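/- Let $V=\mathbb O=\mathbb R\oplus\operatorname{Im}\mathbb O$ be the octonions with the standard metric $g_0$. On $V\oplus V^*$ let $\langle v_1+\eta_1,v_2+\eta_2\rangle=\tfrac12(\eta_1(v_2)+\eta_2(v_1))$, let $\mathrm{CL}$ be the Clifford algebra of $V\oplus V^*$ with $E\cdot E=\langle E,E\rangle$, acting on $\wedge^*V^*$ by $(v+\eta)\cdot\phi=i_v\phi+\eta\wedge\phi$. Write $\tilde g$ for the parity involution. Let $\mathrm{Cpin}$ be the group of invertible $g\in\mathrm{CL}$ such that $\mathrm{Ad}_g(E):=\tilde g^{-1}Eg$ maps $V\oplus V^*$ into itself, and let $\mathrm{CSpin}_0$ be the identity component of $\mathrm{CSpin}=\mathrm{Cpin}\cap\mathrm{CL}^{\mathrm{even}}$. Put $\phi_{G_2}(x,y,z)=\langle xy,z\rangle$ on $\operatorname{Im}\mathbb O$, let $\mathrm{vol}_7$ be the unit volume form of $\operatorname{Im}\mathbb O$ with $i_u\phi_{G_2}\wedge i_v\phi_{G_2}\wedge\phi_{G_2}=6\langle u,v\rangle\,\mathrm{vol}_7$, let $\psi_{G_2}=\star\phi_{G_2}$,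 let $e$ be the unit one-form $x\mapsto \operatorname{Re}x$, and set $$\phi_{\mathrm{Spin}}=e\wedge\phi_{G_2}+\psi_{G_2},\qquad \mathrm{vol}_8=e\wedge\mathrm{vol}_7,\qquad \Phi_{\mathrm{Spin}}=1-\phi_{\mathrm{Spin}}+\mathrm{vol}_8 .$$ Let $G_0$ be the endomorphism of $V\oplus V^*$ that exchanges $V$ and $V^*$ by means of $g_0$. (1) Let $H=\{g\in\mathrm{CSpin}_0 : g\cdot\Phi_{\mathrm{Spin}}=\Phi_{\mathrm{Spin}}\}$. Its identity component $H_0$ is isomorphic, as a topological group, to $\mathrm{Spin}(7)\times\mathrm{Spin}(7)$, and it preserves $G_0$: $\mathrm{Ad}_g\circ G_0=G_0\circ\mathrm{Ad}_g$ for all $g\in H_0$. (2) Let $X$ be a smooth $8$-manifold and let $\Phi$ be a generalized $\mathrm{Spin}(7)$ structure on $X$, i.e. a smooth $d$-closed differential form of mixed degree such that for every $x\in X$ there is a linear isomorphism $h:\mathbb O\to T_xX$ with $h^*\Phi_x\in\mathrm{Cpin}\cdot\Phi_{\mathrm{Spin}}$. Then there is a unique field $G_\Phi$ of endomorphisms of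 $T X\oplus T^*X$ such that, for all $x\in X$, all linear isomorphisms $h:\mathbb O\to T_xX$ and all $g\in\mathrm{Cpin}$ with $\Phi_{\mathrm{Spin}}=g\cdot h^*\Phi_x$, $$(G_\Phi)_x=(\hat h\circ \mathrm{Ad}_g)\circ G_0\circ(\hat h\circ \mathrm{Ad}_g)^{-1},$$ where $\hat h:\mathbb O\oplus\mathbb O^*\to T_xX\oplus T_x^*X$ is induced by $h$. Moreover $G_\Phi$ is a generalized metric on $X$: it is a smooth section of $\mathrm{SO}(TX\oplus T^*X)$ with $G_\Phi^2=1$ and $\langle G_\Phi E,E\rangle>0$ for all $E\neq0$. -/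

import Mathlib

open scoped Manifold ContDiff Quaternion

noncomputable section

namespace GenSpin

/-! ### The Clifford algebra of `V ⊕ V*`, the conformal pin group, the spin representation -/

section LinearAlgebra

variable (V : Type*) [AddCommGroup V] [Module ℝ V]

/-- `V* ⊕ V`, an element being a pair `(η, v)`. -/
abbrev Gen : Type _ := Module.Dual ℝ V × V

/-- The Clifford algebra of `V ⊕ V*` with `E · E = ‖E‖² = η(v)` for `E = v + η`. -/
abbrev Cl : Type _ := CliffordAlgebra (QuadraticForm.dualProd ℝ V)

/-- The inclusion `V ⊕ V* → CL(V ⊕ V*)`. -/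
abbrev incl : Gen V →ₗ[ℝ] Cl V := CliffordAlgebra.ι (QuadraticForm.dualProd ℝ V)

/-- The forms `⋀ V*`. -/
abbrev Forms : Type _ := ExteriorAlgebra ℝ (Module.Dual ℝ V)

variable {V}

/-- The Clifford algebra of a real quadratic form carries the canonical topology of a (finite
dimensional) real vector space. -/
instance cliffordTopology (Q : QuadraticForm ℝ V) : TopologicalSpace (CliffordAlgebra Q) :=
  moduleTopology ℝ _

instance cliffordIsModuleTopology (Q : QuadraticForm ℝ V) :
    IsModuleTopology ℝ (CliffordAlgebra Q) := ⟨rfl⟩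

instance exteriorFinite [FiniteDimensional ℝ V] : Module.Finite ℝ (ExteriorAlgebra ℝ V) :=
  Module.Finite.of_basis (Module.finBasis ℝ V).ExteriorAlgebra

instance cliffordFinite [FiniteDimensional ℝ V] (Q : QuadraticForm ℝ V) :
    Module.Finite ℝ (CliffordAlgebra Q) :=
  Module.Finite.equiv (CliffordAlgebra.equivExterior Q).symm

instance cliffordTopologicalRing [FiniteDimensional ℝ V] (Q : QuadraticForm ℝ V) :
    IsTopologicalRing (CliffordAlgebra Q) := IsModuleTopology.isTopologicalRing ℝ _

theorem incl_injective : Function.Injective (incl V) := by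
  intro x y h
  have h2 := congrArg (CliffordAlgebra.equivExterior (QuadraticForm.dualProd ℝ V)) h
  simpa [CliffordAlgebra.equivExterior, CliffordAlgebra.changeForm_ι] using h2

/-- The twisted adjoint action `α ↦ g̃⁻¹ α g`. -/
def twistedAd (g : (Cl V)ˣ) : Cl V →ₗ[ℝ] Cl V :=
  LinearMap.mulLeft ℝ (CliffordAlgebra.involute (↑g⁻¹ : Cl V)) ∘ₗ LinearMap.mulRight ℝ (g : Cl V)

theorem twistedAd_apply (g : (Cl V)ˣ) (α : Cl V) :
    twistedAd g α = CliffordAlgebra.involute (↑g⁻¹ : Cl V) * (α * g) := rfl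

theorem twistedAd_one (α : Cl V) : twistedAd 1 α = α := by simp [twistedAd_apply]

theorem twistedAd_mul (g h : (Cl V)ˣ) (α : Cl V) :
    twistedAd (g * h) α = twistedAd h (twistedAd g α) := by
  simp [twistedAd_apply, mul_assoc]

theorem twistedAd_injective (g : (Cl V)ˣ) : Function.Injective (twistedAd g) := by
  intro α β h
  have h2 := congrArg (twistedAd g⁻¹) h
  rwa [← twistedAd_mul, ← twistedAd_mul, mul_inv_cancel, twistedAd_one, twistedAd_one] at h2

/-- The endomorphism of `V ⊕ V*` induced by an element whose twisted adjoint action preserves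
`V ⊕ V*`. -/
def adOf (g : (Cl V)ˣ) (hg : ∀ E, twistedAd g (incl V E) ∈ LinearMap.range (incl V)) :
    Gen V →ₗ[ℝ] Gen V :=
  (LinearEquiv.ofInjective (incl V) incl_injective).symm.toLinearMap ∘ₗ
    LinearMap.codRestrict (LinearMap.range (incl V)) (twistedAd g ∘ₗ incl V) hg

theorem incl_adOf (g : (Cl V)ˣ)
    (hg : ∀ E, twistedAd g (incl V E) ∈ LinearMap.range (incl V)) (E : Gen V) :
    incl V (adOf g hg E) = twistedAd g (incl V E) := by
  have h := (LinearEquiv.ofInjective (incl V) incl_injective).apply_symm_apply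
    ⟨twistedAd g (incl V E), hg E⟩
  exact congrArg Subtype.val h

variable (V) in
/-- The conformal pin group: the invertible `g` with `g̃⁻¹ (V ⊕ V*) g ⊆ V ⊕ V*`. -/
def Cpin [FiniteDimensional ℝ V] : Subgroup (Cl V)ˣ where
  carrier := {g | ∀ E, twistedAd g (incl V E) ∈ LinearMap.range (incl V)}
  one_mem' E := by rw [twistedAd_one]; exact ⟨E, rfl⟩
  mul_mem' {g h} hg hh E := by
    obtain ⟨F, hF⟩ := hg E
    rw [twistedAd_mul, ← hF]
    exact hh F
  inv_mem' {g} hg E := by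
    have hinj : Function.Injective (adOf g hg) := by
      intro x y hxy
      have h2 := congrArg (incl V) hxy
      rw [incl_adOf, incl_adOf] at h2
      exact incl_injective (twistedAd_injective g h2)
    obtain ⟨F, hF⟩ := LinearMap.injective_iff_surjective.mp hinj E
    refine ⟨F, ?_⟩
    rw [← hF, incl_adOf, ← twistedAd_mul, mul_inv_cancel, twistedAd_one]

/-- The action `Ad_g E = g̃⁻¹ E g` of the conformal pin group on `V ⊕ V*`. -/
def Ad [FiniteDimensional ℝ V] (g : Cpin V) : Gen V →ₗ[ℝ] Gen V := adOf g.1 g.2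

variable (V) in
/-- The conformal spin group: the even elements of the conformal pin group. -/
def CSpin [FiniteDimensional ℝ V] : Subgroup (Cl V)ˣ :=
  Cpin V ⊓ (CliffordAlgebra.even (QuadraticForm.dualProd ℝ V)).toSubmonoid.units

/-- The connected component of `1` in a subgroup `K` of a topological group, as a subgroup of the
ambient group. -/
def identityComponent {G : Type*} [Group G] [TopologicalSpace G] [IsTopologicalGroup G]
    (K : Subgroup G) : Subgroup G :=
  (Subgroup.connectedComponentOfOne K).map K.subtype

variable (V) in
/-- The identity component `CSpin₀` of the conformal spin group. -/
def CSpin₀ [FiniteDimensional ℝ V] : Subgroup (Cl V)ˣ := identityComponent (CSpin V)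

/-- The Clifford action of a vector on forms: `(v + η) · φ = i_v φ + η ∧ φ`. -/
def cliffordMul : Gen V →ₗ[ℝ] Module.End ℝ (Forms V) where
  toFun E := CliffordAlgebra.contractLeft (Module.Dual.eval ℝ V E.2) +
    LinearMap.mulLeft ℝ (ExteriorAlgebra.ι ℝ E.1)
  map_add' E F := by ext φ; simp [add_mul]; abel
  map_smul' c E := by ext φ; simp

theorem cliffordMul_sq (E : Gen V) :
    cliffordMul E * cliffordMul E =
      algebraMap ℝ (Module.End ℝ (Forms V)) (QuadraticForm.dualProd ℝ V E) := by
  refine LinearMap.ext fun φ => ?_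
  have h1 := CliffordAlgebra.contractLeft_contractLeft (Q := (0 : QuadraticForm ℝ (Module.Dual ℝ V)))
    (Module.Dual.eval ℝ V E.2) φ
  have h2 := CliffordAlgebra.contractLeft_ι_mul (Q := (0 : QuadraticForm ℝ (Module.Dual ℝ V)))
    (Module.Dual.eval ℝ V E.2) E.1 φ
  have h3 : ExteriorAlgebra.ι ℝ E.1 * (ExteriorAlgebra.ι ℝ E.1 * φ) = 0 := by
    rw [← mul_assoc, ExteriorAlgebra.ι_sq_zero, zero_mul]
  change CliffordAlgebra.contractLeft (Module.Dual.eval ℝ V E.2)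
      (CliffordAlgebra.contractLeft (Module.Dual.eval ℝ V E.2) φ + ExteriorAlgebra.ι ℝ E.1 * φ) +
    ExteriorAlgebra.ι ℝ E.1 *
      (CliffordAlgebra.contractLeft (Module.Dual.eval ℝ V E.2) φ + ExteriorAlgebra.ι ℝ E.1 * φ) =
    (E.1 E.2) • φ
  rw [map_add, h1, mul_add, h3]
  erw [h2]
  simp [ExteriorAlgebra.ι]

/-- The spin representation of `CL(V ⊕ V*)` on the forms `⋀ V*`. -/
def spinRep : Cl V →ₐ[ℝ] Module.End ℝ (Forms V) :=
  CliffordAlgebra.lift _ ⟨cliffordMul, cliffordMul_sq⟩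

/-- Pull-back of forms along a linear map. -/
def pullback {W : Type*} [AddCommGroup W] [Module ℝ W] (f : V →ₗ[ℝ] W) : Forms W →ₐ[ℝ] Forms V :=
  ExteriorAlgebra.map f.dualMap

/-- For mutually inverse linear maps `a : V → W` and `b : W → V`, the induced identification
`V* ⊕ V → W* ⊕ W`, `(η, v) ↦ (η ∘ b, a v)`. -/
def genMap {W : Type*} [AddCommGroup W] [Module ℝ W] (a : V →ₗ[ℝ] W) (b : W →ₗ[ℝ] V) :
    Gen V →ₗ[ℝ] Gen W :=
  b.dualMap.prodMap a

/-- A generalized metric on `V`: an element `G` of `SO(V ⊕ V*)` with `G² = 1` such that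
`⟨G E, E⟩` is positive definite. -/
structure IsGeneralizedMetric (G : Gen V →ₗ[ℝ] Gen V) : Prop where
  isometry : ∀ E, QuadraticForm.dualProd ℝ V (G E) = QuadraticForm.dualProd ℝ V E
  det_eq_one : LinearMap.det G = 1
  sq_eq_one : ∀ E, G (G E) = E
  pos : ∀ E, E ≠ 0 → 0 < LinearMap.dualProd ℝ V (G E) E

end LinearAlgebra

/-! ### Octonions and the form `Φ_Spin` -/

/-- The octonions as an oriented Euclidean space, with orthonormal basis `e₀ = 1, e₁, …, e₇`. -/
abbrev Oct : Type := EuclideanSpace ℝ (Fin 8)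

/-- The octonion corresponding to a pair of quaternions. -/
def Oct.ofPair (a b : ℍ[ℝ]) : Oct :=
  !₂[a.re, a.imI, a.imJ, a.imK, b.re, b.imI, b.imJ, b.imK]

def Oct.left (x : Oct) : ℍ[ℝ] := ⟨x 0, x 1, x 2, x 3⟩

def Oct.right (x : Oct) : ℍ[ℝ] := ⟨x 4, x 5, x 6, x 7⟩

/-- Octonion multiplication, by the Cayley-Dickson formula
`(a, b) (c, d) = (a c - d b̄, ā d + c b)`. -/
def Oct.mul (x y : Oct) : Oct :=
  Oct.ofPair (x.left * y.left - y.right * star x.right) (star x.left * y.right + y.left * x.right)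

/-- The basis vector `eᵢ` of the octonions. -/
def basisVec (i : Fin 8) : Oct := EuclideanSpace.single i 1

/-- The one-form dual to `eᵢ`; `dualForm 0` is the unit one-form on the real part. -/
def dualForm (i : Fin 8) : Forms Oct :=
  ExteriorAlgebra.ι ℝ (EuclideanSpace.proj i : Oct →L[ℝ] ℝ).toLinearMap

/-- The 3-form `φ_{G₂}(x, y, z) = ⟨x y, z⟩` on `Im 𝕆` (pulled back to `𝕆` by the projection). -/
def phiG2 : Forms Oct :=
  ∑ i : Fin 7, ∑ j : Fin 7, ∑ k : Fin 7,
    if i < j ∧ j < k then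
      inner ℝ (Oct.mul (basisVec i.succ) (basisVec j.succ)) (basisVec k.succ) •
        (dualForm i.succ * dualForm j.succ * dualForm k.succ)
    else 0

/-- The volume form `e¹ ∧ ⋯ ∧ e⁷` of `Im 𝕆`. It gives the orientation determined by `φ_{G₂}`,
i.e. `i_u φ_{G₂} ∧ i_v φ_{G₂} ∧ φ_{G₂} = 6 ⟨u, v⟩ vol₇`. -/
def vol7 : Forms Oct :=
  dualForm 1 * dualForm 2 * dualForm 3 * dualForm 4 * dualForm 5 * dualForm 6 * dualForm 7

/-- The volume form of `𝕆 = ℝ ⊕ Im 𝕆`. -/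
def vol8 : Forms Oct := dualForm 0 * vol7

/-- The metric isomorphism `𝕆 → 𝕆*`, `v ↦ ⟨v, ·⟩`. -/
def flatMap : Oct ≃ₗ[ℝ] Module.Dual ℝ Oct :=
  LinearEquiv.ofBijective (innerₗ Oct) (by
    have h : Function.Injective (innerₗ Oct) := fun x y hxy =>
      ext_inner_right ℝ fun z => by simpa using LinearMap.congr_fun hxy z
    exact ⟨h, (LinearMap.injective_iff_surjective_of_finrank_eq_finrank
      Subspace.dual_finrank_eq.symm).mp h⟩)

/-- The contraction of forms with multivectors (written as forms by means of the metric), in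
reversed order: `a₁ ∧ ⋯ ∧ aₚ` acts as `i_{aₚ} ∘ ⋯ ∘ i_{a₁}`. -/
def multiContract : Forms Oct →ₐ[ℝ] (Module.End ℝ (Forms Oct))ᵐᵒᵖ :=
  ExteriorAlgebra.lift ℝ
    ⟨(MulOpposite.opLinearEquiv ℝ).toLinearMap ∘ₗ CliffordAlgebra.contractLeft ∘ₗ
      Module.Dual.eval ℝ Oct ∘ₗ flatMap.symm.toLinearMap, fun a => by
        apply MulOpposite.unop_injective
        ext φ
        exact CliffordAlgebra.contractLeft_contractLeft _ _⟩

/-- The Hodge star operator with respect to the volume form `vol`: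
`⋆ (a₁ ∧ ⋯ ∧ aₚ) = i_{aₚ} ⋯ i_{a₁} vol`. -/
def hodgeStar (vol α : Forms Oct) : Forms Oct := (multiContract α).unop vol

/-- `ψ_{G₂} = ⋆ φ_{G₂}`, the Hodge star being that of `Im 𝕆`. -/
def psiG2 : Forms Oct := hodgeStar vol7 phiG2

/-- The Cayley form `φ_Spin`. -/
def phiSpin : Forms Oct := dualForm 0 * phiG2 + psiG2

/-- `Φ_Spin = 1 - φ_Spin + vol₈`. -/
def PhiSpin : Forms Oct := 1 - phiSpin + vol8

/-- The generalized metric `G₀ = (0, g₀*; g₀, 0)` of the octonions. -/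
def G₀ : Gen Oct →ₗ[ℝ] Gen Oct :=
  (flatMap.toLinearMap ∘ₗ LinearMap.snd ℝ _ _).prod (flatMap.symm.toLinearMap ∘ₗ LinearMap.fst ℝ _ _)

/-- The isotropy group of `Φ_Spin` in `CSpin₀`. -/
def isotropy : Subgroup (Cl Oct)ˣ where
  carrier := {g | g ∈ CSpin₀ Oct ∧ spinRep (g : Cl Oct) PhiSpin = PhiSpin}
  one_mem' := ⟨one_mem _, by simp⟩
  mul_mem' {g h} hg hh := ⟨mul_mem hg.1 hh.1, by
    rw [Units.val_mul, map_mul, Module.End.mul_apply, hh.2, hg.2]⟩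
  inv_mem' {g} hg := ⟨inv_mem hg.1, by
    conv_lhs => rw [← hg.2]
    rw [← Module.End.mul_apply, ← map_mul, Units.inv_mul, map_one, Module.End.one_apply]⟩

/-- The identity component `H₀` of the isotropy group. -/
def H₀ : Subgroup (Cl Oct)ˣ := identityComponent isotropy

theorem CSpin₀_le_Cpin : CSpin₀ Oct ≤ Cpin Oct := by
  rintro _ ⟨g, -, rfl⟩
  exact g.2.1

theorem H₀_le_Cpin : H₀ ≤ Cpin Oct := by
  rintro _ ⟨g, -, rfl⟩
  exact CSpin₀_le_Cpin g.2.1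

/-- The standard positive definite quadratic form on `ℝ⁷`. -/
def euclid7 : QuadraticForm ℝ (Fin 7 → ℝ) := QuadraticMap.weightedSumSquares ℝ fun _ => (1 : ℝ)

/-- The compact group `Spin(7)`. -/
abbrev Spin7 : Type := spinGroup euclid7

/-! ### Generalized `Spin(7)` structures on 8-manifolds -/

section Manifold

variable {X : Type*} [TopologicalSpace X] [ChartedSpace Oct X]

/-- The (not necessarily continuous) mixed degree differential forms on `X`. -/
abbrev FormField (X : Type*) [TopologicalSpace X] [ChartedSpace Oct X] : Type _ :=
  ∀ x : X, Forms (TangentSpace (𝓡 8) x)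

/-- The (not necessarily continuous) fields of endomorphisms of `T ⊕ T*`. -/
abbrev GenEndField (X : Type*) [TopologicalSpace X] [ChartedSpace Oct X] : Type _ :=
  ∀ x : X, Gen (TangentSpace (𝓡 8) x) →ₗ[ℝ] Gen (TangentSpace (𝓡 8) x)

/-- The differential of a chart at the point with coordinates `y`. -/
def chartD (e : OpenPartialHomeomorph X Oct) (y : Oct) :
    TangentSpace (𝓡 8) (e.symm y) →ₗ[ℝ] Oct :=
  (mfderiv (𝓡 8) 𝓘(ℝ, Oct) e (e.symm y)).toLinearMap

/-- The differential of the inverse of a chart at the point with coordinates `y`. -/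
def chartSymmD (e : OpenPartialHomeomorph X Oct) (y : Oct) :
    Oct →ₗ[ℝ] TangentSpace (𝓡 8) (e.symm y) :=
  (mfderiv 𝓘(ℝ, Oct) (𝓡 8) e.symm y).toLinearMap

/-- A field of forms, read in a chart. -/
def FormField.inChart (Φ : FormField X) (e : OpenPartialHomeomorph X Oct) (y : Oct) : Forms Oct :=
  pullback (chartSymmD e y) (Φ (e.symm y))

/-- A field of endomorphisms of `T ⊕ T*`, read in a chart. -/
def GenEndField.inChart (G : GenEndField X) (e : OpenPartialHomeomorph X Oct) (y : Oct) :
    Gen Oct →ₗ[ℝ] Gen Oct :=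
  genMap (chartD e y) (chartSymmD e y) ∘ₗ G (e.symm y) ∘ₗ genMap (chartSymmD e y) (chartD e y)

/-- Smoothness of a differential form: its components in every chart are smooth. -/
def FormField.IsSmooth (Φ : FormField X) : Prop :=
  ∀ e ∈ atlas Oct X, ∀ c : Module.Dual ℝ (Forms Oct),
    ContDiffOn ℝ ∞ (fun y => c (Φ.inChart e y)) e.target

/-- Smoothness of a section of `End (T ⊕ T*)`: its components in every chart are smooth. -/
def GenEndField.IsSmooth (G : GenEndField X) : Prop :=
  ∀ e ∈ atlas Oct X, ∀ c : Module.Dual ℝ (Gen Oct →ₗ[ℝ] Gen Oct),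
    ContDiffOn ℝ ∞ (fun y => c (G.inChart e y)) e.target

/-- `dΦ = 0`: in every chart, all components of `dΦ = ∑ᵢ dyⁱ ∧ ∂ᵢ Φ = ∑ᵢ ∂ᵢ (dyⁱ ∧ Φ)` vanish. -/
def FormField.IsClosed (Φ : FormField X) : Prop :=
  ∀ e ∈ atlas Oct X, ∀ y ∈ e.target, ∀ c : Module.Dual ℝ (Forms Oct),
    ∑ i : Fin 8, fderiv ℝ (fun z => c (dualForm i * Φ.inChart e z)) y (basisVec i) = 0

/-- The orbit of `Φ_Spin` under the conformal pin group. -/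
def orbitSpin : Set (Forms Oct) := {α | ∃ g ∈ Cpin Oct, α = spinRep (g : Cl Oct) PhiSpin}

/-- A generalized `Spin(7)` structure: a closed smooth form which at every point corresponds, under
an identification `𝕆 ≅ T_x X`, to an element of the orbit of `Φ_Spin`. -/
structure IsGeneralizedSpin7 (Φ : FormField X) : Prop where
  smooth : Φ.IsSmooth
  closed : Φ.IsClosed
  mem_orbit : ∀ x, ∃ h : Oct ≃ₗ[ℝ] TangentSpace (𝓡 8) x,
    pullback h.toLinearMap (Φ x) ∈ orbitSpin

/-- `G` is, at every point, the generalized metric induced from `G₀` by `Φ`: for every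
identification `h : 𝕆 ≅ T_x X`, with induced `ĥ : 𝕆* ⊕ 𝕆 ≅ T_x* X ⊕ T_x X`, and every `g` in the
conformal pin group with `Φ_Spin = g · h^* Φ_x`, one has `G_x = (ĥ ∘ Ad_g) G₀ (ĥ ∘ Ad_g)⁻¹`. -/
def IsInducedBy (G : GenEndField X) (Φ : FormField X) : Prop :=
  ∀ (x : X) (h : Oct ≃ₗ[ℝ] TangentSpace (𝓡 8) x) (g : Cpin Oct),
    PhiSpin = spinRep (g.1 : Cl Oct) (pullback h.toLinearMap (Φ x)) →
      G x ∘ₗ genMap h.toLinearMap h.symm.toLinearMap ∘ₗ Ad g =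
        genMap h.toLinearMap h.symm.toLinearMap ∘ₗ Ad g ∘ₗ G₀

end Manifold

end GenSpin

end

noncomputable section

namespace GenSpin

/-! ### Octonion algebra -/

/-! Let C₊ and C₋ be the ±1 eigenspaces of G₀, that is, the graphs of ±g₀; `genEmb ε` parametrizes
them, and the Clifford algebra of V ⊕ V* is generated by the two graded-commuting images of `octMap
1` and `octMap (-1)`. For ε = ±1 the algebra of (𝕆, ε‖u‖²) acts on 𝕆 ⊕ 𝕆 through octonion
multiplication and is the full matrix algebra (`octRep_bijective`). The decisive fact is that Φ_Spin
behaves like the product of two copies of the spinor (1, 0), one for each sign: `spinorProj ε`,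
sixteen times the projection onto that spinor, multiplies Φ_Spin by 16 for both signs. Hence y ·
Φ_Spin depends only, and injectively, on y · (1, 0) (`spinRep_octMap_congr`,
`spinRep_octMap_injective`).

Invariance of G₀. A quadratic Clifford element that kills Φ_Spin has no component in C₊ ⊗ C₋
(`annihilator_decomp`), so its bracket preserves C₊ and C₋. If g fixes Φ_Spin, conjugation by g
preserves these annihilators. Let w be the C₋ component of an element of Ad_g C₊. Bracketing with an
annihilator taken from the algebra of C₋ gives a vector lying both in C₋ and in Ad_g C₊, where the
quadratic form has opposite signs; it vanishes. The annihilators have no common kernel, so w = 0.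
The argument is symmetric in the sign and holds for the whole stabilizer in Cpin (`Ad_comp_G₀`).

The group H₀. An even stabilizing element conjugates C₊ and C₋ by orthogonal maps A of 𝕆 with A(xu)
= π(x) A(u) (`even_stabilizer_conj`). Writing the isometry π as a product of reflections shows that
such A are exactly the spin transformations of Spin(7) (`isSpin7_evenRep`, `exists_of_isSpin7`).
Conversely a pair of them lifts to CL and fixes Φ_Spin; as Spin(7) is connected, the lift lies in
H₀. A stabilizing element is determined by its conjugation action (`eq_of_conj_eq`), and the pair is
recovered continuously from g and g⁻¹.

The metric of a structure. Pull-back by a linear isomorphism is the action of an element of Cpin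
(`exists_cpin_pullback`), so two admissible choices of (h, g) differ by a stabilizing element and
induce the same endomorphism. For smoothness no smooth choice of g is made; instead G is
characterized by linear equations with coefficients smooth in Φ. A pairing on forms, invariant up to
scale, turns a form α into a 4-form `rho α` on V ⊕ V*, which for Φ_Spin is the Cayley form on each
of C₊ and C₋ and has no mixed terms. The endomorphisms A with ρ(AE, F, G, H) = ρ(E, AF, G, H) are
then exactly the span of 1 and G. Vanishing trace and one normalization single out a positive
multiple of G, which is smooth by Cramer's rule; G² = 1 recovers the factor
(`contDiffOn_inducedMetric`). -/

@[simp] theorem Oct.left_re (x : Oct) : x.left.re = x 0 := rfl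
@[simp] theorem Oct.left_imI (x : Oct) : x.left.imI = x 1 := rfl
@[simp] theorem Oct.left_imJ (x : Oct) : x.left.imJ = x 2 := rfl
@[simp] theorem Oct.left_imK (x : Oct) : x.left.imK = x 3 := rfl
@[simp] theorem Oct.right_re (x : Oct) : x.right.re = x 4 := rfl
@[simp] theorem Oct.right_imI (x : Oct) : x.right.imI = x 5 := rfl
@[simp] theorem Oct.right_imJ (x : Oct) : x.right.imJ = x 6 := rfl
@[simp] theorem Oct.right_imK (x : Oct) : x.right.imK = x 7 := rfl

theorem Oct.mul_coords (x y : Oct) : Oct.mul x y =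
    !₂[x 0 * y 0 - x 1 * y 1 - x 2 * y 2 - x 3 * y 3 - x 4 * y 4 - x 5 * y 5 - x 6 * y 6 - x 7 * y 7,
      x 0 * y 1 + x 1 * y 0 + x 2 * y 3 - x 3 * y 2 - x 4 * y 5 + x 5 * y 4 - x 6 * y 7 + x 7 * y 6,
      x 0 * y 2 - x 1 * y 3 + x 2 * y 0 + x 3 * y 1 - x 4 * y 6 + x 5 * y 7 + x 6 * y 4 - x 7 * y 5,
      x 0 * y 3 + x 1 * y 2 - x 2 * y 1 + x 3 * y 0 - x 4 * y 7 - x 5 * y 6 + x 6 * y 5 + x 7 * y 4,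
      x 0 * y 4 + x 1 * y 5 + x 2 * y 6 + x 3 * y 7 + x 4 * y 0 - x 5 * y 1 - x 6 * y 2 - x 7 * y 3,
      x 0 * y 5 - x 1 * y 4 - x 2 * y 7 + x 3 * y 6 + x 4 * y 1 + x 5 * y 0 - x 6 * y 3 + x 7 * y 2,
      x 0 * y 6 + x 1 * y 7 - x 2 * y 4 - x 3 * y 5 + x 4 * y 2 + x 5 * y 3 + x 6 * y 0 - x 7 * y 1,
      x 0 * y 7 - x 1 * y 6 + x 2 * y 5 - x 3 * y 4 + x 4 * y 3 - x 5 * y 2 + x 6 * y 1 + x 7 * y 0] := by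
  ext i
  fin_cases i <;>
    simp [Oct.mul, Oct.ofPair] <;> ring

/-- Octonion multiplication as a bilinear map. -/
def Oct.mulₗ : Oct →ₗ[ℝ] Oct →ₗ[ℝ] Oct :=
  LinearMap.mk₂ ℝ Oct.mul
    (fun x y z => by ext i; fin_cases i <;> simp [Oct.mul_coords] <;> ring)
    (fun c x y => by ext i; fin_cases i <;> simp [Oct.mul_coords] <;> ring)
    (fun x y z => by ext i; fin_cases i <;> simp [Oct.mul_coords] <;> ring)
    (fun c x y => by ext i; fin_cases i <;> simp [Oct.mul_coords] <;> ring)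

@[simp] theorem Oct.mulₗ_apply (x y : Oct) : Oct.mulₗ x y = Oct.mul x y := rfl

theorem Oct.add_mul (x y z : Oct) : Oct.mul (x + y) z = Oct.mul x z + Oct.mul y z :=
  LinearMap.map_add₂ Oct.mulₗ x y z
theorem Oct.mul_add (x y z : Oct) : Oct.mul x (y + z) = Oct.mul x y + Oct.mul x z :=
  map_add (Oct.mulₗ x) y z
theorem Oct.smul_mul (c : ℝ) (x y : Oct) : Oct.mul (c • x) y = c • Oct.mul x y :=
  LinearMap.map_smul₂ Oct.mulₗ c x y
theorem Oct.mul_smul (c : ℝ) (x y : Oct) : Oct.mul x (c • y) = c • Oct.mul x y :=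
  map_smul (Oct.mulₗ x) c y

/-- Octonion conjugation. -/
def Oct.conj : Oct →ₗ[ℝ] Oct where
  toFun x := !₂[x 0, -x 1, -x 2, -x 3, -x 4, -x 5, -x 6, -x 7]
  map_add' x y := by ext i; fin_cases i <;> simp <;> ring
  map_smul' c x := by ext i; fin_cases i <;> simp

theorem Oct.conj_coords (x : Oct) :
    Oct.conj x = !₂[x 0, -x 1, -x 2, -x 3, -x 4, -x 5, -x 6, -x 7] := rfl

/-- The octonion `1`. -/
abbrev Oct.one : Oct := basisVec 0

theorem inner_coords (x y : Oct) : inner ℝ x y = x 0 * y 0 + x 1 * y 1 + x 2 * y 2 + x 3 * y 3 +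
    x 4 * y 4 + x 5 * y 5 + x 6 * y 6 + x 7 * y 7 := by
  simp [PiLp.inner_apply, Fin.sum_univ_eight]; ring

theorem basisVec_apply (i j : Fin 8) : basisVec i j = if j = i then 1 else 0 := by
  simp [basisVec]

theorem Oct.one_mul (x : Oct) : Oct.mul Oct.one x = x := by
  ext i; fin_cases i <;> simp [Oct.mul_coords, basisVec_apply]
theorem Oct.mul_one (x : Oct) : Oct.mul x Oct.one = x := by
  ext i; fin_cases i <;> simp [Oct.mul_coords, basisVec_apply]
theorem Oct.conj_one : Oct.conj Oct.one = Oct.one := by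
  ext i; fin_cases i <;> simp [Oct.conj_coords, basisVec_apply]
theorem Oct.conj_conj (x : Oct) : Oct.conj (Oct.conj x) = x := by
  ext i; fin_cases i <;> simp [Oct.conj_coords]
theorem Oct.conj_mul (x y : Oct) : Oct.conj (Oct.mul x y) = Oct.mul (Oct.conj y) (Oct.conj x) := by
  ext i; fin_cases i <;> simp [Oct.mul_coords, Oct.conj_coords] <;> ring
theorem Oct.inner_conj (x y : Oct) : inner ℝ (Oct.conj x) (Oct.conj y) = inner ℝ x y := by
  simp [inner_coords, Oct.conj_coords]

/-- Alternativity, in the form that makes right multiplications a Clifford module: it is the only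
input for `octRep` to respect the Clifford relation. -/
theorem Oct.mul_mul_conj (x u : Oct) :
    Oct.mul (Oct.mul x u) (Oct.conj u) = inner ℝ u u • x := by
  ext i
  fin_cases i <;> simp [Oct.mul_coords, Oct.conj_coords, inner_coords, -inner_self_eq_norm_sq_to_K] <;> ring

theorem Oct.mul_conj_mul (x u : Oct) :
    Oct.mul (Oct.mul x (Oct.conj u)) u = inner ℝ u u • x := by
  simpa [Oct.conj_conj, Oct.inner_conj, -inner_self_eq_norm_sq_to_K] using Oct.mul_mul_conj x (Oct.conj u)

theorem Oct.conj_mul_mul (u x : Oct) :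
    Oct.mul (Oct.conj u) (Oct.mul u x) = inner ℝ u u • x := by
  simpa [Oct.conj_mul, Oct.conj_conj, Oct.inner_conj, -inner_self_eq_norm_sq_to_K] using
    congrArg Oct.conj (Oct.mul_mul_conj (Oct.conj x) (Oct.conj u))

theorem Oct.inner_mul_mul_right (x y u : Oct) :
    inner ℝ (Oct.mul x u) (Oct.mul y u) = inner ℝ u u * inner ℝ x y := by
  simp [Oct.mul_coords, inner_coords, -inner_self_eq_norm_sq_to_K]; ring

theorem Oct.inner_mul_mul_left (u x y : Oct) :
    inner ℝ (Oct.mul u x) (Oct.mul u y) = inner ℝ u u * inner ℝ x y := by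
  simp [Oct.mul_coords, inner_coords, -inner_self_eq_norm_sq_to_K]; ring

theorem Oct.inner_mul_left (u x y : Oct) :
    inner ℝ (Oct.mul u x) y = inner ℝ x (Oct.mul (Oct.conj u) y) := by
  simp [Oct.mul_coords, inner_coords, Oct.conj_coords]; ring

/-- The imaginary octonion with given components. -/
def Oct.im : (Fin 7 → ℝ) →ₗ[ℝ] Oct where
  toFun v := !₂[0, v 0, v 1, v 2, v 3, v 4, v 5, v 6]
  map_add' v w := by ext i; fin_cases i <;> simp
  map_smul' c v := by ext i; fin_cases i <;> simp

theorem Oct.im_coords (v : Fin 7 → ℝ) :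
    Oct.im v = !₂[0, v 0, v 1, v 2, v 3, v 4, v 5, v 6] := rfl

theorem Oct.conj_im (v : Fin 7 → ℝ) : Oct.conj (Oct.im v) = -Oct.im v := by
  ext i; fin_cases i <;> simp [Oct.conj_coords, Oct.im_coords]

theorem Oct.im_injective : Function.Injective Oct.im := by
  intro v w h
  ext i
  have := congrArg (fun x : Oct => x i.succ) h
  fin_cases i <;> simpa [Oct.im_coords] using this

theorem Oct.inner_im (v w : Fin 7 → ℝ) : inner ℝ (Oct.im v) (Oct.im w) = ∑ i, v i * w i := by
  simp [inner_coords, Oct.im_coords, Fin.sum_univ_seven]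

theorem Oct.exists_im (x : Oct) : ∃ v, x = x 0 • Oct.one + Oct.im v := by
  refine ⟨fun i => x i.succ, ?_⟩
  ext i; fin_cases i <;> simp [Oct.im_coords, basisVec_apply]

theorem euclid7_apply (v : Fin 7 → ℝ) : euclid7 v = inner ℝ (Oct.im v) (Oct.im v) := by
  simp [euclid7, Oct.inner_im, QuadraticMap.weightedSumSquares_apply, -inner_self_eq_norm_sq_to_K]

end GenSpin

/-! ### General facts on Clifford algebras and matrix algebras -/

theorem ExteriorAlgebra.finrank_eq {K M : Type*} [Field K] [AddCommGroup M] [Module K M]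
    [FiniteDimensional K M] :
    Module.finrank K (ExteriorAlgebra K M) = 2 ^ Module.finrank K M := by
  rw [Module.finrank_eq_card_basis (Module.finBasis K M).ExteriorAlgebra]
  simp

theorem CliffordAlgebra.finrank_eq {K M : Type*} [Field K] [Invertible (2 : K)] [AddCommGroup M]
    [Module K M] [FiniteDimensional K M] (Q : QuadraticForm K M) :
    Module.finrank K (CliffordAlgebra Q) = 2 ^ Module.finrank K M := by
  rw [(CliffordAlgebra.equivExterior Q).finrank_eq, ExteriorAlgebra.finrank_eq]

theorem CliffordAlgebra.map_contractLeft {R M N : Type*} [CommRing R] [AddCommGroup M] [Module R M]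
    [AddCommGroup N] [Module R N] {Q : QuadraticForm R M} {Q' : QuadraticForm R N} (f : Q →qᵢ Q')
    (d : Module.Dual R N) (x : CliffordAlgebra Q) :
    CliffordAlgebra.map f (contractLeft (d ∘ₗ f.toLinearMap) x) =
      contractLeft d (CliffordAlgebra.map f x) := by
  induction x using CliffordAlgebra.left_induction with
  | algebraMap r => simp
  | add x y hx hy => simp [hx, hy]
  | ι_mul x m hx => simp [contractLeft_ι_mul, hx]

theorem CliffordAlgebra.changeForm_map {R M N : Type*} [CommRing R] [AddCommGroup M] [Module R M]
    [AddCommGroup N] [Module R N] {Q₁ Q₁' : QuadraticForm R M} {Q₂ Q₂' : QuadraticForm R N}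
    {B₁ : LinearMap.BilinForm R M} {B₂ : LinearMap.BilinForm R N}
    (h₁ : B₁.toQuadraticMap = Q₁' - Q₁) (h₂ : B₂.toQuadraticMap = Q₂' - Q₂)
    (f : Q₁ →qᵢ Q₂) (f' : Q₁' →qᵢ Q₂') (hf : f.toLinearMap = f'.toLinearMap)
    (hB : ∀ m m', B₁ m m' = B₂ (f m) (f m')) (x : CliffordAlgebra Q₁) :
    changeForm h₂ (CliffordAlgebra.map f x) = CliffordAlgebra.map f' (changeForm h₁ x) := by
  have hf' : ∀ m, f m = f' m := fun m => LinearMap.congr_fun hf m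
  induction x using CliffordAlgebra.left_induction with
  | algebraMap r => simp
  | add x y hx hy => simp [hx, hy]
  | ι_mul x m hx =>
    have : B₁ m = B₂ (f m) ∘ₗ f'.toLinearMap := by
      ext m'; rw [hB, hf' m']; rfl
    rw [map_mul, map_apply_ι, changeForm_ι_mul, changeForm_ι_mul, hx, map_sub, map_mul,
      map_apply_ι, this, map_contractLeft, hf' m]

/-- With 2 invertible, the linear identification with the exterior algebra is natural for
isometries, so injectivity reduces to that of exterior powers of an injective linear map over a
field. -/
theorem CliffordAlgebra.map_injective {K M N : Type*} [Field K] [Invertible (2 : K)]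
    [AddCommGroup M] [Module K M] [AddCommGroup N] [Module K N] {Q : QuadraticForm K M}
    {Q' : QuadraticForm K N} (f : Q →qᵢ Q') (hf : Function.Injective f) :
    Function.Injective (CliffordAlgebra.map f) := by
  have key : ∀ x, CliffordAlgebra.equivExterior Q' (CliffordAlgebra.map f x) =
      ExteriorAlgebra.map f.toLinearMap (CliffordAlgebra.equivExterior Q x) := by
    intro x
    exact changeForm_map changeForm.associated_neg_proof changeForm.associated_neg_proof f
      (⟨f.toLinearMap, fun _ => rfl⟩ : (0 : QuadraticForm K M) →qᵢ (0 : QuadraticForm K N)) rfl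
      (fun m m' => by simp [QuadraticMap.associated_apply, ← map_add]) x
  intro x y hxy
  have h := key x
  rw [hxy, key y] at h
  exact (CliffordAlgebra.equivExterior Q).injective
    (ExteriorAlgebra.map_injective_field (LinearMap.ker_eq_bot.mpr hf) h).symm

/-- A subalgebra of `End F` that contains a rank one operator `v ⊗ l`, with `v` cyclic and `l`
cocyclic, is everything. -/
theorem Subalgebra.eq_top_of_rankOne {K F : Type*} [Field K] [AddCommGroup F] [Module K F]
    [FiniteDimensional K F] (A : Subalgebra K (Module.End K F)) (v : F) (l : Module.Dual K F)
    (hT : l.smulRight v ∈ A) (hv : ∀ w, ∃ a ∈ A, a v = w)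
    (hl : ∀ w, (∀ a ∈ A, l (a w) = 0) → w = 0) : A = ⊤ := by
  -- Since b ∘ (v ⊗ l) ∘ a = (b v) ⊗ (l ∘ a), cyclicity of v puts an arbitrary vector in the first
  -- slot.
  have h1 : ∀ (w : F), ∀ a ∈ A, (l ∘ₗ a).smulRight w ∈ A := by
    intro w a ha
    obtain ⟨b, hb, rfl⟩ := hv w
    have : (l ∘ₗ a).smulRight (b v) = b * (l.smulRight v) * a := by ext; simp
    rw [this]
    exact mul_mem (mul_mem hb hT) ha
  let W : Submodule K (Module.Dual K F) :=
    { carrier := {m | ∃ a ∈ A, m = l ∘ₗ a}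
      zero_mem' := ⟨0, zero_mem _, by simp⟩
      add_mem' := by
        rintro _ _ ⟨a, ha, rfl⟩ ⟨b, hb, rfl⟩
        exact ⟨a + b, add_mem ha hb, by ext; simp⟩
      smul_mem' := by
        rintro c _ ⟨a, ha, rfl⟩
        exact ⟨c • a, A.smul_mem ha c, by ext; simp⟩ }
  -- Cocyclicity says that the functionals l ∘ a have no common zero, so in finite dimension they
  -- fill the dual.
  have hW : W = ⊤ := by
    have : W.dualCoannihilator = ⊥ := by
      rw [Submodule.eq_bot_iff]
      intro w hw
      rw [Submodule.mem_dualCoannihilator] at hw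
      exact hl w fun a ha => hw _ ⟨a, ha, rfl⟩
    have h2 := Subspace.dualCoannihilator_dualAnnihilator_eq (W := W)
    rw [← h2, this, Submodule.dualAnnihilator_bot]
  have h3 : ∀ (m : Module.Dual K F) (w : F), m.smulRight w ∈ A := by
    intro m w
    obtain ⟨a, ha, rfl⟩ : m ∈ W := hW ▸ Submodule.mem_top
    exact h1 w a ha
  rw [Algebra.eq_top_iff]
  intro f
  have : f = ∑ i, ((Module.finBasis K F).coord i).smulRight (f (Module.finBasis K F i)) := by
    refine (Module.finBasis K F).ext fun j => ?_
    simp [LinearMap.sum_apply, Finsupp.single_apply, ite_smul]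
  rw [this]
  exact sum_mem fun i _ => h3 _ _

theorem CliffordAlgebra.map_involute_eq_conj {R M A : Type*} [CommRing R] [AddCommGroup M]
    [Module R M] {Q : QuadraticForm R M} [Ring A] [Algebra R A] (f : CliffordAlgebra Q →ₐ[R] A)
    (γ : A) (hγ : γ * γ = 1) (h : ∀ m, γ * f (ι Q m) * γ = -f (ι Q m)) (x : CliffordAlgebra Q) :
    f (involute x) = γ * f x * γ := by
  induction x using CliffordAlgebra.induction with
  | algebraMap r =>
    rw [AlgHom.commutes, AlgHom.commutes, ← Algebra.commutes, mul_assoc, hγ, mul_one]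
  | ι m => rw [involute_ι, map_neg, h]
  | mul x y hx hy =>
    rw [map_mul, map_mul, hx, hy, map_mul,
      show γ * f x * γ * (γ * f y * γ) = γ * f x * (γ * γ) * f y * γ by noncomm_ring, hγ]
    noncomm_ring
  | add x y hx hy =>
    rw [map_add, map_add, hx, hy, map_add]
    noncomm_ring

namespace GenSpin

/-! ### The spin representation of the Clifford algebra of `𝕆` -/

/-- The quadratic form `ε ‖u‖²` on the octonions. -/
def normForm (ε : ℝ) : QuadraticForm ℝ Oct :=
  LinearMap.BilinMap.toQuadraticMap (ε • innerₗ Oct)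

theorem normForm_apply (ε : ℝ) (u : Oct) : normForm ε u = ε * inner ℝ u u := rfl

theorem normForm_polar (ε : ℝ) (u w : Oct) :
    QuadraticMap.polar (normForm ε) u w = 2 * ε * inner ℝ u w := by
  simp only [QuadraticMap.polar, normForm_apply, inner_add_left, inner_add_right,
    real_inner_comm u w]
  ring

/-- Clifford multiplication by an octonion on the spinors `𝕆 ⊕ 𝕆`:
`u · (x, y) = (ε y ū, x u)`. -/
def octClifford (ε : ℝ) : Oct →ₗ[ℝ] Module.End ℝ (Oct × Oct) where
  toFun u :=
    { toFun := fun p => (ε • Oct.mul p.2 (Oct.conj u), Oct.mul p.1 u)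
      map_add' := fun p q => by simp [Oct.add_mul]
      map_smul' := fun c p => by simp [Oct.smul_mul, smul_comm c ε] }
  map_add' u w := by
    refine LinearMap.ext fun p => ?_
    simp [Oct.mul_add]
  map_smul' c u := by
    refine LinearMap.ext fun p => ?_
    simp [Oct.mul_smul, smul_comm c ε]

theorem octClifford_apply (ε : ℝ) (u : Oct) (p : Oct × Oct) :
    octClifford ε u p = (ε • Oct.mul p.2 (Oct.conj u), Oct.mul p.1 u) := rfl

/-- The spin representation of the Clifford algebra of `(𝕆, ε ‖u‖²)`. -/
def octRep (ε : ℝ) : CliffordAlgebra (normForm ε) →ₐ[ℝ] Module.End ℝ (Oct × Oct) :=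
  CliffordAlgebra.lift _ ⟨octClifford ε, fun u => by
    refine LinearMap.ext fun p => ?_
    simp only [Module.End.mul_apply, octClifford_apply, Oct.smul_mul, Oct.mul_mul_conj,
      Oct.mul_conj_mul, Module.algebraMap_end_apply, normForm_apply, smul_smul]
    rfl⟩

theorem octRep_ι (ε : ℝ) (u : Oct) (p : Oct × Oct) :
    octRep ε (CliffordAlgebra.ι _ u) p = (ε • Oct.mul p.2 (Oct.conj u), Oct.mul p.1 u) := by
  simp [octRep, octClifford_apply]

/-- The product of four basis vectors. -/
def quad (ε : ℝ) (i j k l : Fin 8) : CliffordAlgebra (normForm ε) :=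
  CliffordAlgebra.ι _ (basisVec i) * CliffordAlgebra.ι _ (basisVec j) *
    CliffordAlgebra.ι _ (basisVec k) * CliffordAlgebra.ι _ (basisVec l)

/-- Sixteen times the projection onto the spinor `(1, 0)`. -/
def spinorProj (ε : ℝ) : CliffordAlgebra (normForm ε) :=
  (1 - quad ε 0 1 2 3) * (1 + quad ε 0 1 4 5) * (1 - quad ε 4 5 6 7) * (1 + quad ε 0 2 4 6)

/-- The four products entering `spinorProj` act by diagonal sign matrices, and the signs do not
depend on ε. -/
theorem octRep_quad_0123 {ε : ℝ} (hε : ε * ε = 1) (x y : Oct) : octRep ε (quad ε 0 1 2 3) (x, y) =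
    (!₂[-x 0, -x 1, -x 2, -x 3, x 4, x 5, x 6, x 7],
      !₂[y 0, y 1, y 2, y 3, -y 4, -y 5, -y 6, -y 7]) := by
  simp only [quad, map_mul, Module.End.mul_apply, octRep_ι, Oct.smul_mul, smul_smul, hε, one_smul]
  ext i <;> fin_cases i <;> simp [Oct.mul_coords, Oct.conj_coords, basisVec_apply]

theorem octRep_quad_0145 {ε : ℝ} (hε : ε * ε = 1) (x y : Oct) : octRep ε (quad ε 0 1 4 5) (x, y) =
    (!₂[x 0, x 1, -x 2, -x 3, x 4, x 5, -x 6, -x 7],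
      !₂[-y 0, -y 1, y 2, y 3, -y 4, -y 5, y 6, y 7]) := by
  simp only [quad, map_mul, Module.End.mul_apply, octRep_ι, Oct.smul_mul, smul_smul, hε, one_smul]
  ext i <;> fin_cases i <;> simp [Oct.mul_coords, Oct.conj_coords, basisVec_apply]

theorem octRep_quad_4567 {ε : ℝ} (hε : ε * ε = 1) (x y : Oct) : octRep ε (quad ε 4 5 6 7) (x, y) =
    (!₂[-x 0, -x 1, -x 2, -x 3, x 4, x 5, x 6, x 7],
      !₂[-y 0, -y 1, -y 2, -y 3, y 4, y 5, y 6, y 7]) := by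
  simp only [quad, map_mul, Module.End.mul_apply, octRep_ι, Oct.smul_mul, smul_smul, hε, one_smul]
  ext i <;> fin_cases i <;> simp [Oct.mul_coords, Oct.conj_coords, basisVec_apply]

theorem octRep_quad_0246 {ε : ℝ} (hε : ε * ε = 1) (x y : Oct) : octRep ε (quad ε 0 2 4 6) (x, y) =
    (!₂[x 0, -x 1, x 2, -x 3, x 4, -x 5, x 6, -x 7],
      !₂[-y 0, y 1, -y 2, y 3, -y 4, y 5, -y 6, y 7]) := by
  simp only [quad, map_mul, Module.End.mul_apply, octRep_ι, Oct.smul_mul, smul_smul, hε, one_smul]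
  ext i <;> fin_cases i <;> simp [Oct.mul_coords, Oct.conj_coords, basisVec_apply]

/-- The signs in `spinorProj` match the eigenvalues −1, 1, −1, 1 of the four products on (1, 0).
There every factor is 2; every other basis spinor is killed by at least one factor. -/
theorem octRep_spinorProj {ε : ℝ} (hε : ε * ε = 1) (p : Oct × Oct) :
    octRep ε (spinorProj ε) p = ((16 * p.1 0) • Oct.one, 0) := by
  obtain ⟨x, y⟩ := p
  simp only [spinorProj, map_mul, map_add, map_sub, map_one, Module.End.mul_apply,
    LinearMap.add_apply, LinearMap.sub_apply, Module.End.one_apply, octRep_quad_0123 hε,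
    octRep_quad_0145 hε, octRep_quad_4567 hε, octRep_quad_0246 hε, Prod.mk_add_mk, Prod.mk_sub_mk]
  ext i <;> fin_cases i <;> (simp [basisVec_apply]; try ring)

theorem Oct.zero_mul (x : Oct) : Oct.mul 0 x = 0 := LinearMap.map_zero₂ Oct.mulₗ x
theorem Oct.mul_zero (x : Oct) : Oct.mul x 0 = 0 := map_zero (Oct.mulₗ x)

theorem Oct.neg_mul (x y : Oct) : Oct.mul (-x) y = -Oct.mul x y := LinearMap.map_neg₂ Oct.mulₗ x y

theorem Oct.mul_conj_zero (x y : Oct) : Oct.mul x (Oct.conj y) 0 = inner ℝ x y := by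
  simp [Oct.mul_coords, Oct.conj_coords, inner_coords]

/-- The distinguished spinor `(1, 0)`. -/
abbrev spinorOne : Oct × Oct := (Oct.one, 0)

theorem octRep_spinorOne {ε : ℝ} (hε : ε * ε = 1) (x y : Oct) :
    octRep ε (CliffordAlgebra.ι _ (ε • Oct.conj x) * CliffordAlgebra.ι _ Oct.one +
      CliffordAlgebra.ι _ y) spinorOne = (x, y) := by
  rw [map_add, map_mul, LinearMap.add_apply, Module.End.mul_apply, octRep_ι, octRep_ι, octRep_ι]
  simp [Oct.one_mul, Oct.zero_mul, Oct.conj_conj, Oct.mul_smul, smul_smul, hε]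

/-- `Subalgebra.eq_top_of_rankOne` applies to `spinorProj`: the spinor (1, 0) is cyclic by
`octRep_spinorOne`, and its coordinate is cocyclic because the products by y and by x · 1 turn (x,
y) into spinors with coordinates ε‖y‖² and ε‖x‖². -/
theorem octRep_surjective {ε : ℝ} (hε : ε * ε = 1) : Function.Surjective (octRep ε) := by
  have hε0 : ε ≠ 0 := by rintro rfl; simp at hε
  rw [← AlgHom.range_eq_top]
  refine Subalgebra.eq_top_of_rankOne _ spinorOne
    (innerₗ Oct Oct.one ∘ₗ LinearMap.fst ℝ Oct Oct)
    ⟨(1 / 16 : ℝ) • spinorProj ε, ?_⟩ (fun w => ⟨_, ⟨_, rfl⟩, octRep_spinorOne hε w.1 w.2⟩) ?_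
  · refine LinearMap.ext fun p => ?_
    rw [AlgHom.toRingHom_eq_coe, RingHom.coe_coe, map_smul, LinearMap.smul_apply,
      octRep_spinorProj hε]
    simp [smul_smul, inner_coords, basisVec_apply]
  · rintro ⟨x, y⟩ h
    have h1 := h _ ⟨CliffordAlgebra.ι _ y, rfl⟩
    have h2 := h _ ⟨CliffordAlgebra.ι _ x * CliffordAlgebra.ι _ Oct.one, rfl⟩
    have h3 : ∀ z : Oct, inner ℝ Oct.one (ε • Oct.mul z (Oct.conj z)) = 0 → z = 0 := by
      intro z hz
      have : inner ℝ Oct.one (Oct.mul z (Oct.conj z)) = inner ℝ z z := by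
        rw [← Oct.mul_conj_zero z z]
        simp only [inner_coords Oct.one]
        simp [basisVec_apply]
      rwa [inner_smul_right, this, mul_eq_zero, or_iff_right hε0, inner_self_eq_zero] at hz
    have h1' := h3 y (by simpa [octRep_ι, inner_smul_right] using h1)
    have h2' := h3 x (by simpa [octRep_ι, Oct.mul_one, inner_smul_right] using h2)
    rw [h1', h2']
    rfl

theorem octRep_bijective {ε : ℝ} (hε : ε * ε = 1) : Function.Bijective (octRep ε) := by
  have h : Module.finrank ℝ (CliffordAlgebra (normForm ε)) =
      Module.finrank ℝ (Module.End ℝ (Oct × Oct)) := by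
    rw [CliffordAlgebra.finrank_eq]
    simp [Module.finrank_linearMap]
  exact ⟨(LinearMap.injective_iff_surjective_of_finrank_eq_finrank (f := (octRep ε).toLinearMap)
    h).mpr (octRep_surjective hε), octRep_surjective hε⟩

theorem octRep_involute (ε : ℝ) (x : CliffordAlgebra (normForm ε)) (p : Oct × Oct) :
    octRep ε (CliffordAlgebra.involute x) p =
      ((octRep ε x (p.1, -p.2)).1, -(octRep ε x (p.1, -p.2)).2) := by
  rw [CliffordAlgebra.map_involute_eq_conj (octRep ε)
    (LinearMap.prodMap LinearMap.id (-LinearMap.id)) (LinearMap.ext fun p => by simp)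
    (fun u => LinearMap.ext fun p => by simp [octRep_ι, Oct.neg_mul])]
  simp

end GenSpin

namespace GenSpin

/-! ### The form `Φ_Spin` as a pure spinor projection -/

theorem flatMap_apply (u w : Oct) : flatMap u w = inner ℝ u w := rfl

/-- The embedding `u ↦ u + ε ⟨u, ·⟩` of `𝕆` into `𝕆* ⊕ 𝕆`. -/
def genEmb (ε : ℝ) : Oct →ₗ[ℝ] Gen Oct := (ε • flatMap.toLinearMap).prod LinearMap.id

theorem genEmb_apply (ε : ℝ) (u : Oct) : genEmb ε u = (ε • flatMap u, u) := rfl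

/-- The Clifford algebra of `(𝕆, ε ‖u‖²)` inside `CL(𝕆 ⊕ 𝕆*)`. -/
def octMap (ε : ℝ) : CliffordAlgebra (normForm ε) →ₐ[ℝ] Cl Oct :=
  CliffordAlgebra.map ⟨genEmb ε, fun _ => rfl⟩

theorem octMap_ι (ε : ℝ) (u : Oct) : octMap ε (CliffordAlgebra.ι _ u) = incl Oct (genEmb ε u) :=
  CliffordAlgebra.map_apply_ι _ _

theorem spinRep_incl {V : Type*} [AddCommGroup V] [Module ℝ V] (E : Gen V) (φ : Forms V) :
    spinRep (incl V E) φ = CliffordAlgebra.contractLeft (Module.Dual.eval ℝ V E.2) φ +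
      ExteriorAlgebra.ι ℝ E.1 * φ := by
  rw [spinRep, CliffordAlgebra.lift_ι_apply]
  rfl

/-- Contraction of forms with the basis vector `eᵢ`. -/
def contr (i : Fin 8) : Module.End ℝ (Forms Oct) :=
  CliffordAlgebra.contractLeft (Module.Dual.eval ℝ Oct (basisVec i))

theorem dualForm_eq (i : Fin 8) : dualForm i = ExteriorAlgebra.ι ℝ (flatMap (basisVec i)) := by
  rw [dualForm]
  congr 1
  ext x
  simp [flatMap_apply, basisVec, EuclideanSpace.inner_single_left]

theorem contr_mul (i j : Fin 8) (φ : Forms Oct) : contr i (dualForm j * φ) =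
    (if i = j then φ else 0) - dualForm j * contr i φ := by
  have h := CliffordAlgebra.contractLeft_ι_mul (Q := (0 : QuadraticForm ℝ (Module.Dual ℝ Oct)))
    (Module.Dual.eval ℝ Oct (basisVec i)) (flatMap (basisVec j)) φ
  rw [dualForm_eq]
  refine h.trans ?_
  rw [Module.Dual.eval_apply, flatMap_apply]
  simp [basisVec, EuclideanSpace.inner_single_left, ExteriorAlgebra.ι, contr, eq_comm]

theorem contr_one (i : Fin 8) : contr i 1 = 0 :=
  CliffordAlgebra.contractLeft_one (Q := (0 : QuadraticForm ℝ (Module.Dual ℝ Oct))) _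

theorem contr_dualForm (i j : Fin 8) : contr i (dualForm j) = if i = j then 1 else 0 := by
  simpa [contr_one] using contr_mul i j 1

theorem spinRep_octMap (ε : ℝ) (i : Fin 8) (φ : Forms Oct) :
    spinRep (octMap ε (CliffordAlgebra.ι _ (basisVec i))) φ = contr i φ + ε • (dualForm i * φ) := by
  rw [octMap_ι, spinRep_incl, genEmb_apply, map_smul, smul_mul_assoc, dualForm_eq]
  rfl

theorem dualForm_sq (i : Fin 8) : dualForm i * dualForm i = 0 := ExteriorAlgebra.ι_sq_zero _

theorem dualForm_sq_mul (i : Fin 8) (φ : Forms Oct) : dualForm i * (dualForm i * φ) = 0 := by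
  rw [← mul_assoc, dualForm_sq, zero_mul]

theorem dualForm_comm (i j : Fin 8) : dualForm i * dualForm j = -(dualForm j * dualForm i) :=
  eq_neg_of_add_eq_zero_left (ExteriorAlgebra.ι_add_mul_swap _ _)

theorem dualForm_swap {i j : Fin 8} (_ : j < i) :
    dualForm i * dualForm j = -(dualForm j * dualForm i) := dualForm_comm i j

theorem dualForm_swap_mul {i j : Fin 8} (_ : j < i) (φ : Forms Oct) :
    dualForm i * (dualForm j * φ) = -(dualForm j * (dualForm i * φ)) := by
  rw [← mul_assoc, dualForm_comm, neg_mul, mul_assoc]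

theorem phiG2_eq : phiG2 =
    dualForm 1 * (dualForm 2 * dualForm 3) - dualForm 1 * (dualForm 4 * dualForm 5)
    - dualForm 1 * (dualForm 6 * dualForm 7) - dualForm 2 * (dualForm 4 * dualForm 6)
    + dualForm 2 * (dualForm 5 * dualForm 7) - dualForm 3 * (dualForm 4 * dualForm 7)
    - dualForm 3 * (dualForm 5 * dualForm 6) := by
  have h : ∀ i j k : Fin 8, inner ℝ (Oct.mul (basisVec i) (basisVec j)) (basisVec k) =
      Oct.mul (basisVec i) (basisVec j) k := by
    intro i j k
    simp [basisVec, EuclideanSpace.inner_single_right]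
  simp only [phiG2, h, Fin.sum_univ_seven]
  simp [Oct.mul_coords, basisVec_apply, mul_assoc]
  abel

theorem multiContract_dualForm (i : Fin 8) :
    multiContract (dualForm i) = MulOpposite.op (contr i) := by
  rw [dualForm_eq, multiContract, ExteriorAlgebra.lift_ι_apply]
  simp [contr]

theorem psiG2_eq : psiG2 =
    dualForm 4 * (dualForm 5 * (dualForm 6 * dualForm 7))
    - dualForm 2 * (dualForm 3 * (dualForm 6 * dualForm 7))
    - dualForm 2 * (dualForm 3 * (dualForm 4 * dualForm 5))
    - dualForm 1 * (dualForm 3 * (dualForm 5 * dualForm 7))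
    + dualForm 1 * (dualForm 3 * (dualForm 4 * dualForm 6))
    - dualForm 1 * (dualForm 2 * (dualForm 5 * dualForm 6))
    - dualForm 1 * (dualForm 2 * (dualForm 4 * dualForm 7)) := by
  simp only [psiG2, hodgeStar, phiG2_eq, vol7, mul_assoc, map_sub, map_add, map_mul,
    multiContract_dualForm, MulOpposite.unop_sub, MulOpposite.unop_add, MulOpposite.unop_mul,
    MulOpposite.unop_op, LinearMap.sub_apply, LinearMap.add_apply, Module.End.mul_apply]
  simp [contr_mul, contr_dualForm]

theorem spinRep_quad (ε : ℝ) (i j k l : Fin 8) (φ : Forms Oct) :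
    spinRep (octMap ε (quad ε i j k l)) φ =
      (contr i + ε • LinearMap.mulLeft ℝ (dualForm i))
      ((contr j + ε • LinearMap.mulLeft ℝ (dualForm j))
      ((contr k + ε • LinearMap.mulLeft ℝ (dualForm k))
      ((contr l + ε • LinearMap.mulLeft ℝ (dualForm l)) φ))) := by
  simp [quad, spinRep_octMap]

/-- The index sets 0123, 0145, 4567, 0246 generate the extended Hamming code: the empty set,
fourteen quadruples and the full set. Accordingly the expanded product applied to 1 has sixteen
monomials, which are the terms of Φ_Spin with their signs. -/
theorem spinRep_spinorProj : spinRep (octMap 1 (spinorProj 1)) 1 = PhiSpin := by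
  simp only [spinorProj, map_mul, map_add, map_sub, map_one, Module.End.mul_apply,
    LinearMap.add_apply, LinearMap.sub_apply, Module.End.one_apply]
  simp [spinRep_quad, contr_one, contr_mul, contr_dualForm, dualForm_swap, dualForm_swap_mul,
    dualForm_sq_mul, mul_add, mul_sub, PhiSpin, phiSpin, phiG2_eq, psiG2_eq, vol8,
    vol7, mul_assoc]
  abel

/-- `f_I · 1 = e_I · 1` for products of four basis vectors. -/
theorem spinRep_quad_one {i j k l : Fin 8} (hij : i ≠ j) (hik : i ≠ k) (hil : i ≠ l) (hjk : j ≠ k)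
    (hjl : j ≠ l) (hkl : k ≠ l) : spinRep (octMap (-1) (quad (-1) i j k l)) 1 =
      spinRep (octMap 1 (quad 1 i j k l)) 1 := by
  simp [spinRep_quad, contr_one, contr_mul, contr_dualForm, *]

theorem dualProd_polar (E F : Gen Oct) :
    QuadraticMap.polar (QuadraticForm.dualProd ℝ Oct) E F = E.1 F.2 + F.1 E.2 := by
  simp [QuadraticMap.polar]
  ring

theorem dualProd_polar_genEmb (ε δ : ℝ) (u w : Oct) :
    QuadraticMap.polar (QuadraticForm.dualProd ℝ Oct) (genEmb ε u) (genEmb δ w) =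
      (ε + δ) * inner ℝ u w := by
  simp [dualProd_polar, genEmb_apply, flatMap_apply, real_inner_comm u w]
  ring

theorem octMap_anticomm (ε : ℝ) (u w : Oct) :
    octMap (-ε) (CliffordAlgebra.ι _ u) * octMap ε (CliffordAlgebra.ι _ w) =
      -(octMap ε (CliffordAlgebra.ι _ w) * octMap (-ε) (CliffordAlgebra.ι _ u)) := by
  rw [octMap_ι, octMap_ι]
  apply eq_neg_of_add_eq_zero_left
  rw [CliffordAlgebra.ι_mul_ι_add_swap, dualProd_polar_genEmb]
  simp

theorem octMap_involute_anticomm (ε : ℝ) (x : CliffordAlgebra (normForm ε)) (u : Oct) :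
    octMap (-ε) (CliffordAlgebra.ι _ u) * octMap ε x =
      octMap ε (CliffordAlgebra.involute x) * octMap (-ε) (CliffordAlgebra.ι _ u) := by
  induction x using CliffordAlgebra.induction with
  | algebraMap r => simp [Algebra.commutes]
  | ι w => simp [octMap_anticomm]
  | mul x y hx hy =>
    rw [map_mul, map_mul, map_mul, ← mul_assoc, hx, mul_assoc, hy, mul_assoc]
  | add x y hx hy => simp [mul_add, add_mul, hx, hy]

theorem octMap_comm_of_involute {ε : ℝ} {x : CliffordAlgebra (normForm ε)}
    (hx : CliffordAlgebra.involute x = x) (y : CliffordAlgebra (normForm (-ε))) :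
    Commute (octMap (-ε) y) (octMap ε x) := by
  induction y using CliffordAlgebra.induction with
  | algebraMap r => rw [AlgHom.commutes]; exact Algebra.commutes r _
  | ι w =>
    have := octMap_involute_anticomm ε x w
    rwa [hx] at this
  | mul x y hx hy => rw [map_mul]; exact hx.mul_left hy
  | add x y hx hy => rw [map_add]; exact hx.add_left hy

theorem involute_quad (ε : ℝ) (i j k l : Fin 8) :
    CliffordAlgebra.involute (quad ε i j k l) = quad ε i j k l := by
  simp [quad]

theorem involute_spinorProj (ε : ℝ) : CliffordAlgebra.involute (spinorProj ε) = spinorProj ε := by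
  simp [spinorProj, involute_quad]

theorem octRep_injective {ε : ℝ} (hε : ε * ε = 1) : Function.Injective (octRep ε) :=
  (octRep_bijective hε).1

/-- Write Φ_Spin as `spinorProj 1` applied to 1. The product of four C₋ vectors commutes past this
even element, acts on 1 as the corresponding C₊ product does, and is then absorbed from the right.
-/
theorem spinRep_octMap_neg_PhiSpin {i j k l : Fin 8} (hij : i ≠ j) (hik : i ≠ k) (hil : i ≠ l)
    (hjk : j ≠ k) (hjl : j ≠ l) (hkl : k ≠ l) {c : ℝ}
    (h : spinorProj 1 * quad 1 i j k l = c • spinorProj 1) :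
    spinRep (octMap (-1) (quad (-1) i j k l)) PhiSpin = c • PhiSpin := by
  rw [← spinRep_spinorProj, ← Module.End.mul_apply, ← map_mul,
    octMap_comm_of_involute (involute_spinorProj 1) _, map_mul, Module.End.mul_apply,
    spinRep_quad_one hij hik hil hjk hjl hkl, ← Module.End.mul_apply, ← map_mul, ← map_mul, h]
  simp

theorem spinorProj_mul_quad_right {i j k l : Fin 8} {c : ℝ}
    (h : ∀ p : Oct × Oct, (octRep 1 (quad 1 i j k l) p).1 0 = c * p.1 0) :
    spinorProj 1 * quad 1 i j k l = c • spinorProj 1 := by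
  apply octRep_injective (by norm_num)
  refine LinearMap.ext fun p => ?_
  rw [map_mul, Module.End.mul_apply, map_smul, LinearMap.smul_apply,
    octRep_spinorProj (by norm_num), octRep_spinorProj (by norm_num), h]
  simp [smul_smul, mul_left_comm]

/-- For ε = 1, `spinorProj` is 16 times an idempotent with Φ_Spin in its image. For ε = −1, Φ_Spin
has the same four eigenvalues −1, 1, −1, 1 as the spinor (1, 0), so each factor contributes 2. -/
theorem spinRep_octMap_spinorProj {ε : ℝ} (hε : ε * ε = 1) :
    spinRep (octMap ε (spinorProj ε)) PhiSpin = (16 : ℝ) • PhiSpin := by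
  have h1 : (1 : ℝ) * 1 = 1 := by norm_num
  rcases mul_self_eq_one_iff.mp hε with rfl | rfl
  · have : spinorProj 1 * spinorProj 1 = (16 : ℝ) • spinorProj 1 := by
      apply octRep_injective h1
      refine LinearMap.ext fun p => ?_
      rw [map_mul, Module.End.mul_apply, map_smul, LinearMap.smul_apply, octRep_spinorProj h1,
        octRep_spinorProj h1]
      simp [smul_smul, basisVec_apply]
    rw [← spinRep_spinorProj, ← Module.End.mul_apply, ← map_mul, ← map_mul, this]
    simp
  · have e1 := spinRep_octMap_neg_PhiSpin (i := 0) (j := 1) (k := 2) (l := 3) (by decide)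
      (by decide) (by decide) (by decide) (by decide) (by decide)
      (spinorProj_mul_quad_right (c := -1) fun p => by
        rw [← Prod.mk.eta (p := p), octRep_quad_0123 h1]; simp)
    have e2 := spinRep_octMap_neg_PhiSpin (i := 0) (j := 1) (k := 4) (l := 5) (by decide)
      (by decide) (by decide) (by decide) (by decide) (by decide)
      (spinorProj_mul_quad_right (c := 1) fun p => by
        rw [← Prod.mk.eta (p := p), octRep_quad_0145 h1]; simp)
    have e3 := spinRep_octMap_neg_PhiSpin (i := 4) (j := 5) (k := 6) (l := 7) (by decide)
      (by decide) (by decide) (by decide) (by decide) (by decide)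
      (spinorProj_mul_quad_right (c := -1) fun p => by
        rw [← Prod.mk.eta (p := p), octRep_quad_4567 h1]; simp)
    have e4 := spinRep_octMap_neg_PhiSpin (i := 0) (j := 2) (k := 4) (l := 6) (by decide)
      (by decide) (by decide) (by decide) (by decide) (by decide)
      (spinorProj_mul_quad_right (c := 1) fun p => by
        rw [← Prod.mk.eta (p := p), octRep_quad_0246 h1]; simp)
    simp only [spinorProj, map_mul, map_add, map_sub, map_one, Module.End.mul_apply,
      LinearMap.add_apply, LinearMap.sub_apply, Module.End.one_apply, e1, e2, e3, e4, map_smul]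
    module

/-- The action of the Clifford algebra of `𝕆` on `Φ_Spin` only depends on the action on the
distinguished spinor. -/
theorem spinRep_octMap_congr {ε : ℝ} (hε : ε * ε = 1) {y z : CliffordAlgebra (normForm ε)}
    (h : octRep ε y spinorOne = octRep ε z spinorOne) :
    spinRep (octMap ε y) PhiSpin = spinRep (octMap ε z) PhiSpin := by
  -- The image of `spinorProj` is the line of (1, 0), where the two elements agree; on Φ_Spin the
  -- extra factor is only the scalar 16.
  have hP : y * spinorProj ε = z * spinorProj ε := by
    apply octRep_injective hε
    refine LinearMap.ext fun p => ?_
    have : octRep ε (spinorProj ε) p = (16 * p.1 0) • spinorOne := by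
      rw [octRep_spinorProj hε]; simp
    rw [map_mul, map_mul, Module.End.mul_apply, Module.End.mul_apply, this, map_smul, map_smul, h]
  have h16 := congrArg (fun t => spinRep (octMap ε t) PhiSpin) hP
  simp only [map_mul, Module.End.mul_apply, spinRep_octMap_spinorProj hε, map_smul] at h16
  exact smul_right_injective _ (by norm_num : (16 : ℝ) ≠ 0) h16

theorem PhiSpin_ne_zero : PhiSpin ≠ 0 := by
  intro h
  have h2 := congrArg (ExteriorAlgebra.algebraMapInv (R := ℝ)) h
  have h0 : ∀ i, ExteriorAlgebra.algebraMapInv (R := ℝ) (dualForm i) = 0 := fun i => by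
    simp [dualForm, ExteriorAlgebra.algebraMapInv]
  simp [PhiSpin, phiSpin, psiG2_eq, vol8, h0] at h2

theorem spinRep_octMap_injective {ε : ℝ} (hε : ε * ε = 1) {y z : CliffordAlgebra (normForm ε)}
    (h : spinRep (octMap ε y) PhiSpin = spinRep (octMap ε z) PhiSpin) :
    octRep ε y spinorOne = octRep ε z spinorOne := by
  by_contra hne
  obtain ⟨f, hf⟩ := Module.Projective.exists_dual_eq_one ℝ (sub_ne_zero.mpr hne)
  -- If the spinors differed, some t would send their difference back to (1, 0), so that t(y − z)
  -- would act on Φ_Spin as the identity although y − z kills it.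
  obtain ⟨t, ht⟩ := octRep_surjective hε (f.smulRight spinorOne)
  have h1 : spinRep (octMap ε (t * (y - z))) PhiSpin = spinRep (octMap ε 1) PhiSpin := by
    apply spinRep_octMap_congr hε
    rw [map_mul, Module.End.mul_apply, map_sub, LinearMap.sub_apply, ht, LinearMap.smulRight_apply,
      hf, one_smul, map_one, Module.End.one_apply]
  rw [map_mul, map_mul, Module.End.mul_apply, map_sub, map_sub, LinearMap.sub_apply, h, sub_self,
    map_zero, map_one, map_one, Module.End.one_apply] at h1
  exact PhiSpin_ne_zero h1.symm

end GenSpin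

namespace GenSpin

/-! ### The spin representation of `CL(𝕆 ⊕ 𝕆*)` is an isomorphism -/

theorem spinRep_dual {V : Type*} [AddCommGroup V] [Module ℝ V] (η : Module.Dual ℝ V) :
    spinRep (incl V (η, 0)) = LinearMap.mulLeft ℝ (ExteriorAlgebra.ι ℝ η) := by
  refine LinearMap.ext fun φ => ?_
  rw [spinRep_incl]
  simp

theorem spinRep_vector (i : Fin 8) : spinRep (incl Oct (0, basisVec i)) = contr i := by
  refine LinearMap.ext fun φ => ?_
  rw [spinRep_incl]
  simp [contr]

theorem mulLeft_mem_range_spinRep {V : Type*} [AddCommGroup V] [Module ℝ V] (w : Forms V) :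
    LinearMap.mulLeft ℝ w ∈ (spinRep (V := V)).range := by
  induction w using ExteriorAlgebra.induction with
  | algebraMap r =>
    refine ⟨algebraMap ℝ _ r, LinearMap.ext fun φ => ?_⟩
    simp [Algebra.smul_def]
  | ι η => exact ⟨_, spinRep_dual η⟩
  | mul x y hx hy => rw [LinearMap.mulLeft_mul]; exact mul_mem hx hy
  | add x y hx hy =>
    rw [show LinearMap.mulLeft ℝ (x + y) = LinearMap.mulLeft ℝ x + LinearMap.mulLeft ℝ y from
      LinearMap.ext fun φ => add_mul _ _ _]
    exact add_mem hx hy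

theorem oct_eq_sum (u : Oct) : u = ∑ i, u i • basisVec i := by
  ext j
  simp [basisVec_apply]

theorem vol8_mul_dualForm (i : Fin 8) : vol8 * dualForm i = 0 := by
  fin_cases i <;> simp [vol8, vol7, mul_assoc, dualForm_swap, dualForm_swap_mul, dualForm_sq,
    dualForm_sq_mul]

/-- Exhibits multiplication by the top form as a rank one operator, as
`Subalgebra.eq_top_of_rankOne` requires. -/
theorem vol8_mul (φ : Forms Oct) : vol8 * φ = ExteriorAlgebra.algebraMapInv φ • vol8 := by
  induction φ using ExteriorAlgebra.induction with
  | algebraMap r => simp [Algebra.smul_def, Algebra.commutes]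
  | ι η =>
    obtain ⟨u, rfl⟩ := flatMap.surjective η
    have h : ExteriorAlgebra.ι ℝ (flatMap u) = ∑ i, u i • dualForm i := by
      conv_lhs => rw [oct_eq_sum u]
      simp [dualForm_eq]
    rw [show ExteriorAlgebra.algebraMapInv (R := ℝ) (ExteriorAlgebra.ι ℝ (flatMap u)) = 0 by
      simp [ExteriorAlgebra.algebraMapInv], zero_smul, h, Finset.mul_sum]
    exact Finset.sum_eq_zero fun i _ => by rw [mul_smul_comm, vol8_mul_dualForm, smul_zero]
  | mul x y hx hy => rw [← mul_assoc, hx, smul_mul_assoc, hy, map_mul, mul_smul]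
  | add x y hx hy => rw [mul_add, hx, hy, map_add, add_smul]

/-- The contraction with all basis vectors. -/
def contrAll : Module.End ℝ (Forms Oct) :=
  contr 7 * contr 6 * contr 5 * contr 4 * contr 3 * contr 2 * contr 1 * contr 0

theorem contrAll_vol8_mul {φ : Forms Oct} (h : ∀ i, contr i φ = 0) : contrAll (vol8 * φ) = φ := by
  simp [contrAll, vol8, vol7, mul_assoc, contr_mul, h]

theorem contr_comm (i j : Fin 8) (φ : Forms Oct) : contr i (contr j φ) = -contr j (contr i φ) :=
  CliffordAlgebra.contractLeft_comm (Q := (0 : QuadraticForm ℝ (Module.Dual ℝ Oct))) _ _ φ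

theorem contr_contr (i : Fin 8) (φ : Forms Oct) : contr i (contr i φ) = 0 :=
  CliffordAlgebra.contractLeft_contractLeft (Q := (0 : QuadraticForm ℝ (Module.Dual ℝ Oct))) _ φ

/-- A nonzero form can be contracted to a form with nonzero scalar part. The induction is on the
number k of basis contractions not yet known to kill φ: when k = 0 all of them do, so φ is a scalar.
In the inductive step, contracting φ once more gives a form killed by one further contraction,
because contractions anticommute and square to zero. -/
theorem eq_zero_of_scalarPart {A : Subalgebra ℝ (Module.End ℝ (Forms Oct))}
    (hA : ∀ i, contr i ∈ A) (k : ℕ) : ∀ φ : Forms Oct,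
      (∀ a ∈ A, ExteriorAlgebra.algebraMapInv (R := ℝ) (a φ) = 0) →
      (∀ i : Fin 8, (i : ℕ) + k < 8 → contr i φ = 0) → φ = 0 := by
  induction k with
  | zero =>
    intro φ h h2
    have h3 := contrAll_vol8_mul (φ := φ) fun i => h2 i i.2
    rw [vol8_mul, show ExteriorAlgebra.algebraMapInv (R := ℝ) φ = 0 from h 1 (one_mem A),
      zero_smul, map_zero] at h3
    exact h3.symm
  | succ k ih =>
    intro φ h h2
    refine ih φ h fun i hi => ?_
    refine ih (contr i φ) (fun a ha => h (a * contr i) (mul_mem ha (hA i))) fun j hj => ?_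
    rw [contr_comm]
    rcases eq_or_ne j i with rfl | hji
    · rw [contr_contr, neg_zero]
    · rcases lt_or_ge ((j : ℕ) + (k + 1)) 8 with h8 | h8
      · rw [h2 j h8, map_zero, neg_zero]
      · rw [← contr_comm]
        have : (i : ℕ) ≠ j := fun h => hji (Fin.ext h.symm)
        rw [h2 i (by omega), map_zero]

/-- Again by a rank one operator, scalar part times vol₈. The top form is cyclic since contracting
it by all basis vectors gives 1, after which left multiplication reaches every form. -/
theorem spinRep_surjective : Function.Surjective (spinRep (V := Oct)) := by
  rw [← AlgHom.range_eq_top]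
  have hc : ∀ i, contr i ∈ (spinRep (V := Oct)).range := fun i => ⟨_, spinRep_vector i⟩
  refine Subalgebra.eq_top_of_rankOne _ vol8
    (ExteriorAlgebra.algebraMapInv (R := ℝ) (M := Module.Dual ℝ Oct)).toLinearMap ?_
    (fun w => ⟨LinearMap.mulLeft ℝ w * contrAll, mul_mem (mulLeft_mem_range_spinRep w) ?_, ?_⟩)
    (fun w h => eq_zero_of_scalarPart hc 8 w h fun i hi => by omega)
  · convert mulLeft_mem_range_spinRep vol8 using 1
    exact LinearMap.ext fun φ => (vol8_mul φ).symm
  · exact mul_mem (mul_mem (mul_mem (mul_mem (mul_mem (mul_mem (mul_mem (hc 7) (hc 6)) (hc 5))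
      (hc 4)) (hc 3)) (hc 2)) (hc 1)) (hc 0)
  · have := contrAll_vol8_mul (φ := 1) contr_one
    rw [mul_one] at this
    simp [this]

theorem spinRep_bijective : Function.Bijective (spinRep (V := Oct)) := by
  have h : Module.finrank ℝ (Cl Oct) = Module.finrank ℝ (Module.End ℝ (Forms Oct)) := by
    rw [CliffordAlgebra.finrank_eq, Module.finrank_linearMap, ExteriorAlgebra.finrank_eq]
    simp [Subspace.dual_finrank_eq]
  exact ⟨(LinearMap.injective_iff_surjective_of_finrank_eq_finrank
    (f := (spinRep (V := Oct)).toLinearMap) h).mpr spinRep_surjective, spinRep_surjective⟩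

theorem spinRep_injective : Function.Injective (spinRep (V := Oct)) := spinRep_bijective.1

/-! ### Pull-backs are given by the conformal pin group -/

section

variable {V W : Type*} [AddCommGroup V] [Module ℝ V] [AddCommGroup W] [Module ℝ W]

theorem _root_.CliffordAlgebra.involute_contractLeft {R M : Type*} [CommRing R] [AddCommGroup M]
    [Module R M] {Q : QuadraticForm R M} (d : Module.Dual R M) (x : CliffordAlgebra Q) :
    CliffordAlgebra.involute (CliffordAlgebra.contractLeft d x) =
      -CliffordAlgebra.contractLeft d (CliffordAlgebra.involute x) := by
  induction x using CliffordAlgebra.left_induction with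
  | algebraMap r => simp
  | add x y hx hy => simp only [map_add, hx, hy, neg_add]
  | ι_mul x m hx =>
    simp only [CliffordAlgebra.contractLeft_ι_mul, map_sub, map_smul, map_mul, hx,
      CliffordAlgebra.involute_ι, neg_mul, map_neg]
    noncomm_ring

variable (V) in
/-- The parity operator on forms. -/
def parity : Forms V →ₐ[ℝ] Forms V :=
  CliffordAlgebra.involute (Q := (0 : QuadraticForm ℝ (Module.Dual ℝ V)))

theorem parity_ι (η : Module.Dual ℝ V) :
    parity V (ExteriorAlgebra.ι ℝ η) = -ExteriorAlgebra.ι ℝ η :=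
  CliffordAlgebra.involute_ι η

theorem parity_parity (φ : Forms V) : parity V (parity V φ) = φ :=
  CliffordAlgebra.involute_involute (Q := (0 : QuadraticForm ℝ (Module.Dual ℝ V))) φ

theorem parity_contractLeft (d : Module.Dual ℝ (Module.Dual ℝ V)) (φ : Forms V) :
    parity V (CliffordAlgebra.contractLeft d φ) =
      -CliffordAlgebra.contractLeft d (parity V φ) :=
  CliffordAlgebra.involute_contractLeft (Q := (0 : QuadraticForm ℝ (Module.Dual ℝ V))) d φ

theorem spinRep_involute (x : Cl V) : spinRep (CliffordAlgebra.involute x) =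
    (parity V).toLinearMap * spinRep x * (parity V).toLinearMap := by
  refine CliffordAlgebra.map_involute_eq_conj spinRep _
    (LinearMap.ext fun φ => parity_parity φ) (fun E => LinearMap.ext fun φ => ?_) x
  change parity V (spinRep (incl V E) (parity V φ)) = -spinRep (incl V E) φ
  rw [spinRep_incl, spinRep_incl, map_add, map_mul, parity_ι, parity_contractLeft, parity_parity]
  rw [neg_mul, neg_add]

theorem pullback_ι (f : V →ₗ[ℝ] W) (η : Module.Dual ℝ W) :
    pullback f (ExteriorAlgebra.ι ℝ η) = ExteriorAlgebra.ι ℝ (η ∘ₗ f) :=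
  ExteriorAlgebra.map_apply_ι _ _

theorem pullback_parity (f : V →ₗ[ℝ] W) (φ : Forms W) :
    pullback f (parity W φ) = parity V (pullback f φ) := by
  have : (pullback f).comp (parity W) = (parity V).comp (pullback f) := by
    refine ExteriorAlgebra.hom_ext (LinearMap.ext fun η => ?_)
    simp [pullback_ι, parity_ι]
  exact DFunLike.congr_fun this φ

theorem pullback_contractLeft (f : V →ₗ[ℝ] W) (v : V) (φ : Forms W) :
    CliffordAlgebra.contractLeft (Module.Dual.eval ℝ V v) (pullback f φ) =
      pullback f (CliffordAlgebra.contractLeft (Module.Dual.eval ℝ W (f v)) φ) :=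
  (CliffordAlgebra.map_contractLeft
    (⟨f.dualMap, fun _ => rfl⟩ : (0 : QuadraticForm ℝ (Module.Dual ℝ W)) →qᵢ
      (0 : QuadraticForm ℝ (Module.Dual ℝ V))) (Module.Dual.eval ℝ V v) φ).symm

theorem spinRep_pullback (f : V →ₗ[ℝ] W) (b : W →ₗ[ℝ] V) (hb : b ∘ₗ f = LinearMap.id) (E : Gen V)
    (φ : Forms W) : spinRep (incl V E) (pullback f φ) =
      pullback f (spinRep (incl W (genMap f b E)) φ) := by
  rw [spinRep_incl, spinRep_incl, map_add, map_mul, pullback_contractLeft, pullback_ι]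
  congr 3
  change _ = (E.1 ∘ₗ b) ∘ₗ f
  rw [LinearMap.comp_assoc, hb, LinearMap.comp_id]

theorem pullback_pullback {U : Type*} [AddCommGroup U] [Module ℝ U] (f : V →ₗ[ℝ] W)
    (f' : W →ₗ[ℝ] U) (φ : Forms U) : pullback f (pullback f' φ) = pullback (f' ∘ₗ f) φ := by
  have : (pullback f).comp (pullback f') = pullback (f' ∘ₗ f) := by
    refine ExteriorAlgebra.hom_ext (LinearMap.ext fun η => ?_)
    simp [pullback_ι, LinearMap.comp_assoc]
  exact DFunLike.congr_fun this φ

theorem pullback_id (φ : Forms V) : pullback LinearMap.id φ = φ := by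
  have : pullback (LinearMap.id : V →ₗ[ℝ] V) = AlgHom.id ℝ _ := by
    refine ExteriorAlgebra.hom_ext (LinearMap.ext fun η => ?_)
    simp [pullback_ι]
  exact DFunLike.congr_fun this φ

end

/-- As the spin representation is onto, pull-back is the action of some Clifford element. It is even
because pull-back commutes with parity, and it permutes vectors by `spinRep_pullback`. Orientation
reversing maps need no separate treatment. -/
theorem exists_cpin_pullback (a : Oct ≃ₗ[ℝ] Oct) : ∃ g : Cpin Oct,
    (∀ φ, spinRep (g.1 : Cl Oct) φ = pullback a.toLinearMap φ) ∧
      Ad g = genMap a.toLinearMap a.symm.toLinearMap := by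
  obtain ⟨x, hx⟩ := spinRep_surjective (pullback a.toLinearMap).toLinearMap
  obtain ⟨y, hy⟩ := spinRep_surjective (pullback a.symm.toLinearMap).toLinearMap
  have hxy : x * y = 1 := by
    apply spinRep_injective
    refine LinearMap.ext fun φ => ?_
    simp [hx, hy, pullback_pullback, pullback_id]
  have hyx : y * x = 1 := by
    apply spinRep_injective
    refine LinearMap.ext fun φ => ?_
    simp [hx, hy, pullback_pullback, pullback_id]
  have hye : CliffordAlgebra.involute y = y := by
    apply spinRep_injective
    refine LinearMap.ext fun φ => ?_
    simp [spinRep_involute, hy, pullback_parity, parity_parity]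
  have key : ∀ E, twistedAd ⟨x, y, hxy, hyx⟩ (incl Oct E) =
      incl Oct (genMap a.toLinearMap a.symm.toLinearMap E) := by
    intro E
    rw [twistedAd_apply]
    change CliffordAlgebra.involute y * (incl Oct E * x) = _
    have : incl Oct E * x = x * incl Oct (genMap a.toLinearMap a.symm.toLinearMap E) := by
      apply spinRep_injective
      refine LinearMap.ext fun φ => ?_
      simp only [map_mul, Module.End.mul_apply, hx, AlgHom.toLinearMap_apply]
      exact spinRep_pullback _ _ (by ext; simp) E φ
    rw [this, hye, ← mul_assoc, hyx, one_mul]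
  refine ⟨⟨⟨x, y, hxy, hyx⟩, fun E => ⟨_, (key E).symm⟩⟩, fun φ => by simp [hx], ?_⟩
  refine LinearMap.ext fun E => incl_injective ?_
  rw [← key]
  exact incl_adOf _ _ E

end GenSpin

namespace GenSpin

/-! ### The quadratic elements of a Clifford algebra -/

section

variable {M : Type*} [AddCommGroup M] [Module ℝ M] {Q : QuadraticForm ℝ M}

variable (Q) in
/-- The span of the products of two vectors in a Clifford algebra. -/
def quadSpan : Submodule ℝ (CliffordAlgebra Q) :=
  Submodule.span ℝ (Set.range fun p : M × M => CliffordAlgebra.ι Q p.1 * CliffordAlgebra.ι Q p.2)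

theorem mul_mem_quadSpan (u w : M) :
    CliffordAlgebra.ι Q u * CliffordAlgebra.ι Q w ∈ quadSpan Q :=
  Submodule.subset_span ⟨(u, w), rfl⟩

@[elab_as_elim]
theorem quadSpan_induction {p : (x : CliffordAlgebra Q) → x ∈ quadSpan Q → Prop}
    (mul : ∀ u w, p (CliffordAlgebra.ι Q u * CliffordAlgebra.ι Q w) (mul_mem_quadSpan u w))
    (zero : p 0 (zero_mem _))
    (add : ∀ x y hx hy, p x hx → p y hy → p (x + y) (add_mem hx hy))
    (smul : ∀ (c : ℝ) x hx, p x hx → p (c • x) (Submodule.smul_mem _ c hx))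
    {x : CliffordAlgebra Q} (hx : x ∈ quadSpan Q) : p x hx := by
  induction hx using Submodule.span_induction with
  | mem x h => obtain ⟨q, rfl⟩ := h; exact mul _ _
  | zero => exact zero
  | add x y hx hy h1 h2 => exact add x y hx hy h1 h2
  | smul c x hx h => exact smul c x hx h

theorem involute_of_mem_quadSpan {x : CliffordAlgebra Q} (hx : x ∈ quadSpan Q) :
    CliffordAlgebra.involute x = x := by
  induction hx using quadSpan_induction with
  | mul u w => simp
  | zero => simp
  | add x y _ _ hx hy => simp [hx, hy]
  | smul c x _ hx => simp [hx]

theorem ι_mul_ι_bracket (a b z : M) :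
    CliffordAlgebra.ι Q a * CliffordAlgebra.ι Q b * CliffordAlgebra.ι Q z -
      CliffordAlgebra.ι Q z * (CliffordAlgebra.ι Q a * CliffordAlgebra.ι Q b) =
    CliffordAlgebra.ι Q (QuadraticMap.polar Q b z • a - QuadraticMap.polar Q a z • b) := by
  have h1 := CliffordAlgebra.ι_mul_ι_comm (Q := Q) b z
  have h2 := CliffordAlgebra.ι_mul_ι_comm (Q := Q) z a
  rw [mul_assoc, h1, ← mul_assoc, h2, mul_sub, sub_mul, map_sub, map_smul, map_smul,
    QuadraticMap.polar_comm Q z a, ← Algebra.commutes, ← Algebra.smul_def, ← Algebra.smul_def]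
  noncomm_ring

theorem quadSpan_bracket {x : CliffordAlgebra Q} (hx : x ∈ quadSpan Q) (z : M) :
    ∃ z', x * CliffordAlgebra.ι Q z - CliffordAlgebra.ι Q z * x = CliffordAlgebra.ι Q z' := by
  induction hx using quadSpan_induction with
  | mul u w => exact ⟨_, ι_mul_ι_bracket u w z⟩
  | zero => exact ⟨0, by simp⟩
  | add x y _ _ hx hy =>
    obtain ⟨z₁, h₁⟩ := hx
    obtain ⟨z₂, h₂⟩ := hy
    exact ⟨z₁ + z₂, by rw [map_add, ← h₁, ← h₂]; noncomm_ring⟩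
  | smul c x _ hx =>
    obtain ⟨z₁, h₁⟩ := hx
    exact ⟨c • z₁, by rw [map_smul, ← h₁, smul_sub, smul_mul_assoc, mul_smul_comm]⟩

end

section

variable {V : Type*} [AddCommGroup V] [Module ℝ V] [FiniteDimensional ℝ V]

theorem incl_Ad' (g : Cpin V) (E : Gen V) : incl V (Ad g E) =
    (↑g.1⁻¹ : Cl V) * (incl V E * CliffordAlgebra.involute (g.1 : Cl V)) := by
  have h := congrArg CliffordAlgebra.involute (incl_adOf g.1 g.2 E)
  simp only [twistedAd_apply, map_mul, CliffordAlgebra.involute_ι,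
    CliffordAlgebra.involute_involute, neg_mul, mul_neg, neg_inj] at h
  exact h

theorem incl_Ad (g : Cpin V) (E : Gen V) : incl V (Ad g E) =
    CliffordAlgebra.involute (↑g.1⁻¹ : Cl V) * (incl V E * (g.1 : Cl V)) :=
  incl_adOf g.1 g.2 E

theorem involute_mul_involute_inv (g : (Cl V)ˣ) :
    CliffordAlgebra.involute (g : Cl V) * CliffordAlgebra.involute (↑g⁻¹ : Cl V) = 1 := by
  rw [← map_mul, Units.mul_inv, map_one]

theorem involute_inv_mul_involute (g : (Cl V)ˣ) :
    CliffordAlgebra.involute (↑g⁻¹ : Cl V) * CliffordAlgebra.involute (g : Cl V) = 1 := by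
  rw [← map_mul, Units.inv_mul, map_one]

/-- Ad_g E equals both g̃⁻¹ E g and g⁻¹ E g̃. Using one expression for each factor of the square
makes the middle cancel and leaves a scalar conjugated by g̃. -/
theorem dualProd_Ad (g : Cpin V) (E : Gen V) :
    QuadraticForm.dualProd ℝ V (Ad g E) = QuadraticForm.dualProd ℝ V E := by
  apply (algebraMap ℝ (Cl V)).injective
  rw [← CliffordAlgebra.ι_sq_scalar, ← CliffordAlgebra.ι_sq_scalar]
  change incl V (Ad g E) * incl V (Ad g E) = incl V E * incl V E
  conv_lhs =>
    enter [1]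
    rw [incl_Ad]
  rw [incl_Ad' g E]
  have h : (g.1 : Cl V) * (↑g.1⁻¹ : Cl V) = 1 := Units.mul_inv _
  have hsq : incl V E * incl V E = algebraMap ℝ (Cl V) (QuadraticForm.dualProd ℝ V E) :=
    CliffordAlgebra.ι_sq_scalar _ _
  calc _ = CliffordAlgebra.involute (↑g.1⁻¹ : Cl V) * (incl V E * ((g.1 : Cl V) * (↑g.1⁻¹ : Cl V)) *
        incl V E) * CliffordAlgebra.involute (g.1 : Cl V) := by noncomm_ring
    _ = _ := by
      rw [h, mul_one, hsq, ← Algebra.commutes, mul_assoc, involute_inv_mul_involute, mul_one]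

theorem Ad_mul (g h : Cpin V) (E : Gen V) : Ad (g * h) E = Ad h (Ad g E) := by
  apply incl_injective
  rw [incl_Ad, incl_Ad, incl_Ad]
  simp [mul_assoc]

theorem Ad_one (E : Gen V) : Ad (1 : Cpin V) E = E := by
  apply incl_injective
  rw [incl_Ad]
  simp

theorem conj_mem_quadSpan (g : Cpin V) {x : Cl V} (hx : x ∈ quadSpan (QuadraticForm.dualProd ℝ V)) :
    (g.1 : Cl V) * x * (↑g.1⁻¹ : Cl V) ∈ quadSpan (QuadraticForm.dualProd ℝ V) := by
  induction hx using quadSpan_induction with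
  | mul E F =>
    have h1 := incl_Ad' g⁻¹ E
    have h2 := incl_Ad g⁻¹ F
    have h3 : (g.1 : Cl V) * (incl V E * incl V F) * (↑g.1⁻¹ : Cl V) =
        incl V (Ad g⁻¹ E) * incl V (Ad g⁻¹ F) := by
      rw [h1, h2]
      simp only [InvMemClass.coe_inv, inv_inv]
      calc _ = (g.1 : Cl V) * (incl V E * 1 * incl V F) * (↑g.1⁻¹ : Cl V) := by rw [mul_one]
        _ = _ := by rw [← involute_inv_mul_involute g.1]; noncomm_ring
    exact h3 ▸ mul_mem_quadSpan _ _
  | zero => simp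
  | add x y _ _ hx hy => rw [mul_add, add_mul]; exact add_mem hx hy
  | smul c x _ hx => rw [mul_smul_comm, smul_mul_assoc]; exact Submodule.smul_mem _ _ hx

/-- `Ad_g [x, E] = [g⁻¹ x g, Ad_g E]` for quadratic elements. -/
theorem bracket_Ad (g : Cpin V) {x : Cl V} (hx : x ∈ quadSpan (QuadraticForm.dualProd ℝ V))
    (E F : Gen V)
    (h : (g.1 : Cl V) * x * (↑g.1⁻¹ : Cl V) * incl V E -
      incl V E * ((g.1 : Cl V) * x * (↑g.1⁻¹ : Cl V)) = incl V F) :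
    x * incl V (Ad g E) - incl V (Ad g E) * x = incl V (Ad g F) := by
  have hinv : CliffordAlgebra.involute (g.1 : Cl V) * x * CliffordAlgebra.involute (↑g.1⁻¹ : Cl V) =
      (g.1 : Cl V) * x * (↑g.1⁻¹ : Cl V) := by
    conv_rhs => rw [← involute_of_mem_quadSpan (conj_mem_quadSpan g hx)]
    rw [map_mul, map_mul, involute_of_mem_quadSpan hx]
  rw [incl_Ad' g E, incl_Ad' g F, ← h]
  conv_rhs =>
    enter [2, 1, 2, 2]
    rw [← hinv]
  have e1 : (↑g.1⁻¹ : Cl V) * (g.1 : Cl V) = 1 := Units.inv_mul _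
  have e2 := involute_inv_mul_involute g.1
  generalize CliffordAlgebra.involute (g.1 : Cl V) = a at *
  generalize CliffordAlgebra.involute (↑g.1⁻¹ : Cl V) = b at *
  generalize (↑g.1⁻¹ : Cl V) = c at *
  generalize (g.1 : Cl V) = d at *
  calc _ = 1 * x * c * incl V E * a - c * incl V E * a * x * 1 := by noncomm_ring
    _ = (c * d) * x * c * incl V E * a - c * incl V E * a * x * (b * a) := by rw [e1, e2]
    _ = _ := by noncomm_ring

end

end GenSpin

namespace GenSpin

/-! ### The stabilizer of `Φ_Spin` preserves `G₀` -/

theorem neg_mul_self_eq_one {ε : ℝ} (hε : ε * ε = 1) : -ε * -ε = 1 := by rwa [neg_mul_neg]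

theorem genEmb_injective (ε : ℝ) : Function.Injective (genEmb ε) :=
  fun _ _ h => congrArg Prod.snd h

theorem dualProd_genEmb (ε : ℝ) (u : Oct) :
    QuadraticForm.dualProd ℝ Oct (genEmb ε u) = ε * inner ℝ u u := rfl

theorem exists_genEmb {ε : ℝ} (hε : ε * ε = 1) (E : Gen Oct) :
    ∃ u w, E = genEmb ε u + genEmb (-ε) w := by
  obtain ⟨η, v⟩ := E
  obtain ⟨a, rfl⟩ := flatMap.surjective η
  refine ⟨(1 / 2 : ℝ) • (v + ε • a), (1 / 2 : ℝ) • (v - ε • a), Prod.ext ?_ ?_⟩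
  · simp only [genEmb_apply, Prod.fst_add, ← map_smul, ← map_add]
    congr 1
    simp only [smul_add, smul_sub, smul_smul]
    rw [show ε * (1 / 2 * ε) = 1 / 2 by linear_combination (1 / 2) * hε,
      show -ε * (1 / 2 * ε) = -(1 / 2) by linear_combination (-1 / 2) * hε]
    module
  · simp only [genEmb_apply, Prod.snd_add]
    module

theorem octMap_comm_quadSpan (ε : ℝ) (x : CliffordAlgebra (normForm ε))
    {y : CliffordAlgebra (normForm (-ε))} (hy : y ∈ quadSpan (normForm (-ε))) :
    Commute (octMap (-ε) y) (octMap ε x) := by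
  induction hy using quadSpan_induction with
  | mul u w =>
    rw [map_mul, Commute, SemiconjBy, mul_assoc, octMap_involute_anticomm, ← mul_assoc,
      octMap_involute_anticomm, CliffordAlgebra.involute_involute, mul_assoc]
  | zero => simp
  | add x y _ _ hx hy => rw [map_add]; exact hx.add_left hy
  | smul c x _ hx => rw [map_smul]; exact hx.smul_left c

/-- Every quadratic element of `CL(𝕆 ⊕ 𝕆*)` splits along `C₊ ⊕ C₋`. -/
theorem quadSpan_decomp {ε : ℝ} (hε : ε * ε = 1) {x : Cl Oct}
    (hx : x ∈ quadSpan (QuadraticForm.dualProd ℝ Oct)) :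
    ∃ y ∈ quadSpan (normForm ε), ∃ z ∈ quadSpan (normForm (-ε)), ∃ w : Fin 8 → Oct,
      x = octMap ε y + octMap (-ε) z + ∑ i, octMap ε (CliffordAlgebra.ι _ (basisVec i)) *
        octMap (-ε) (CliffordAlgebra.ι _ (w i)) := by
  induction hx using quadSpan_induction with
  | mul E F =>
    obtain ⟨u, w, rfl⟩ := exists_genEmb hε E
    obtain ⟨u', w', rfl⟩ := exists_genEmb hε F
    refine ⟨_, mul_mem_quadSpan u u', _, mul_mem_quadSpan w w', fun i => u i • w' - u' i • w, ?_⟩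
    have h : ∀ (v : Oct) (y : Oct), ∑ i, octMap ε (CliffordAlgebra.ι _ (basisVec i)) *
        octMap (-ε) (CliffordAlgebra.ι _ (v i • y)) =
        octMap ε (CliffordAlgebra.ι _ v) * octMap (-ε) (CliffordAlgebra.ι _ y) := by
      intro v y
      conv_rhs => rw [oct_eq_sum v]
      simp [Finset.sum_mul]
    simp only [map_sub, mul_sub, Finset.sum_sub_distrib, h, map_add, ← octMap_ι, map_mul]
    have h2 := octMap_anticomm ε w u'
    simp only [octMap_ι] at h2 ⊢
    rw [add_mul, mul_add, mul_add, h2]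
    noncomm_ring
  | zero => exact ⟨0, zero_mem _, 0, zero_mem _, 0, by simp⟩
  | add x y _ _ hx hy =>
    obtain ⟨y₁, h₁, z₁, k₁, w₁, rfl⟩ := hx
    obtain ⟨y₂, h₂, z₂, k₂, w₂, rfl⟩ := hy
    refine ⟨_, add_mem h₁ h₂, _, add_mem k₁ k₂, w₁ + w₂, ?_⟩
    simp only [map_add, Pi.add_apply, mul_add, Finset.sum_add_distrib]
    abel
  | smul c x _ hx =>
    obtain ⟨y₁, h₁, z₁, k₁, w₁, rfl⟩ := hx
    refine ⟨_, Submodule.smul_mem _ c h₁, _, Submodule.smul_mem _ c k₁, c • w₁, ?_⟩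
    simp [Finset.smul_sum]

theorem octRep_quadSpan_snd {ε : ℝ} {y : CliffordAlgebra (normForm ε)}
    (hy : y ∈ quadSpan (normForm ε)) : (octRep ε y spinorOne).2 = 0 := by
  induction hy using quadSpan_induction with
  | mul u w => simp [octRep_ι, Oct.zero_mul]
  | zero => simp
  | add x y _ _ hx hy => simp [hx, hy]
  | smul c x _ hx => simp [hx]

/-- Odd elements of the Clifford algebra of `𝕆` that recover the components of `u · (1, 0)`. -/
theorem exists_odd_coord {ε : ℝ} (hε : ε * ε = 1) (k : Fin 8) :
    ∃ q : CliffordAlgebra (normForm ε), CliffordAlgebra.involute q = -q ∧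
      ∀ p, octRep ε q p = (p.2 k • Oct.one, 0) := by
  obtain ⟨q, hq⟩ := octRep_surjective hε
    (((EuclideanSpace.proj k : Oct →L[ℝ] ℝ).toLinearMap ∘ₗ LinearMap.snd ℝ Oct Oct).smulRight
      spinorOne)
  have h : ∀ p, octRep ε q p = (p.2 k • Oct.one, 0) := fun p => by simp [hq]
  refine ⟨q, octRep_injective hε (LinearMap.ext fun p => ?_), h⟩
  rw [octRep_involute, map_neg, LinearMap.neg_apply, h, h]
  simp

theorem spinRep_octMap_eq_zero {ε : ℝ} (hε : ε * ε = 1) {y : CliffordAlgebra (normForm ε)}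
    (h : octRep ε y spinorOne = 0) : spinRep (octMap ε y) PhiSpin = 0 := by
  rw [spinRep_octMap_congr hε (z := 0) (by rw [h]; simp)]
  simp

/-- A quadratic element that annihilates `Φ_Spin` has no component in `C₊ ⊗ C₋`. -/
theorem annihilator_decomp {ε : ℝ} (hε : ε * ε = 1) {x : Cl Oct}
    (hx : x ∈ quadSpan (QuadraticForm.dualProd ℝ Oct)) (h0 : spinRep x PhiSpin = 0) :
    ∃ y ∈ quadSpan (normForm ε), ∃ z ∈ quadSpan (normForm (-ε)),
      x = octMap ε y + octMap (-ε) z := by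
  obtain ⟨y, hy, z, hz, w, rfl⟩ := quadSpan_decomp hε hx
  refine ⟨y, hy, z, hz, ?_⟩
  suffices hw : ∀ k, w k = 0 by simp [hw]
  intro k
  -- The odd element q reads off the k-th coordinate of the odd half of a spinor. Applied to x ·
  -- Φ_Spin it annihilates both unmixed terms and reduces the mixed sum to w k acting on Φ_Spin.
  obtain ⟨q, hq, hqp⟩ := exists_odd_coord hε k
  have h1 : spinRep (octMap ε q * octMap ε y) PhiSpin = 0 := by
    rw [← map_mul]
    apply spinRep_octMap_eq_zero hε
    rw [map_mul, Module.End.mul_apply, hqp, octRep_quadSpan_snd hy]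
    simp
  have h2 : spinRep (octMap ε q * octMap (-ε) z) PhiSpin = 0 := by
    rw [← octMap_comm_quadSpan ε q hz, map_mul, Module.End.mul_apply, spinRep_octMap_eq_zero hε,
      map_zero]
    rw [hqp]
    simp
  have h3 : ∀ i, spinRep (octMap ε q * (octMap ε (CliffordAlgebra.ι _ (basisVec i)) *
      octMap (-ε) (CliffordAlgebra.ι _ (w i)))) PhiSpin =
      if i = k then spinRep (octMap (-ε) (CliffordAlgebra.ι _ (w i))) PhiSpin else 0 := by
    intro i
    have heven : CliffordAlgebra.involute (q * CliffordAlgebra.ι _ (basisVec i)) =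
        q * CliffordAlgebra.ι _ (basisVec i) := by simp [hq]
    rw [← mul_assoc, ← map_mul, ← octMap_comm_of_involute heven, map_mul, Module.End.mul_apply,
      spinRep_octMap_congr hε (z := algebraMap ℝ _ (if i = k then 1 else 0))]
    · split_ifs <;> simp
    · rw [map_mul, Module.End.mul_apply, hqp, octRep_ι, AlgHom.commutes]
      split_ifs with hik <;> simp [Oct.one_mul, basisVec_apply, hik, eq_comm (a := k)]
  have h4 := congrArg (spinRep (octMap ε q)) h0
  rw [map_zero, ← Module.End.mul_apply, ← map_mul, mul_add, mul_add, map_add, map_add,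
    LinearMap.add_apply, LinearMap.add_apply, h1, h2, Finset.mul_sum, map_sum,
    LinearMap.sum_apply, Finset.sum_congr rfl fun i _ => h3 i] at h4
  simp only [Finset.sum_ite_eq', Finset.mem_univ, if_true, add_zero, zero_add] at h4
  -- Acting once more by w k gives −ε‖w k‖² times the nonzero form Φ_Spin.
  have h5 := congrArg (spinRep (octMap (-ε) (CliffordAlgebra.ι _ (w k)))) h4
  rw [map_zero, ← Module.End.mul_apply, ← map_mul, ← map_mul, CliffordAlgebra.ι_sq_scalar,
    AlgHom.commutes, AlgHom.commutes, Module.algebraMap_end_apply, normForm_apply] at h5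
  have hε0 : ε ≠ 0 := by rintro rfl; simp at hε
  simpa [PhiSpin_ne_zero, hε0] using h5

theorem bracket_octMap {ε : ℝ} {y : CliffordAlgebra (normForm ε)} {u z : Oct}
    (h : y * CliffordAlgebra.ι _ u - CliffordAlgebra.ι _ u * y = CliffordAlgebra.ι _ z) :
    octMap ε y * incl Oct (genEmb ε u) - incl Oct (genEmb ε u) * octMap ε y =
      incl Oct (genEmb ε z) := by
  rw [← octMap_ι, ← octMap_ι, ← h, map_sub, map_mul, map_mul]

/-- The annihilator of `Φ_Spin` preserves `C₊` and `C₋`. -/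
theorem annihilator_bracket {ε : ℝ} (hε : ε * ε = 1) {x : Cl Oct}
    (hx : x ∈ quadSpan (QuadraticForm.dualProd ℝ Oct)) (h0 : spinRep x PhiSpin = 0) (u : Oct) :
    ∃ u', x * incl Oct (genEmb ε u) - incl Oct (genEmb ε u) * x = incl Oct (genEmb ε u') := by
  obtain ⟨y, hy, z, hz, rfl⟩ := annihilator_decomp hε hx h0
  obtain ⟨u', hu'⟩ := quadSpan_bracket hy u
  refine ⟨u', ?_⟩
  rw [← bracket_octMap hu']
  have h := octMap_comm_quadSpan ε (CliffordAlgebra.ι _ u) hz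
  rw [octMap_ι] at h
  rw [add_mul, mul_add, h.eq]
  abel

theorem octMap_mem_quadSpan {ε : ℝ} {y : CliffordAlgebra (normForm ε)}
    (hy : y ∈ quadSpan (normForm ε)) : octMap ε y ∈ quadSpan (QuadraticForm.dualProd ℝ Oct) := by
  induction hy using quadSpan_induction with
  | mul u w => rw [map_mul, octMap_ι, octMap_ι]; exact mul_mem_quadSpan _ _
  | zero => simp
  | add x y _ _ hx hy => rw [map_add]; exact add_mem hx hy
  | smul c x _ hx => rw [map_smul]; exact Submodule.smul_mem _ c hx

/-- The annihilator of the distinguished spinor has no common kernel on `𝕆`. -/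
theorem eq_zero_of_annihilator_bracket {ε : ℝ} (hε : ε * ε = 1) {z : Oct}
    (h : ∀ y ∈ quadSpan (normForm ε), octRep ε y spinorOne = 0 →
      y * CliffordAlgebra.ι _ z - CliffordAlgebra.ι _ z * y = 0) : z = 0 := by
  have hε0 : ε ≠ 0 := by rintro rfl; simp at hε
  -- When e_b ē_a = e_d ē_c, the difference of the two products of basis vectors kills (1, 0). Its
  -- bracket with z then gives a relation among the coordinates z_a, z_b, z_c, z_d.
  have key : ∀ a b c d : Fin 8,
      Oct.mul (basisVec b) (Oct.conj (basisVec a)) = Oct.mul (basisVec d) (Oct.conj (basisVec c)) →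
      z b • basisVec a - z a • basisVec b - (z d • basisVec c - z c • basisVec d) = 0 := by
    intro a b c d habcd
    have h1 := h (CliffordAlgebra.ι _ (basisVec a) * CliffordAlgebra.ι _ (basisVec b) -
      CliffordAlgebra.ι _ (basisVec c) * CliffordAlgebra.ι _ (basisVec d))
      (sub_mem (mul_mem_quadSpan _ _) (mul_mem_quadSpan _ _))
      (by simp [octRep_ι, Oct.one_mul, habcd, Oct.zero_mul])
    have h2 : ∀ i : Fin 8, inner ℝ (basisVec i) z = z i := fun i => by
      simp [basisVec, EuclideanSpace.inner_single_left]
    rw [sub_mul, mul_sub, sub_sub_sub_comm, ι_mul_ι_bracket, ι_mul_ι_bracket, ← map_sub,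
      ← map_zero (CliffordAlgebra.ι (normForm ε))] at h1
    have h3 := congrArg (octMap ε) h1
    rw [octMap_ι, octMap_ι] at h3
    have h4 := genEmb_injective ε (incl_injective h3)
    simp only [normForm_polar, h2] at h4
    have h5 : (2 * ε) • (z b • basisVec a - z a • basisVec b -
      (z d • basisVec c - z c • basisVec d)) = 0 := by
      rw [← h4]; module
    simpa [hε0] using h5
  -- The index quadruples 0123 and 4567 cover all eight coordinates.
  have k1 := key 0 1 2 3 (by
    ext i; fin_cases i <;> simp [Oct.mul_coords, Oct.conj_coords, basisVec_apply])
  have k2 := key 4 5 6 7 (by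
    ext i; fin_cases i <;> simp [Oct.mul_coords, Oct.conj_coords, basisVec_apply])
  have c1 := fun i => congrArg (fun u : Oct => u i) k1
  have c2 := fun i => congrArg (fun u : Oct => u i) k2
  ext i
  fin_cases i
  · simpa [basisVec_apply] using c1 1
  · simpa [basisVec_apply] using c1 0
  · simpa [basisVec_apply] using c1 3
  · simpa [basisVec_apply] using c1 2
  · simpa [basisVec_apply] using c2 5
  · simpa [basisVec_apply] using c2 4
  · simpa [basisVec_apply] using c2 7
  · simpa [basisVec_apply] using c2 6

/-- The stabilizer of `Φ_Spin` preserves `C₊` and `C₋`. -/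
theorem Ad_genEmb {ε : ℝ} (hε : ε * ε = 1) (g : Cpin Oct)
    (hg : spinRep (g.1 : Cl Oct) PhiSpin = PhiSpin) (u : Oct) :
    ∃ u', Ad g (genEmb ε u) = genEmb ε u' := by
  have hε' := neg_mul_self_eq_one hε
  obtain ⟨u', w, hw⟩ := exists_genEmb hε (Ad g (genEmb ε u))
  suffices w = 0 from ⟨u', by rw [hw, this]; simp⟩
  -- Let y be an annihilator from the algebra of the opposite eigenspace. Its conjugate g y g⁻¹
  -- still kills Φ_Spin, so bracketing with it keeps the original eigenspace; transported by Ad_g,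
  -- the bracket of y with Ad_g u stays in the image of that eigenspace.
  refine eq_zero_of_annihilator_bracket hε' fun y hy h0 => ?_
  have hx := octMap_mem_quadSpan hy
  have hgi : spinRep (↑g.1⁻¹ : Cl Oct) PhiSpin = PhiSpin := by
    conv_lhs => rw [← hg]
    rw [← Module.End.mul_apply, ← map_mul, Units.inv_mul, map_one, Module.End.one_apply]
  obtain ⟨v, hv⟩ := annihilator_bracket hε (conj_mem_quadSpan g hx) (by
    rw [map_mul, map_mul, Module.End.mul_apply, Module.End.mul_apply, hgi,
      spinRep_octMap_eq_zero hε' h0, map_zero]) u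
  have h1 := bracket_Ad g hx _ _ hv
  obtain ⟨w', hw'⟩ := quadSpan_bracket hy w
  have h2 := (octMap_comm_quadSpan ε (CliffordAlgebra.ι _ u') hy).eq
  rw [octMap_ι] at h2
  rw [hw, map_add, mul_add, add_mul, h2, add_sub_add_left_eq_sub, bracket_octMap hw'] at h1
  -- One vector is both an Ad_g-image from C_ε and an element of C_{−ε}; comparing quadratic forms
  -- gives ‖w'‖² = −‖v‖².
  have h3 := dualProd_Ad g (genEmb ε v)
  rw [← incl_injective h1, dualProd_genEmb, dualProd_genEmb] at h3
  have h4 : inner ℝ w' w' = 0 := by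
    have a1 : 0 ≤ inner ℝ w' w' := real_inner_self_nonneg
    have a2 : 0 ≤ inner ℝ v v := real_inner_self_nonneg
    have : inner ℝ w' w' + inner ℝ v v = 0 := by
      linear_combination (-ε) * h3 - (inner ℝ w' w' + inner ℝ v v) * hε
    linarith
  rw [hw', inner_self_eq_zero.mp h4, map_zero]

theorem G₀_genEmb {ε : ℝ} (hε : ε * ε = 1) (u : Oct) : G₀ (genEmb ε u) = ε • genEmb ε u := by
  simp [G₀, genEmb_apply, smul_smul, hε]

theorem Ad_comp_G₀ (g : Cpin Oct) (hg : spinRep (g.1 : Cl Oct) PhiSpin = PhiSpin) :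
    Ad g ∘ₗ G₀ = G₀ ∘ₗ Ad g := by
  refine LinearMap.ext fun E => ?_
  have h1 : (1 : ℝ) * 1 = 1 := by norm_num
  have h2 := neg_mul_self_eq_one h1
  obtain ⟨u, w, rfl⟩ := exists_genEmb h1 E
  obtain ⟨u', hu⟩ := Ad_genEmb h1 g hg u
  obtain ⟨w', hw⟩ := Ad_genEmb h2 g hg w
  simp only [LinearMap.comp_apply, map_add, G₀_genEmb h1, G₀_genEmb h2, map_smul, hu, hw]

end GenSpin

namespace GenSpin

/-! ### The group `Spin(7)` and its action on the octonions -/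

/-- The orthogonal transformations `A` of `𝕆` with `A (x u) = π(x) (A u)` for all `x`, `u`, where
necessarily `π(x) = (A x) (A 1)̄`. -/
structure IsSpin7 (A : Module.End ℝ Oct) : Prop where
  inner_map : ∀ x y, inner ℝ (A x) (A y) = inner ℝ x y
  map_mul : ∀ x u, A (Oct.mul x u) = Oct.mul (Oct.mul (A x) (Oct.conj (A Oct.one))) (A u)

theorem inner_one_one : inner ℝ Oct.one Oct.one = (1 : ℝ) := by
  rw [inner_coords]
  simp [basisVec_apply]

theorem Oct.im_mul_im_mul (u x : Fin 7 → ℝ) (p : Oct) :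
    Oct.mul (Oct.im u) (Oct.mul (Oct.im x) p) + Oct.mul (Oct.im x) (Oct.mul (Oct.im u) p) =
      (-2 * ∑ i, u i * x i) • p := by
  ext i
  fin_cases i <;> simp [Oct.mul_coords, Oct.im_coords, Fin.sum_univ_seven] <;> ring

theorem Oct.im_mul_self_mul (u : Fin 7 → ℝ) (p : Oct) :
    Oct.mul (Oct.im u) (Oct.mul (Oct.im u) p) = -euclid7 u • p := by
  have h := Oct.conj_mul_mul (Oct.im u) p
  rw [Oct.conj_im, Oct.neg_mul] at h
  rw [euclid7_apply, neg_smul, ← h, neg_neg]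

/-- The product of the left multiplications by a list of imaginary octonions. -/
def leftProd (l : List (Fin 7 → ℝ)) : Module.End ℝ Oct :=
  (l.map fun v => Oct.mulₗ (Oct.im v)).prod

theorem leftProd_cons (v : Fin 7 → ℝ) (l : List (Fin 7 → ℝ)) (p : Oct) :
    leftProd (v :: l) p = Oct.mul (Oct.im v) (leftProd l p) := by
  simp [leftProd]

theorem isUnit_leftProd {l : List (Fin 7 → ℝ)} (hl : ∀ v ∈ l, euclid7 v = 1) :
    IsUnit (leftProd l) := by
  induction l with
  | nil => exact isUnit_one
  | cons v l ih =>
    have hv : Oct.mulₗ (Oct.im v) * Oct.mulₗ (Oct.im v) = (-1 : Module.End ℝ Oct) :=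
      LinearMap.ext fun p => by simp [Oct.im_mul_self_mul, hl v (by simp)]
    have : IsUnit (Oct.mulₗ (Oct.im v) : Module.End ℝ Oct) :=
      ⟨⟨Oct.mulₗ (Oct.im v), -Oct.mulₗ (Oct.im v), by rw [mul_neg, hv, neg_neg],
        by rw [neg_mul, hv, neg_neg]⟩, rfl⟩
    rw [show leftProd (v :: l) = Oct.mulₗ (Oct.im v) * leftProd l by simp [leftProd]]
    exact this.mul (ih fun w hw => hl w (by simp [hw]))

theorem euclid7_eq_inner (v : EuclideanSpace ℝ (Fin 7)) : euclid7 v = inner ℝ v v := by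
  simp [euclid7, PiLp.inner_apply, QuadraticMap.weightedSumSquares_apply,
    -inner_self_eq_norm_sq_to_K]

/-- Every isometry of `Im 𝕆` is implemented, up to sign, by a product of left multiplications. -/
theorem exists_leftProd_of_isometry (π : EuclideanSpace ℝ (Fin 7) ≃ₗᵢ[ℝ] EuclideanSpace ℝ (Fin 7)) :
    ∃ l : List (Fin 7 → ℝ), (∀ v ∈ l, euclid7 v = 1) ∧
      ∀ (x : EuclideanSpace ℝ (Fin 7)) (p : Oct), leftProd l (Oct.mul (Oct.im x) p) =
        (-1 : ℝ) ^ l.length • Oct.mul (Oct.im (π x)) (leftProd l p) := by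
  obtain ⟨l, -, rfl⟩ := π.reflections_generate_dim
  induction l with
  | nil => exact ⟨[], by simp, fun x p => by simp [leftProd]⟩
  | cons v l ih =>
    obtain ⟨l', h1, h2⟩ := ih
    -- For v = 0 the reflection in the complement of its span is the identity and contributes no
    -- factor.
    rcases eq_or_ne v 0 with rfl | hv
    · refine ⟨l', h1, fun x p => ?_⟩
      rw [h2]
      simp only [List.map_cons, List.prod_cons, LinearIsometryEquiv.coe_mul, Function.comp_apply]
      rw [Submodule.reflection_mem_subspace_eq_self (by simp)]
    · obtain ⟨u, hu_def⟩ : ∃ u : EuclideanSpace ℝ (Fin 7), u = ‖v‖⁻¹ • v := ⟨_, rfl⟩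
      have hu : ‖u‖ = 1 := by simp [hu_def, norm_smul, hv]
      have hu1 : euclid7 u = 1 := by
        rw [euclid7_eq_inner, real_inner_self_eq_norm_sq, hu]; norm_num
      refine ⟨u :: l', by simpa [hu1] using h1, fun x p => ?_⟩
      rw [leftProd_cons, h2, leftProd_cons]
      generalize leftProd l' p = q
      simp only [List.map_cons, List.prod_cons, LinearIsometryEquiv.coe_mul, Function.comp_apply]
      generalize (List.map (fun v => (ℝ ∙ v)ᗮ.reflection) l).prod x = y
      have hr : (ℝ ∙ v)ᗮ.reflection y = y - (2 * ∑ i, u i * y i) • u := by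
        have h3 : ∑ i, u i * y i = inner ℝ u y := by simp [PiLp.inner_apply, mul_comm]
        rw [Submodule.reflection_orthogonal_apply, Submodule.reflection_singleton_apply, h3,
          neg_sub, hu_def, real_inner_smul_left]
        simp only [smul_smul, two_smul, ← add_smul, RCLike.ofReal_real_eq_id, id]
        congr 2
        field_simp
        ring
      -- Writing L for left multiplication, L_u L_y = −L_y L_u − 2⟨u, y⟩ and L_u² = −1 give L_u L_y
      -- = −L_{r(y)} L_u for the reflection r along u. Each reflection therefore costs one sign.
      have h3 := Oct.im_mul_im_mul u y q
      have h4 := Oct.im_mul_self_mul u q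
      rw [hu1] at h4
      rw [hr, WithLp.ofLp_sub, WithLp.ofLp_smul, map_sub, map_smul, sub_eq_add_neg, Oct.add_mul,
        Oct.neg_mul, Oct.smul_mul, h4, Oct.mul_smul, eq_sub_of_add_eq h3, List.length_cons, pow_succ]
      module

theorem Oct.mul_neg (x y : Oct) : Oct.mul x (-y) = -Oct.mul x y := map_neg (Oct.mulₗ x) y

/-- The representation of the Clifford algebra of `ℝ⁷` on `𝕆 ⊕ 𝕆` by
`v · (x, y) = (v y, -v x)`. -/
def sevenRep : CliffordAlgebra euclid7 →ₐ[ℝ] Module.End ℝ (Oct × Oct) :=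
  CliffordAlgebra.lift _ ⟨
    { toFun := fun v =>
        { toFun := fun p => (Oct.mul (Oct.im v) p.2, -Oct.mul (Oct.im v) p.1)
          map_add' := fun p q => by
            simp only [Prod.fst_add, Prod.snd_add, Oct.mul_add, neg_add, Prod.mk_add_mk]
          map_smul' := fun c p => by
            simp only [Prod.smul_fst, Prod.smul_snd, Oct.mul_smul, Prod.smul_mk, smul_neg, RingHom.id_apply] }
      map_add' := fun v w => by
        refine LinearMap.ext fun p => ?_
        simp only [map_add, LinearMap.coe_mk, AddHom.coe_mk, LinearMap.add_apply, Oct.add_mul, neg_add,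
          Prod.mk_add_mk]
      map_smul' := fun c v => by
        refine LinearMap.ext fun p => ?_
        simp only [map_smul, LinearMap.coe_mk, AddHom.coe_mk, LinearMap.smul_apply, Oct.smul_mul,
          smul_neg, Prod.smul_mk, RingHom.id_apply] }, fun v => by
    refine LinearMap.ext fun p => ?_
    simp [Oct.im_mul_self_mul, Oct.mul_neg, Prod.ext_iff]⟩

theorem sevenRep_ι (v : Fin 7 → ℝ) (p : Oct × Oct) : sevenRep (CliffordAlgebra.ι _ v) p =
    (Oct.mul (Oct.im v) p.2, -Oct.mul (Oct.im v) p.1) := by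
  simp [sevenRep]

/-- The inclusion `Im 𝕆 → 𝕆`, as an isometry of quadratic spaces. -/
def imIsometry : euclid7 →qᵢ normForm 1 :=
  ⟨Oct.im, fun v => by rw [normForm_apply, one_mul, euclid7_apply]; rfl⟩

theorem imIsometry_apply (v : Fin 7 → ℝ) : imIsometry v = Oct.im v := rfl

/-- Octonion conjugation interchanges left and right multiplication, so `sevenRep` is a restriction
of `octRep 1` in disguise and inherits its faithfulness. -/
theorem octRep_map_imIsometry (x : CliffordAlgebra euclid7) : ∀ p q : Oct,
    octRep 1 (CliffordAlgebra.map imIsometry x) (Oct.conj p, Oct.conj q) =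
      (Oct.conj (sevenRep x (p, q)).1, Oct.conj (sevenRep x (p, q)).2) := by
  induction x using CliffordAlgebra.induction with
  | algebraMap r => intro p q; simp
  | ι v =>
    intro p q
    have h : Oct.conj (Oct.im v) = -Oct.im v := Oct.conj_im v
    rw [CliffordAlgebra.map_apply_ι, imIsometry_apply, octRep_ι, sevenRep_ι]
    simp only [one_smul, map_neg, Oct.conj_mul, h, Oct.mul_neg, neg_neg]
  | mul x y hx hy => intro p q; simp only [map_mul, Module.End.mul_apply, hx, hy]
  | add x y hx hy => intro p q; simp only [map_add, LinearMap.add_apply, hx, hy, Prod.fst_add,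
      Prod.snd_add, Prod.mk_add_mk]

theorem sevenRep_injective : Function.Injective sevenRep := by
  intro x y hxy
  apply CliffordAlgebra.map_injective imIsometry Oct.im_injective
  apply octRep_injective (by norm_num)
  refine LinearMap.ext fun p => ?_
  have hx := octRep_map_imIsometry x (Oct.conj p.1) (Oct.conj p.2)
  have hy := octRep_map_imIsometry y (Oct.conj p.1) (Oct.conj p.2)
  rw [Oct.conj_conj, Oct.conj_conj] at hx hy
  exact hx.trans (by rw [hy, hxy])

/-- The action of the even part of the Clifford algebra of `ℝ⁷` on the octonions. -/
def evenRep : CliffordAlgebra euclid7 →ₗ[ℝ] Module.End ℝ Oct where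
  toFun x := LinearMap.fst ℝ Oct Oct ∘ₗ sevenRep x ∘ₗ LinearMap.inl ℝ Oct Oct
  map_add' x y := by refine LinearMap.ext fun p => ?_; simp
  map_smul' c x := by refine LinearMap.ext fun p => ?_; simp

theorem evenRep_apply (x : CliffordAlgebra euclid7) (p : Oct) :
    evenRep x p = (sevenRep x (p, 0)).1 := rfl

theorem sevenRep_of_even {x : CliffordAlgebra euclid7} (hx : x ∈ CliffordAlgebra.even euclid7)
    (p : Oct × Oct) : sevenRep x p = (evenRep x p.1, evenRep x p.2) := by
  have hx' : x ∈ CliffordAlgebra.evenOdd euclid7 0 := hx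
  clear hx
  induction x, hx' using CliffordAlgebra.even_induction with
  | algebraMap r => simp [evenRep_apply]; rfl
  | add x y _ _ hx hy => simp [hx, hy]
  | ι_mul_ι_mul v w x _ hx =>
    simp only [evenRep_apply, map_mul, Module.End.mul_apply, sevenRep_ι, hx]
    simp [Oct.mul_neg]

theorem evenRep_mul {x y : CliffordAlgebra euclid7} (hx : x ∈ CliffordAlgebra.even euclid7)
    (hy : y ∈ CliffordAlgebra.even euclid7) : evenRep (x * y) = evenRep x * evenRep y := by
  refine LinearMap.ext fun p => ?_
  rw [evenRep_apply, map_mul, Module.End.mul_apply, sevenRep_of_even hy, sevenRep_of_even hx]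
  rfl

theorem evenRep_one : evenRep 1 = 1 := by
  refine LinearMap.ext fun p => ?_
  simp [evenRep_apply]

theorem evenRep_injective {x y : CliffordAlgebra euclid7} (hx : x ∈ CliffordAlgebra.even euclid7)
    (hy : y ∈ CliffordAlgebra.even euclid7) (h : evenRep x = evenRep y) : x = y := by
  apply sevenRep_injective
  refine LinearMap.ext fun p => ?_
  rw [sevenRep_of_even hx, sevenRep_of_even hy, h]

theorem inner_sevenRep (x : CliffordAlgebra euclid7) : ∀ p q : Oct × Oct,
    inner ℝ (sevenRep x p).1 q.1 + inner ℝ (sevenRep x p).2 q.2 =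
      (inner ℝ p.1 (sevenRep (CliffordAlgebra.reverse x) q).1 +
        inner ℝ p.2 (sevenRep (CliffordAlgebra.reverse x) q).2 : ℝ) := by
  induction x using CliffordAlgebra.induction with
  | algebraMap r => intro p q; simp [real_inner_smul_left, real_inner_smul_right]
  | ι v =>
    intro p q
    simp only [CliffordAlgebra.reverse_ι, sevenRep_ι, inner_neg_left, inner_neg_right,
      Oct.inner_mul_left, Oct.conj_im, Oct.neg_mul]
    ring
  | mul x y hx hy => intro p q; simp [hx, hy]
  | add x y hx hy =>
    intro p q
    simp only [map_add, LinearMap.add_apply, Prod.fst_add, Prod.snd_add, inner_add_left,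
      inner_add_right]
    linarith [hx p q, hy p q]

theorem inner_evenRep (x : CliffordAlgebra euclid7) (p q : Oct) :
    inner ℝ (evenRep x p) q = inner ℝ p (evenRep (CliffordAlgebra.reverse x) q) := by
  have h := inner_sevenRep x (p, 0) (q, 0)
  simpa [evenRep_apply] using h

theorem star_eq_reverse {x : CliffordAlgebra euclid7} (hx : x ∈ CliffordAlgebra.even euclid7) :
    star x = CliffordAlgebra.reverse x := by
  rw [CliffordAlgebra.star_def, CliffordAlgebra.involute_eq_of_mem_even hx]

/-- `Spin(7)` acts on the octonions by the transformations described in `IsSpin7`. -/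
theorem isSpin7_evenRep {s : CliffordAlgebra euclid7} (hs : s ∈ spinGroup euclid7) :
    IsSpin7 (evenRep s) := by
  have hse := spinGroup.mem_even hs
  have hss := spinGroup.star_mul_self_of_mem hs
  have hinner : ∀ x y, inner ℝ (evenRep s x) (evenRep s y) = inner ℝ x y := by
    intro x y
    rw [inner_evenRep, ← star_eq_reverse hse, ← Module.End.mul_apply,
      ← evenRep_mul (spinGroup.mem_even (spinGroup.star_mem hs)) hse, hss, evenRep_one]
    rfl
  let g : (CliffordAlgebra euclid7)ˣ := ⟨s, star s, spinGroup.mul_star_self_of_mem hs, hss⟩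
  -- Conjugation by s preserves vectors, so A carries left multiplication by v to left
  -- multiplication by some w. This extends to all of 𝕆, and evaluation at 1 then identifies the
  -- multiplier as (A x)(A 1)̄.
  have hv : ∀ v, ∃ w, ∀ p, evenRep s (Oct.mul (Oct.im v) p) = Oct.mul (Oct.im w) (evenRep s p) := by
    intro v
    obtain ⟨w, hw⟩ := spinGroup.conjAct_smul_ι_mem_range_ι (x := g) hs v
    rw [ConjAct.units_smul_def, ConjAct.ofConjAct_toConjAct] at hw
    have h1 : CliffordAlgebra.ι euclid7 w * s = s * CliffordAlgebra.ι euclid7 v := by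
      rw [hw]
      exact Units.inv_mul_cancel_right _ g
    refine ⟨w, fun p => ?_⟩
    have h2 := congrArg (fun t => (sevenRep t (0, p)).1) h1
    simp only [map_mul, Module.End.mul_apply, sevenRep_ι, sevenRep_of_even hse] at h2
    exact h2.symm
  have hx : ∀ x, ∃ y, ∀ p, evenRep s (Oct.mul x p) = Oct.mul y (evenRep s p) := by
    intro x
    obtain ⟨v, hxv⟩ := Oct.exists_im x
    obtain ⟨w, hw⟩ := hv v
    refine ⟨x 0 • Oct.one + Oct.im w, fun p => ?_⟩
    conv_lhs => rw [hxv]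
    simp only [Oct.add_mul, Oct.smul_mul, Oct.one_mul, map_add, map_smul, hw]
  refine ⟨hinner, fun x u => ?_⟩
  obtain ⟨y, hy⟩ := hx x
  have h1 := hy Oct.one
  rw [Oct.mul_one] at h1
  rw [hy, h1, Oct.mul_mul_conj, hinner, inner_one_one, one_smul]

end GenSpin

/-! ### Spin transformations of 𝕆 as products of unit vectors -/

namespace GenSpin

theorem Oct.exists_im_of_inner_one {x : Oct} (hx : inner ℝ x Oct.one = 0) :
    Oct.im (fun i => x i.succ) = x := by
  have h0 : x 0 = 0 := by
    rw [inner_coords] at hx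
    simpa [Oct.one, basisVec_apply] using hx
  ext i
  fin_cases i <;> simp [Oct.im_coords, h0]

theorem inner_leftProd {l : List (Fin 7 → ℝ)} (hl : ∀ v ∈ l, euclid7 v = 1) (p q : Oct) :
    inner ℝ (leftProd l p) (leftProd l q) = inner ℝ p q := by
  induction l with
  | nil => simp [leftProd]
  | cons v l ih =>
    have hv : inner ℝ (Oct.im v) (Oct.im v) = (1 : ℝ) := by
      rw [← euclid7_apply]; exact hl v (by simp)
    rw [leftProd_cons, leftProd_cons, Oct.inner_mul_mul_left, hv, one_mul]
    exact ih fun w hw => hl w (by simp [hw])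

/-- The nucleus of 𝕆 is ℝ; three pairs of basis units already detect every imaginary coordinate of
b. -/
theorem Oct.eq_smul_one_of_assoc {b : Oct}
    (h : ∀ x y, Oct.mul (Oct.mul x y) b = Oct.mul x (Oct.mul y b)) : b = b 0 • Oct.one := by
  have h1 := fun i => congrArg (fun z : Oct => z i) (h (basisVec 1) (basisVec 2))
  have h2 := fun i => congrArg (fun z : Oct => z i) (h (basisVec 1) (basisVec 4))
  have h3 := fun i => congrArg (fun z : Oct => z i) (h (basisVec 2) (basisVec 4))
  simp only [Oct.mul_coords] at h1 h2 h3
  simp [Fin.forall_fin_succ, basisVec_apply] at h1 h2 h3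
  ext i
  fin_cases i <;> simp [basisVec_apply] <;> linarith

/-- Serves to rule out an odd number of reflections in `IsSpin7.exists_leftProd`. Four pairs of
orthogonal imaginary units suffice. -/
theorem Oct.eq_zero_of_antiassoc {b : Oct}
    (h : ∀ v w, (∃ z, Oct.mul (Oct.im v) (Oct.im w) = Oct.im z) →
      Oct.mul (Oct.mul (Oct.im v) (Oct.im w)) b = -Oct.mul (Oct.im v) (Oct.mul (Oct.im w) b)) :
    b = 0 := by
  have key : ∀ i j : Fin 7, i ≠ j → Oct.mul (Oct.mul (basisVec i.succ) (basisVec j.succ)) b =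
      -Oct.mul (basisVec i.succ) (Oct.mul (basisVec j.succ) b) := by
    intro i j hij
    have e : ∀ i : Fin 7, Oct.im (Pi.single i 1) = basisVec i.succ := by
      intro i
      ext k
      fin_cases i <;> fin_cases k <;> simp [Oct.im_coords, basisVec_apply]
    rw [← e, ← e]
    refine h _ _ ⟨fun k => Oct.mul (Oct.im (Pi.single i 1)) (Oct.im (Pi.single j 1)) k.succ, ?_⟩
    refine (Oct.exists_im_of_inner_one ?_).symm
    rw [Oct.inner_mul_left, Oct.mul_one, Oct.conj_im, inner_neg_right, Oct.inner_im]
    simp [Pi.single_apply, hij]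
  have h1 := fun i => congrArg (fun z : Oct => z i) (key 0 1 (by decide))
  have h2 := fun i => congrArg (fun z : Oct => z i) (key 0 3 (by decide))
  have h3 := fun i => congrArg (fun z : Oct => z i) (key 1 3 (by decide))
  have h4 := fun i => congrArg (fun z : Oct => z i) (key 2 3 (by decide))
  simp only [Oct.mul_coords] at h1 h2 h3 h4
  simp [Fin.forall_fin_succ, basisVec_apply] at h1 h2 h3 h4
  ext i
  fin_cases i <;> simp <;> linarith

/-- The isometry `x ↦ (A x) (A 1)̄` of the imaginary octonions. -/
theorem IsSpin7.exists_isometry {A : Module.End ℝ Oct} (hA : IsSpin7 A) :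
    ∃ π : EuclideanSpace ℝ (Fin 7) ≃ₗᵢ[ℝ] EuclideanSpace ℝ (Fin 7),
      ∀ (x : EuclideanSpace ℝ (Fin 7)) (p : Oct),
        A (Oct.mul (Oct.im x) p) = Oct.mul (Oct.im (π x)) (A p) := by
  have h1 : inner ℝ (A Oct.one) (A Oct.one) = (1 : ℝ) := by rw [hA.inner_map, inner_one_one]
  let P : Oct →ₗ[ℝ] Oct :=
    { toFun := fun x => Oct.mul (A x) (Oct.conj (A Oct.one))
      map_add' := fun x y => by rw [map_add, Oct.add_mul]
      map_smul' := fun c x => by rw [map_smul, Oct.smul_mul, RingHom.id_apply] }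
  have hP : ∀ x, P x = Oct.mul (A x) (Oct.conj (A Oct.one)) := fun x => rfl
  have hPi : ∀ v : Fin 7 → ℝ, Oct.im (fun i => P (Oct.im v) i.succ) = P (Oct.im v) := by
    intro v
    apply Oct.exists_im_of_inner_one
    -- P fixes 1 and preserves inner products, so it maps Im 𝕆, the complement of 1, to itself.
    have h2 : P Oct.one = Oct.one := by
      have := Oct.mul_mul_conj Oct.one (A Oct.one)
      rwa [Oct.one_mul, h1, one_smul] at this
    conv_lhs => rw [← h2]
    rw [hP, hP, Oct.inner_mul_mul_right, hA.inner_map]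
    simp [inner_coords, Oct.im_coords, basisVec_apply]
  let π₀ : EuclideanSpace ℝ (Fin 7) →ₗ[ℝ] EuclideanSpace ℝ (Fin 7) :=
    { toFun := fun x => WithLp.toLp 2 fun i => P (Oct.im x) i.succ
      map_add' := fun x y => by ext i; simp
      map_smul' := fun c x => by ext i; simp }
  let π₁ : EuclideanSpace ℝ (Fin 7) →ₗᵢ[ℝ] EuclideanSpace ℝ (Fin 7) := ⟨π₀, fun x => by
    have h3 : inner ℝ (π₀ x) (π₀ x) = (inner ℝ x x : ℝ) := by
      rw [← euclid7_eq_inner, ← euclid7_eq_inner, euclid7_apply, euclid7_apply]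
      change inner ℝ (Oct.im fun i => P (Oct.im x) i.succ) (Oct.im fun i => P (Oct.im x) i.succ) = _
      rw [hPi, hP, Oct.inner_mul_mul_right, Oct.inner_conj, h1, one_mul, hA.inner_map]
    rw [real_inner_self_eq_norm_sq, real_inner_self_eq_norm_sq] at h3
    exact (sq_eq_sq₀ (norm_nonneg _) (norm_nonneg _)).mp h3⟩
  refine ⟨π₁.toLinearIsometryEquiv rfl, fun x p => ?_⟩
  rw [hA.map_mul]
  congr 1
  exact (hPi x).symm

/-- A product of left multiplications implements the same isometry π up to sign, so C = (leftProd
l)⁻¹ A commutes or anticommutes with left multiplication by Im 𝕆. If l has even length, C is right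
multiplication by b = C 1, which lies in the nucleus and has norm one, so C = ±1. If the length is
odd, b is antiassociative, hence zero, contradicting orthogonality. -/
theorem IsSpin7.exists_leftProd {A : Module.End ℝ Oct} (hA : IsSpin7 A) :
    ∃ l : List (Fin 7 → ℝ), (∀ v ∈ l, euclid7 v = 1) ∧ Even l.length ∧
      (A = leftProd l ∨ A = -leftProd l) := by
  obtain ⟨π, hπ⟩ := hA.exists_isometry
  obtain ⟨l, hl, h⟩ := exists_leftProd_of_isometry π
  have hinj : Function.Injective (leftProd l) :=
    ((Module.End.isUnit_iff _).mp (isUnit_leftProd hl)).injective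
  obtain ⟨C, hC⟩ : ∃ C : Module.End ℝ Oct, ∀ p, leftProd l (C p) = A p := by
    obtain ⟨u, hu⟩ := isUnit_leftProd hl
    refine ⟨(↑u⁻¹ : Module.End ℝ Oct) * A, fun p => ?_⟩
    rw [← hu, ← Module.End.mul_apply, ← mul_assoc, Units.mul_inv, one_mul]
  have hCmul : ∀ (x : Fin 7 → ℝ) (p : Oct),
      C (Oct.mul (Oct.im x) p) = (-1 : ℝ) ^ l.length • Oct.mul (Oct.im x) (C p) := by
    intro x p
    apply hinj
    have h1 := h (WithLp.toLp 2 x) (C p)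
    have h2 := hπ (WithLp.toLp 2 x) p
    simp only at h1 h2
    rw [hC, map_smul, h1, smul_smul, ← mul_pow, h2, hC]
    simp
  have hC1 : ∀ x, C (Oct.im x) = (-1 : ℝ) ^ l.length • Oct.mul (Oct.im x) (C Oct.one) := by
    intro x
    have := hCmul x Oct.one
    rwa [Oct.mul_one] at this
  obtain ⟨b, hb⟩ : ∃ b, b = C Oct.one := ⟨_, rfl⟩
  rcases Nat.even_or_odd l.length with he | ho
  · rw [← hb, he.neg_one_pow] at hC1
    simp only [he.neg_one_pow, one_smul] at hCmul hC1
    have hx : ∀ x p, C (Oct.mul x p) = Oct.mul x (C p) := by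
      intro x p
      obtain ⟨v, hv⟩ := Oct.exists_im x
      rw [hv]
      simp only [Oct.add_mul, Oct.smul_mul, Oct.one_mul, map_add, map_smul, hCmul]
    have hx1 : ∀ x, C x = Oct.mul x b := by
      intro x
      have := hx x Oct.one
      rwa [Oct.mul_one, ← hb] at this
    have hreal := Oct.eq_smul_one_of_assoc (b := b) fun x y => by rw [← hx1, hx, hx1]
    have hAL : ∀ p, A p = b 0 • leftProd l p := by
      intro p
      rw [← hC, hx1, hreal, Oct.mul_smul, Oct.mul_one, map_smul]
      simp [basisVec_apply]
    have hsq : b 0 * b 0 = 1 := by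
      have := hA.inner_map Oct.one Oct.one
      rw [hAL, real_inner_smul_left, real_inner_smul_right, inner_leftProd hl, inner_one_one,
        mul_one] at this
      exact this
    refine ⟨l, hl, he, ?_⟩
    rcases mul_self_eq_one_iff.mp hsq with h0 | h0
    · exact Or.inl (LinearMap.ext fun p => by rw [hAL, h0, one_smul])
    · exact Or.inr (LinearMap.ext fun p => by rw [hAL, h0, neg_one_smul]; rfl)
  · exfalso
    simp only [ho.neg_one_pow, neg_smul, one_smul, ← hb] at hCmul hC1
    have hb0 : b = 0 := by
      apply Oct.eq_zero_of_antiassoc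
      rintro v w ⟨z, hz⟩
      have h1 := hCmul v (Oct.im w)
      rw [hz, hC1, hC1, Oct.mul_neg, neg_neg] at h1
      rw [hz, ← h1, neg_neg]
    have := hA.inner_map Oct.one Oct.one
    rw [← hC, ← hb, hb0, map_zero, inner_zero_left, inner_one_one] at this
    norm_num at this

theorem sevenRep_prod (l : List (Fin 7 → ℝ)) : ∃ c : ℝ, (c = 1 ∨ c = -1) ∧ ∀ p,
    sevenRep (l.map (CliffordAlgebra.ι euclid7)).prod (p, 0) =
      if Even l.length then (c • leftProd l p, 0) else (0, c • leftProd l p) := by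
  induction l with
  | nil => exact ⟨1, Or.inl rfl, fun p => by simp [leftProd]⟩
  | cons v l ih =>
    obtain ⟨c, hc, h⟩ := ih
    rcases Nat.even_or_odd l.length with he | ho
    · refine ⟨-c, by rcases hc with rfl | rfl <;> simp, fun p => ?_⟩
      rw [List.map_cons, List.prod_cons, map_mul, Module.End.mul_apply, h, if_pos he, sevenRep_ι,
        if_neg (by simpa [Nat.even_add_one] using he), leftProd_cons]
      simp [Oct.mul_smul, Oct.mul_zero]
    · have ho' := Nat.not_even_iff_odd.mpr ho
      refine ⟨c, hc, fun p => ?_⟩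
      rw [List.map_cons, List.prod_cons, map_mul, Module.End.mul_apply, h, if_neg ho', sevenRep_ι,
        if_pos (by simpa [Nat.even_add_one] using ho'), leftProd_cons]
      simp [Oct.mul_smul, Oct.mul_zero]

/-- Every transformation as in `IsSpin7` is a product of an even number of unit vectors. -/
theorem IsSpin7.exists_prod {A : Module.End ℝ Oct} (hA : IsSpin7 A) :
    ∃ l : List (Fin 7 → ℝ), (∀ v ∈ l, euclid7 v = 1) ∧ Even l.length ∧
      evenRep (l.map (CliffordAlgebra.ι euclid7)).prod = A := by
  obtain ⟨l, hl, he, hAl⟩ := hA.exists_leftProd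
  obtain ⟨c, hc, h⟩ := sevenRep_prod l
  have h1 : evenRep (l.map (CliffordAlgebra.ι euclid7)).prod = c • leftProd l :=
    LinearMap.ext fun p => by rw [evenRep_apply, h, if_pos he]; rfl
  have hA2 : evenRep (l.map (CliffordAlgebra.ι euclid7)).prod = A ∨
      evenRep (l.map (CliffordAlgebra.ι euclid7)).prod = -A := by
    rcases hc with rfl | rfl <;> rcases hAl with rfl | rfl <;> simp [h1]
  rcases hA2 with h2 | h2
  · exact ⟨l, hl, he, h2⟩
  · have hv : euclid7 (Pi.single 0 1) = 1 := by
      simp [euclid7_apply, Oct.inner_im, Pi.single_apply, -inner_self_eq_norm_sq_to_K]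
    -- The pair v, −v of unit vectors multiplies to −1: it corrects the sign and keeps the length
    -- even.
    refine ⟨Pi.single 0 1 :: -Pi.single 0 1 :: l, ?_, ?_, ?_⟩
    · simpa [hv, QuadraticMap.map_neg] using hl
    · simpa [Nat.even_add_one] using he
    · rw [List.map_cons, List.map_cons, List.prod_cons, List.prod_cons, ← mul_assoc, map_neg,
        mul_neg, CliffordAlgebra.ι_sq_scalar, hv, map_one, neg_one_mul, map_neg, h2, neg_neg]

end GenSpin

/-! ### Connectedness of Spin(7) -/

namespace GenSpin

theorem ι_mul_ι_mem_spinGroup {v w : Fin 7 → ℝ} (hv : euclid7 v = 1) (hw : euclid7 w = 1) :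
    CliffordAlgebra.ι euclid7 v * CliffordAlgebra.ι euclid7 w ∈ spinGroup euclid7 := by
  have hsq : ∀ {v}, euclid7 v = 1 → CliffordAlgebra.ι euclid7 v * CliffordAlgebra.ι euclid7 v = 1 := by
    intro v hv
    rw [CliffordAlgebra.ι_sq_scalar, hv, map_one]
  have hsq' : ∀ {v}, euclid7 v = 1 → ∀ x,
      CliffordAlgebra.ι euclid7 v * (CliffordAlgebra.ι euclid7 v * x) = x := by
    intro v hv x
    rw [← mul_assoc, hsq hv, one_mul]
  have hl : ∀ {v}, euclid7 v = 1 → CliffordAlgebra.ι euclid7 v ∈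
      (lipschitzGroup euclid7).toSubmonoid.map (Units.coeHom (CliffordAlgebra euclid7)) :=
    fun {v} hv => ⟨⟨CliffordAlgebra.ι _ v, CliffordAlgebra.ι _ v, hsq hv, hsq hv⟩,
      Subgroup.subset_closure ⟨v, rfl⟩, rfl⟩
  refine ⟨⟨mul_mem (hl hv) (hl hw), ?_⟩, ?_⟩
  · constructor <;> simp [CliffordAlgebra.star_ι, mul_assoc, hsq' hv, hsq' hw, hsq hv, hsq hw]
  exact CliffordAlgebra.ι_mul_ι_mem_evenOdd_zero _ _ _

/-- The products of `n` pairs of unit vectors. -/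
def pairProducts : ℕ → Set (CliffordAlgebra euclid7)
  | 0 => {1}
  | n + 1 => (fun p : ((Fin 7 → ℝ) × (Fin 7 → ℝ)) × CliffordAlgebra euclid7 =>
      CliffordAlgebra.ι euclid7 p.1.1 * CliffordAlgebra.ι euclid7 p.1.2 * p.2) ''
        (({v | euclid7 v = 1} ×ˢ {v | euclid7 v = 1}) ×ˢ pairProducts n)

theorem prod_mem_pairProducts (n : ℕ) : ∀ l : List (Fin 7 → ℝ), (∀ v ∈ l, euclid7 v = 1) →
    l.length = n + n → (l.map (CliffordAlgebra.ι euclid7)).prod ∈ pairProducts n := by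
  induction n with
  | zero =>
    intro l _ h
    rw [List.length_eq_zero_iff.mp h]
    simp [pairProducts]
  | succ n ih =>
    intro l hl h
    match l, h with
    | [], h => simp at h
    | [v], h => simp at h; omega
    | v :: w :: l, h =>
      refine ⟨((v, w), (l.map (CliffordAlgebra.ι euclid7)).prod),
        ⟨⟨hl v (by simp), hl w (by simp)⟩, ih l (fun x hx => hl x (by simp [hx])) ?_⟩, ?_⟩
      · simp at h; omega
      · simp [mul_assoc]

theorem pairProducts_subset (n : ℕ) : pairProducts n ⊆ spinGroup euclid7 := by
  induction n with
  | zero => rintro _ rfl; exact one_mem _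
  | succ n ih =>
    rintro _ ⟨⟨⟨v, w⟩, x⟩, ⟨⟨hv, hw⟩, hx⟩, rfl⟩
    exact mul_mem (ι_mul_ι_mem_spinGroup hv hw) (ih hx)

theorem one_mem_pairProducts (n : ℕ) : 1 ∈ pairProducts n := by
  induction n with
  | zero => rfl
  | succ n ih =>
    have hv : euclid7 (Pi.single 0 1) = 1 := by
      simp [euclid7_apply, Oct.inner_im, Pi.single_apply, -inner_self_eq_norm_sq_to_K]
    refine ⟨((Pi.single 0 1, Pi.single 0 1), 1), ⟨⟨hv, hv⟩, ih⟩, ?_⟩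
    simp [CliffordAlgebra.ι_sq_scalar, hv]

theorem isPreconnected_euclid7 : IsPreconnected {v | euclid7 v = 1} := by
  have h := (isPreconnected_sphere (E := EuclideanSpace ℝ (Fin 7))
    (by rw [← Module.finrank_eq_rank]; simp) 0 1).image WithLp.ofLp
      (PiLp.continuous_ofLp 2 _).continuousOn
  convert h using 1
  ext v
  constructor
  · intro hv
    refine ⟨WithLp.toLp 2 v, ?_, rfl⟩
    have := euclid7_eq_inner (WithLp.toLp 2 v)
    rw [real_inner_self_eq_norm_sq] at this
    rw [mem_sphere_zero_iff_norm]
    exact (sq_eq_sq₀ (norm_nonneg _) zero_le_one).mp (by rw [← this, one_pow]; exact hv)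
  · rintro ⟨x, hx, rfl⟩
    rw [mem_sphere_zero_iff_norm] at hx
    rw [Set.mem_ofPred_eq, euclid7_eq_inner, real_inner_self_eq_norm_sq, hx, one_pow]

theorem isPreconnected_pairProducts (n : ℕ) : IsPreconnected (pairProducts n) := by
  induction n with
  | zero => exact isPreconnected_singleton
  | succ n ih =>
    have hc : Continuous (CliffordAlgebra.ι euclid7) :=
      LinearMap.continuous_of_finiteDimensional _
    exact ((isPreconnected_euclid7.prod isPreconnected_euclid7).prod ih).image _
      (by fun_prop)

theorem exists_of_isSpin7 {A : Module.End ℝ Oct} (hA : IsSpin7 A) :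
    ∃ n, ∃ x ∈ pairProducts n, evenRep x = A := by
  obtain ⟨l, hl, ⟨n, hn⟩, h⟩ := hA.exists_prod
  exact ⟨n, _, prod_mem_pairProducts n l hl hn, h⟩

/-- The action of s on 𝕆 is also the action of a product of pairs of unit vectors, and the even
Clifford algebra acts faithfully, so s is that product. The spin group becomes a union of connected
sets through 1. -/
theorem spinGroup_eq_iUnion : (spinGroup euclid7 : Set (CliffordAlgebra euclid7)) =
    ⋃ n, pairProducts n := by
  apply Set.Subset.antisymm
  · intro s hs
    obtain ⟨n, x, hx, h⟩ := exists_of_isSpin7 (isSpin7_evenRep hs)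
    rw [← evenRep_injective (spinGroup.mem_even (pairProducts_subset n hx))
      (spinGroup.mem_even hs) h]
    exact Set.mem_iUnion.mpr ⟨n, hx⟩
  · exact Set.iUnion_subset pairProducts_subset

instance : PreconnectedSpace Spin7 := by
  apply Subtype.preconnectedSpace
  have : IsPreconnected (⋃ n, pairProducts n) :=
    isPreconnected_iUnion ⟨1, Set.mem_iInter.mpr one_mem_pairProducts⟩ isPreconnected_pairProducts
  rw [← spinGroup_eq_iUnion] at this
  exact this

end GenSpin

namespace GenSpin

/-! ### The two copies of `Spin(7)` in the isotropy group -/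

/-- The bilinear part of `liftEnd`. -/
def liftFst : Module.End ℝ Oct →ₗ[ℝ] Module.End ℝ Oct →ₗ[ℝ] Module.End ℝ (Oct × Oct) :=
  LinearMap.mk₂ ℝ (fun A B => LinearMap.inl ℝ Oct Oct ∘ₗ
      Oct.mulₗ.flip (Oct.conj (B Oct.one)) ∘ₗ A ∘ₗ LinearMap.fst ℝ Oct Oct)
    (fun A A' B => by refine LinearMap.ext fun p => ?_; simp)
    (fun c A B => by refine LinearMap.ext fun p => ?_; simp)
    (fun A B B' => by refine LinearMap.ext fun p => ?_; simp)
    (fun c A B => by refine LinearMap.ext fun p => ?_; simp)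

/-- The linear part of `liftEnd`. -/
def liftSnd : Module.End ℝ Oct →ₗ[ℝ] Module.End ℝ (Oct × Oct) where
  toFun A := LinearMap.inr ℝ Oct Oct ∘ₗ A ∘ₗ LinearMap.snd ℝ Oct Oct
  map_add' A B := by refine LinearMap.ext fun p => ?_; simp
  map_smul' c A := by refine LinearMap.ext fun p => ?_; simp

/-- The endomorphism `(x, y) ↦ ((A x) (A 1)̄, A y)` of `𝕆 ⊕ 𝕆`. -/
def liftEnd (A : Module.End ℝ Oct) : Module.End ℝ (Oct × Oct) := liftFst A A + liftSnd A

theorem liftEnd_apply (A : Module.End ℝ Oct) (p : Oct × Oct) :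
    liftEnd A p = (Oct.mul (A p.1) (Oct.conj (A Oct.one)), A p.2) := by
  simp [liftEnd, liftFst, liftSnd]

theorem liftEnd_one : liftEnd 1 = 1 := by
  refine LinearMap.ext fun p => ?_
  simp [liftEnd_apply, Oct.conj_one, Oct.mul_one]

theorem IsSpin7.inner_one {A : Module.End ℝ Oct} (hA : IsSpin7 A) :
    inner ℝ (A Oct.one) (A Oct.one) = (1 : ℝ) := by rw [hA.inner_map, inner_one_one]

theorem liftEnd_mul {A B : Module.End ℝ Oct} (hA : IsSpin7 A) (hB : IsSpin7 B) :
    liftEnd (A * B) = liftEnd A * liftEnd B := by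
  refine LinearMap.ext fun p => ?_
  simp only [Module.End.mul_apply, liftEnd_apply, Prod.mk.injEq, and_true]
  have h1 := hA.map_mul (Oct.mul (B p.1) (Oct.conj (B Oct.one))) (B Oct.one)
  have h2 := Oct.mul_conj_mul (B p.1) (B Oct.one)
  rw [hB.inner_one, one_smul] at h2
  rw [h2] at h1
  rw [h1, Oct.mul_mul_conj, hA.inner_map, hB.inner_one, one_smul]

theorem liftEnd_spinorOne {A : Module.End ℝ Oct} (hA : IsSpin7 A) :
    liftEnd A spinorOne = spinorOne := by
  rw [liftEnd_apply, map_zero]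
  have := Oct.mul_mul_conj Oct.one (A Oct.one)
  rw [Oct.one_mul, hA.inner_one, one_smul] at this
  exact Prod.ext this rfl

theorem IsSpin7.map_mul_conj {A : Module.End ℝ Oct} (hA : IsSpin7 A) (y u : Oct) :
    Oct.mul (A (Oct.mul y (Oct.conj u))) (Oct.conj (A Oct.one)) = Oct.mul (A y) (Oct.conj (A u)) := by
  rcases eq_or_ne u 0 with rfl | hu
  · have h0 : Oct.conj 0 = 0 := map_zero Oct.conj
    simp only [map_zero, h0, Oct.mul_zero, Oct.zero_mul]
  · have h1 := congrArg (fun z => Oct.mul z (Oct.conj (A u))) (hA.map_mul (Oct.mul y (Oct.conj u)) u)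
    simp only [Oct.mul_conj_mul, map_smul, Oct.smul_mul, Oct.mul_mul_conj, hA.inner_map] at h1
    exact (smul_right_injective Oct (inner_self_ne_zero.mpr hu) h1).symm

/-- The defining identity of `IsSpin7` gives the odd component and `map_mul_conj`, its form with ū,
gives the even one. Thus A on vectors is implemented by `liftEnd A` on spinors. -/
theorem liftEnd_octRep {A : Module.End ℝ Oct} (hA : IsSpin7 A) (ε : ℝ) (u : Oct) :
    liftEnd A * octRep ε (CliffordAlgebra.ι _ u) =
      octRep ε (CliffordAlgebra.ι _ (A u)) * liftEnd A := by
  refine LinearMap.ext fun p => ?_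
  simp only [Module.End.mul_apply, octRep_ι, liftEnd_apply, map_smul, Oct.smul_mul,
    hA.map_mul_conj, hA.map_mul p.1 u]

/-- The spin representation of the Clifford algebra of `(𝕆, ε ‖u‖²)` as an isomorphism. -/
def octEquiv {ε : ℝ} (hε : ε * ε = 1) :
    CliffordAlgebra (normForm ε) ≃ₐ[ℝ] Module.End ℝ (Oct × Oct) :=
  AlgEquiv.ofBijective (octRep ε) (octRep_bijective hε)

theorem octRep_octEquiv_symm {ε : ℝ} (hε : ε * ε = 1) (a : Module.End ℝ (Oct × Oct)) :
    octRep ε ((octEquiv hε).symm a) = a := (octEquiv hε).apply_symm_apply a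

/-- The homomorphism `Spin(7) → CL(𝕆, ε ‖u‖²)` through which `Spin(7)` acts on `𝕆` by the spin
representation. -/
def spinLift {ε : ℝ} (hε : ε * ε = 1) : Spin7 →* CliffordAlgebra (normForm ε) where
  toFun s := (octEquiv hε).symm (liftEnd (evenRep s))
  map_one' := by rw [Submonoid.coe_one, evenRep_one, liftEnd_one, map_one]
  map_mul' s t := by
    rw [Submonoid.coe_mul, evenRep_mul (spinGroup.mem_even s.2) (spinGroup.mem_even t.2),
      liftEnd_mul (isSpin7_evenRep s.2) (isSpin7_evenRep t.2), map_mul]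

theorem octRep_spinLift {ε : ℝ} (hε : ε * ε = 1) (s : Spin7) :
    octRep ε (spinLift hε s) = liftEnd (evenRep s) := octRep_octEquiv_symm hε _

/-- `liftEnd` is the sum of a quadratic and a linear map of A, so the lift is a bilinear map on the
diagonal plus a linear map, in finite dimension. -/
theorem continuous_spinLift {ε : ℝ} (hε : ε * ε = 1) : Continuous (spinLift hε) := by
  let β : CliffordAlgebra euclid7 →ₗ[ℝ] CliffordAlgebra euclid7 →ₗ[ℝ] CliffordAlgebra (normForm ε) :=
    (liftFst.compl₁₂ evenRep evenRep).compr₂ (octEquiv hε).symm.toLinearMap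
  have h1 : Continuous fun p : CliffordAlgebra euclid7 × CliffordAlgebra euclid7 => β p.1 p.2 :=
    IsModuleTopology.continuous_bilinear_of_finite_left β
  have h2 : Continuous ((octEquiv hε).symm.toLinearMap ∘ₗ liftSnd ∘ₗ evenRep) :=
    IsModuleTopology.continuous_of_linearMap _
  have h3 : Continuous fun x : CliffordAlgebra euclid7 =>
      β x x + ((octEquiv hε).symm.toLinearMap ∘ₗ liftSnd ∘ₗ evenRep) x :=
    (h1.comp (continuous_id.prodMk continuous_id)).add h2
  refine (h3.comp continuous_subtype_val).congr fun s => ?_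
  exact (map_add (octEquiv hε).symm _ _).symm

theorem involute_spinLift {ε : ℝ} (hε : ε * ε = 1) (s : Spin7) :
    CliffordAlgebra.involute (spinLift hε s) = spinLift hε s := by
  apply octRep_injective hε
  refine LinearMap.ext fun p => ?_
  rw [octRep_involute, octRep_spinLift]
  simp [liftEnd_apply]

theorem spinLift_mul_ι {ε : ℝ} (hε : ε * ε = 1) (s : Spin7) (u : Oct) :
    spinLift hε s * CliffordAlgebra.ι _ u = CliffordAlgebra.ι _ (evenRep s u) * spinLift hε s := by
  apply octRep_injective hε
  rw [map_mul, map_mul, octRep_spinLift, liftEnd_octRep (isSpin7_evenRep s.2)]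

theorem spinRep_spinLift {ε : ℝ} (hε : ε * ε = 1) (s : Spin7) :
    spinRep (octMap ε (spinLift hε s)) PhiSpin = PhiSpin := by
  rw [spinRep_octMap_congr hε (z := 1), map_one, map_one, Module.End.one_apply]
  rw [octRep_spinLift, liftEnd_spinorOne (isSpin7_evenRep s.2), map_one, Module.End.one_apply]

theorem commute_octMap {ε δ : ℝ} (h : δ = -ε) {x : CliffordAlgebra (normForm ε)}
    (hx : CliffordAlgebra.involute x = x) (y : CliffordAlgebra (normForm δ)) :
    Commute (octMap δ y) (octMap ε x) := by
  subst h
  exact octMap_comm_of_involute hx y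

/-- The homomorphism `Spin(7) × Spin(7) → CL(𝕆 ⊕ 𝕆*)`. -/
def spinPairHom : Spin7 × Spin7 →* Cl Oct :=
  MonoidHom.noncommCoprod
    ((octMap 1 : CliffordAlgebra (normForm 1) →* Cl Oct).comp (spinLift (one_mul 1)))
    ((octMap (-1) : CliffordAlgebra (normForm (-1)) →* Cl Oct).comp
      (spinLift (neg_mul_self_eq_one (one_mul 1))))
    fun s t => (octMap_comm_of_involute (involute_spinLift (one_mul 1) s)
      (spinLift (neg_mul_self_eq_one (one_mul 1)) t)).symm

theorem spinPairHom_apply (p : Spin7 × Spin7) : spinPairHom p =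
    octMap 1 (spinLift (one_mul 1) p.1) *
      octMap (-1) (spinLift (neg_mul_self_eq_one (one_mul 1)) p.2) := rfl

theorem continuous_spinPairHom : Continuous spinPairHom := by
  have h : ∀ ε : ℝ, Continuous (octMap ε) := fun ε =>
    IsModuleTopology.continuous_of_linearMap (octMap ε).toLinearMap
  exact (((h 1).comp (continuous_spinLift _)).comp continuous_fst).mul
    (((h (-1)).comp (continuous_spinLift _)).comp continuous_snd)

theorem spinPairHom_mul_fst (p : Spin7 × Spin7) (u : Oct) :
    spinPairHom p * incl Oct (genEmb 1 u) = incl Oct (genEmb 1 (evenRep p.1 u)) * spinPairHom p := by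
  have h := commute_octMap (neg_neg (1 : ℝ)).symm
    (involute_spinLift (neg_mul_self_eq_one (one_mul 1)) p.2) (CliffordAlgebra.ι (normForm 1) u)
  rw [octMap_ι] at h
  rw [spinPairHom_apply, mul_assoc, ← h.eq, ← mul_assoc, ← octMap_ι, ← map_mul, spinLift_mul_ι,
    map_mul, octMap_ι, mul_assoc]

theorem spinPairHom_mul_snd (p : Spin7 × Spin7) (u : Oct) :
    spinPairHom p * incl Oct (genEmb (-1) u) =
      incl Oct (genEmb (-1) (evenRep p.2 u)) * spinPairHom p := by
  have h := octMap_comm_of_involute (involute_spinLift (one_mul 1) p.1)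
    (CliffordAlgebra.ι (normForm (-1)) (evenRep p.2 u))
  rw [octMap_ι] at h
  rw [spinPairHom_apply, mul_assoc, ← octMap_ι, ← map_mul, spinLift_mul_ι, map_mul, octMap_ι,
    ← mul_assoc, ← h.eq, mul_assoc]

end GenSpin

/-! ### The image of Spin(7) × Spin(7) in the isotropy group -/

namespace GenSpin

/-- The homomorphism `Spin(7) × Spin(7) → CL(𝕆 ⊕ 𝕆*)ˣ`. -/
def spinPairUnits : Spin7 × Spin7 →* (Cl Oct)ˣ := spinPairHom.toHomUnits

theorem coe_spinPairUnits (p : Spin7 × Spin7) : (spinPairUnits p : Cl Oct) = spinPairHom p := rfl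

theorem coe_spinPairUnits_inv (p : Spin7 × Spin7) :
    (↑(spinPairUnits p)⁻¹ : Cl Oct) = spinPairHom p⁻¹ := rfl

theorem continuous_inv_spin7 : Continuous fun s : Spin7 => s⁻¹ := by
  have h : Continuous (CliffordAlgebra.reverse (Q := euclid7)) :=
    IsModuleTopology.continuous_of_linearMap _
  refine continuous_induced_rng.mpr ((h.comp continuous_subtype_val).congr fun s => ?_)
  exact (star_eq_reverse (spinGroup.mem_even s.2)).symm

theorem continuous_spinPairUnits : Continuous spinPairUnits := by
  rw [Units.continuous_iff]
  refine ⟨continuous_spinPairHom, continuous_spinPairHom.comp ?_⟩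
  exact (continuous_inv_spin7.comp continuous_fst).prodMk
    (continuous_inv_spin7.comp continuous_snd)

theorem mem_identityComponent_of_continuous {P G : Type*} [Group P] [TopologicalSpace P]
    [PreconnectedSpace P] [Group G] [TopologicalSpace G] [IsTopologicalGroup G] {K : Subgroup G}
    {f : P →* G} (hf : Continuous f) (hK : ∀ p, f p ∈ K) (p : P) : f p ∈ identityComponent K := by
  have hc : Continuous fun p => (⟨f p, hK p⟩ : K) := by fun_prop
  refine ⟨⟨f p, hK p⟩, ?_, rfl⟩
  refine (isPreconnected_range hc).subset_connectedComponent ⟨1, ?_⟩ ⟨p, rfl⟩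
  exact Subtype.ext (map_one f)

theorem involute_spinPairHom (p : Spin7 × Spin7) :
    CliffordAlgebra.involute (spinPairHom p) = spinPairHom p := by
  have h : ∀ (ε : ℝ) (x : CliffordAlgebra (normForm ε)), CliffordAlgebra.involute (octMap ε x) =
      octMap ε (CliffordAlgebra.involute x) := by
    intro ε x
    induction x using CliffordAlgebra.induction with
    | algebraMap r => simp
    | ι u => simp [octMap_ι]
    | mul x y hx hy => simp [hx, hy]
    | add x y hx hy => simp [hx, hy]
  rw [spinPairHom_apply, map_mul, h, h, involute_spinLift, involute_spinLift]

theorem mem_even_of_involute {R M : Type*} [Field R] [CharZero R] [AddCommGroup M] [Module R M]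
    {Q : QuadraticForm R M} {x : CliffordAlgebra Q} (hx : CliffordAlgebra.involute x = x) :
    x ∈ CliffordAlgebra.even Q := by
  obtain ⟨a, ha, b, hb, rfl⟩ := Submodule.mem_sup.mp
    ((CliffordAlgebra.evenOdd_isCompl Q).sup_eq_top.symm ▸ Submodule.mem_top : x ∈ _)
  rw [map_add, CliffordAlgebra.involute_eq_of_mem_even ha,
    CliffordAlgebra.involute_eq_of_mem_odd hb, add_right_inj] at hx
  have h2 : (2 : R) • b = 0 := by rw [two_smul]; nth_rw 1 [← hx]; exact neg_add_cancel b
  rw [(smul_eq_zero.mp h2).resolve_left two_ne_zero, add_zero]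
  exact ha

theorem spinPairUnits_mem_CSpin (p : Spin7 × Spin7) : spinPairUnits p ∈ CSpin Oct := by
  refine ⟨fun E => ?_, ?_⟩
  · obtain ⟨u, w, rfl⟩ := exists_genEmb (one_mul 1) E
    refine ⟨genEmb 1 (evenRep p⁻¹.1 u) + genEmb (-1) (evenRep p⁻¹.2 w), ?_⟩
    rw [twistedAd_apply, coe_spinPairUnits_inv, involute_spinPairHom, ← mul_assoc, map_add, map_add,
      mul_add, spinPairHom_mul_fst, spinPairHom_mul_snd, ← add_mul, mul_assoc, ← map_add,
      coe_spinPairUnits, ← map_mul, inv_mul_cancel, map_one, mul_one]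
  · exact (Submonoid.mem_units_iff _ _).mpr ⟨mem_even_of_involute (involute_spinPairHom p),
      mem_even_of_involute (involute_spinPairHom p⁻¹)⟩

theorem spinRep_spinPairHom (p : Spin7 × Spin7) : spinRep (spinPairHom p) PhiSpin = PhiSpin := by
  rw [spinPairHom_apply, map_mul, Module.End.mul_apply, spinRep_spinLift, spinRep_spinLift]

/-- Connectedness is used twice: to land in CSpin₀, so that the image lies in the isotropy group,
and then to land in the identity component of that group. -/
theorem spinPairUnits_mem_H₀ (p : Spin7 × Spin7) : spinPairUnits p ∈ H₀ := by
  refine mem_identityComponent_of_continuous (K := isotropy) continuous_spinPairUnits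
    (fun p => ⟨?_, ?_⟩) p
  · exact mem_identityComponent_of_continuous continuous_spinPairUnits spinPairUnits_mem_CSpin p
  · exact spinRep_spinPairHom p

theorem evenRep_coe_injective {s t : Spin7} (h : ∀ u, evenRep s u = evenRep t u) : s = t :=
  Subtype.ext (evenRep_injective (spinGroup.mem_even s.2) (spinGroup.mem_even t.2)
    (LinearMap.ext h))

theorem spinPairUnits_injective : Function.Injective spinPairUnits := by
  intro p q h
  have h' : spinPairHom p = spinPairHom q := congrArg Units.val h
  have hu : ∀ (ε : ℝ) {a b : Oct}, incl Oct (genEmb ε a) * spinPairHom p =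
      incl Oct (genEmb ε b) * spinPairHom p → a = b := by
    intro ε a b hab
    exact genEmb_injective ε (incl_injective ((spinPairUnits p).isUnit.mul_right_cancel hab))
  refine Prod.ext (evenRep_coe_injective fun u => hu 1 ?_)
    (evenRep_coe_injective fun u => hu (-1) ?_)
  · rw [← spinPairHom_mul_fst, h', ← spinPairHom_mul_fst]
  · rw [← spinPairHom_mul_snd, h', ← spinPairHom_mul_snd]

/-! ### Every element of the isotropy group comes from `Spin(7) × Spin(7)` -/

/-- For vectors u, w the form u · w · Φ_Spin depends only on w ū. Since g fixes Φ_Spin, the same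
holds for Au · Aw · Φ_Spin, and `spinRep_octMap_injective` reads this back as an identity between
octonions, from which multiplicativity follows. -/
theorem even_stabilizer_conj (g : Cpin Oct) (heven : CliffordAlgebra.involute (g.1 : Cl Oct) = g.1)
    (hg : spinRep (g.1 : Cl Oct) PhiSpin = PhiSpin) {ε : ℝ} (hε : ε * ε = 1) :
    ∃ A : Module.End ℝ Oct, IsSpin7 A ∧
      ∀ u, (g.1 : Cl Oct) * incl Oct (genEmb ε u) = incl Oct (genEmb ε (A u)) * g.1 := by
  have hginv : spinRep (g⁻¹.1 : Cl Oct) PhiSpin = PhiSpin := by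
    conv_lhs => rw [← hg]
    rw [← Module.End.mul_apply, ← map_mul, Subgroup.coe_inv, Units.inv_mul, map_one,
      Module.End.one_apply]
  -- The inverse appears because Ad_g is g̃⁻¹ E g, so for even g the map E ↦ g E g⁻¹ is Ad of g⁻¹.
  let A : Module.End ℝ Oct := LinearMap.snd ℝ _ _ ∘ₗ Ad g⁻¹ ∘ₗ genEmb ε
  have hA : ∀ u, Ad g⁻¹ (genEmb ε u) = genEmb ε (A u) := by
    intro u
    obtain ⟨u', h⟩ := Ad_genEmb hε g⁻¹ hginv u
    have : A u = u' := congrArg Prod.snd h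
    rw [this, h]
  have hconj : ∀ u, (g.1 : Cl Oct) * incl Oct (genEmb ε u) = incl Oct (genEmb ε (A u)) * g.1 := by
    intro u
    rw [← hA, incl_Ad, Subgroup.coe_inv, inv_inv, heven, ← mul_assoc, mul_assoc, Units.inv_mul,
      mul_one]
  have hsq : ∀ u, inner ℝ (A u) (A u) = (inner ℝ u u : ℝ) := by
    intro u
    have h := dualProd_Ad g⁻¹ (genEmb ε u)
    rw [hA, dualProd_genEmb, dualProd_genEmb] at h
    exact mul_left_cancel₀ (left_ne_zero_of_mul_eq_one hε) h
  have hinner : ∀ x y, inner ℝ (A x) (A y) = (inner ℝ x y : ℝ) := by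
    intro x y
    have h := hsq (x + y)
    simp only [map_add, inner_add_left, inner_add_right, hsq] at h
    rw [real_inner_comm (A x) (A y), real_inner_comm x y] at h
    linarith
  have hspin : ∀ u w, spinRep (octMap ε (CliffordAlgebra.ι _ (A u) * CliffordAlgebra.ι _ (A w)))
      PhiSpin = spinRep (g.1 : Cl Oct)
        (spinRep (octMap ε (CliffordAlgebra.ι _ u * CliffordAlgebra.ι _ w)) PhiSpin) := by
    intro u w
    rw [← Module.End.mul_apply, ← map_mul spinRep, map_mul (octMap ε), map_mul (octMap ε), octMap_ι,
      octMap_ι, octMap_ι, octMap_ι, ← mul_assoc, hconj, mul_assoc, hconj, ← mul_assoc,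
      map_mul spinRep _ (g.1 : Cl Oct), Module.End.mul_apply _ (spinRep (g.1 : Cl Oct)), hg]
  have hrep : ∀ u w, octRep ε (CliffordAlgebra.ι _ u * CliffordAlgebra.ι _ w) spinorOne =
      (ε • Oct.mul w (Oct.conj u), 0) := by
    intro u w
    rw [map_mul, Module.End.mul_apply, octRep_ι, octRep_ι]
    simp [Oct.one_mul, Oct.zero_mul]
  have hmul : ∀ u w, Oct.mul (A u) (Oct.conj (A w)) =
      Oct.mul (A (Oct.mul u (Oct.conj w))) (Oct.conj (A Oct.one)) := by
    intro u w
    have h1 := spinRep_octMap_congr hε (y := CliffordAlgebra.ι _ u * CliffordAlgebra.ι _ w)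
      (z := CliffordAlgebra.ι _ (Oct.mul u (Oct.conj w)) * CliffordAlgebra.ι _ Oct.one) (by
        rw [hrep, hrep, Oct.one_mul, Oct.conj_mul, Oct.conj_conj])
    have h2 := congrArg (spinRep (g.1 : Cl Oct)) h1
    rw [← hspin, ← hspin] at h2
    have h3 := congrArg Prod.fst (spinRep_octMap_injective hε h2)
    rw [hrep, hrep] at h3
    have h4 := congrArg Oct.conj (smul_right_injective Oct (left_ne_zero_of_mul_eq_one hε) h3)
    rwa [Oct.conj_mul, Oct.conj_mul, Oct.conj_conj, Oct.conj_conj] at h4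
  refine ⟨A, ⟨hinner, fun x u => ?_⟩, hconj⟩
  rcases eq_or_ne u 0 with rfl | hu
  · rw [Oct.mul_zero, map_zero, Oct.mul_zero]
  · have h := congrArg (fun z => Oct.mul z (A u)) (hmul (Oct.mul x u) u)
    simp only [Oct.mul_conj_mul, Oct.mul_mul_conj, map_smul, Oct.smul_mul, hinner] at h
    exact smul_right_injective Oct (inner_self_ne_zero.mpr hu) h

/-- The quotient h⁻¹ g commutes with vectors, hence with all of CL, and fixes the cyclic vector
Φ_Spin. It therefore acts as the identity, and the representation is faithful. -/
theorem eq_of_conj_eq {g h : (Cl Oct)ˣ} (hg : spinRep (g : Cl Oct) PhiSpin = PhiSpin)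
    (hh : spinRep (h : Cl Oct) PhiSpin = PhiSpin)
    (H : ∀ E, ∃ F, (g : Cl Oct) * incl Oct E = incl Oct F * g ∧
      (h : Cl Oct) * incl Oct E = incl Oct F * h) : g = h := by
  have hcomm : ∀ x : Cl Oct, Commute (↑(h⁻¹ * g) : Cl Oct) x := by
    intro x
    induction x using CliffordAlgebra.induction with
    | algebraMap r => exact Algebra.commute_algebraMap_right r _
    | ι E =>
      obtain ⟨F, h1, h2⟩ := H E
      rw [Units.val_mul, commute_iff_eq, mul_assoc, h1, ← mul_assoc, ← mul_assoc]
      congr 1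
      rw [Units.inv_mul_eq_iff_eq_mul, ← mul_assoc, h2, Units.mul_inv_cancel_right] 
    | mul x y hx hy => exact hx.mul_right hy
    | add x y hx hy => exact hx.add_right hy
  have hfix : spinRep (↑(h⁻¹ * g) : Cl Oct) PhiSpin = PhiSpin := by
    rw [Units.val_mul, map_mul, Module.End.mul_apply, hg]
    conv_lhs => rw [← hh]
    rw [← Module.End.mul_apply, ← map_mul, Units.inv_mul, map_one, Module.End.one_apply]
  have h1 : spinRep (↑(h⁻¹ * g) : Cl Oct) = 1 := by
    refine LinearMap.ext fun φ => ?_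
    obtain ⟨x, rfl⟩ : ∃ x : Cl Oct, spinRep x PhiSpin = φ := by
      obtain ⟨f, hf⟩ := Module.Projective.exists_dual_ne_zero ℝ PhiSpin_ne_zero
      obtain ⟨x, hx⟩ := spinRep_surjective (f.smulRight ((f PhiSpin)⁻¹ • φ))
      exact ⟨x, by rw [hx, LinearMap.smulRight_apply, smul_smul, mul_inv_cancel₀ hf, one_smul]⟩
    rw [← Module.End.mul_apply, ← map_mul, (hcomm x).eq, map_mul, Module.End.mul_apply, hfix]
    rfl
  have h2 : h⁻¹ * g = 1 := Units.ext (spinRep_injective (by rw [h1, Units.val_one, map_one]))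
  exact (inv_mul_eq_one.mp h2).symm

/-- The pair is read off from conjugation on C₊ and on C₋. Membership in H₀ enters only through
membership in the full isotropy group. -/
theorem exists_spinPair {g : (Cl Oct)ˣ} (hg : g ∈ H₀) : ∃ p, spinPairUnits p = g := by
  have hiso : g ∈ isotropy := by
    obtain ⟨g, -, rfl⟩ := hg
    exact g.2
  have hCSpin : g ∈ CSpin Oct := by
    obtain ⟨g, -, rfl⟩ := hiso.1
    exact g.2
  have heven : CliffordAlgebra.involute (g : Cl Oct) = g :=
    CliffordAlgebra.involute_eq_of_mem_even ((Submonoid.mem_units_iff _ _).mp hCSpin.2).1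
  obtain ⟨A, hA, hA'⟩ := even_stabilizer_conj ⟨g, hCSpin.1⟩ heven hiso.2 (one_mul 1)
  obtain ⟨B, hB, hB'⟩ := even_stabilizer_conj ⟨g, hCSpin.1⟩ heven hiso.2
    (neg_mul_self_eq_one (one_mul 1))
  obtain ⟨m, s, hs, rfl⟩ := exists_of_isSpin7 hA
  obtain ⟨n, t, ht, rfl⟩ := exists_of_isSpin7 hB
  refine ⟨(⟨s, pairProducts_subset m hs⟩, ⟨t, pairProducts_subset n ht⟩), ?_⟩
  refine eq_of_conj_eq (spinRep_spinPairHom _) hiso.2 fun E => ?_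
  obtain ⟨u, w, rfl⟩ := exists_genEmb (one_mul 1) E
  refine ⟨genEmb 1 (evenRep s u) + genEmb (-1) (evenRep t w), ?_, ?_⟩
  · rw [map_add, map_add, mul_add, add_mul, coe_spinPairUnits, spinPairHom_mul_fst,
      spinPairHom_mul_snd]
  · rw [map_add, map_add, mul_add, add_mul, ← hA', ← hB']

theorem exists_evenRep_leftInverse : ∃ R : Module.End ℝ Oct →ₗ[ℝ] CliffordAlgebra euclid7,
    ∀ s : Spin7, R (evenRep s) = s := by
  obtain ⟨R, hR⟩ := LinearMap.exists_leftInverse_of_injective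
    (evenRep ∘ₗ (CliffordAlgebra.even euclid7).toSubmodule.subtype) (LinearMap.ker_eq_bot.mpr
      fun x y h => Subtype.ext (evenRep_injective x.2 y.2 h))
  refine ⟨(CliffordAlgebra.even euclid7).toSubmodule.subtype ∘ₗ R, fun s => ?_⟩
  exact congrArg Subtype.val (LinearMap.congr_fun hR ⟨s, spinGroup.mem_even s.2⟩)

/-- The action of an element on `{u + ε ⟨u, ·⟩}` by conjugation depends continuously on it. -/
theorem exists_bilinear_conj (ε : ℝ) : ∃ T : Cl Oct →ₗ[ℝ] Cl Oct →ₗ[ℝ] Module.End ℝ Oct,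
    ∀ (g : (Cl Oct)ˣ) (A : Module.End ℝ Oct),
      (∀ u, (g : Cl Oct) * incl Oct (genEmb ε u) = incl Oct (genEmb ε (A u)) * g) →
      T g (↑g⁻¹ : Cl Oct) = A := by
  obtain ⟨J, hJ⟩ := LinearMap.exists_leftInverse_of_injective (incl Oct)
    (LinearMap.ker_eq_bot.mpr incl_injective)
  refine ⟨LinearMap.mk₂ ℝ
    (fun x y => LinearMap.snd ℝ _ _ ∘ₗ J ∘ₗ LinearMap.mulLeft ℝ x ∘ₗ LinearMap.mulRight ℝ y ∘ₗ
      incl Oct ∘ₗ genEmb ε)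
    (fun x x' y => by refine LinearMap.ext fun u => ?_; simp [add_mul])
    (fun c x y => by refine LinearMap.ext fun u => ?_; simp)
    (fun x y y' => by refine LinearMap.ext fun u => ?_; simp [mul_add])
    (fun c x y => by refine LinearMap.ext fun u => ?_; simp), fun g A h => ?_⟩
  refine LinearMap.ext fun u => ?_
  change (J ((g : Cl Oct) * (incl Oct (genEmb ε u) * (↑g⁻¹ : Cl Oct)))).2 = A u
  rw [← mul_assoc, h, Units.mul_inv_cancel_right]
  exact congrArg Prod.snd (LinearMap.congr_fun hJ _)

/-- The conjugation action is bilinear in (g, g⁻¹), and s is a linear function of its action on 𝕆;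
this yields continuity of the inverse isomorphism. -/
theorem exists_continuous_recover (ε : ℝ) : ∃ r : (Cl Oct)ˣ → CliffordAlgebra euclid7,
    Continuous r ∧ ∀ (g : (Cl Oct)ˣ) (s : Spin7),
      (∀ u, (g : Cl Oct) * incl Oct (genEmb ε u) = incl Oct (genEmb ε (evenRep s u)) * g) →
      r g = s := by
  obtain ⟨R, hR⟩ := exists_evenRep_leftInverse
  obtain ⟨T, hT⟩ := exists_bilinear_conj ε
  refine ⟨fun g => R (T g (↑g⁻¹ : Cl Oct)), ?_, fun g s h => ?_⟩
  · have h1 : Continuous fun p : Cl Oct × Cl Oct => T.compr₂ R p.1 p.2 :=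
      IsModuleTopology.continuous_bilinear_of_finite_left _
    exact h1.comp (Units.continuous_val.prodMk Units.continuous_coe_inv)
  · change R (T g (↑g⁻¹ : Cl Oct)) = s
    rw [hT g _ h, hR]

/-- `H₀` is isomorphic to `Spin(7) × Spin(7)`. -/
theorem nonempty_continuousMulEquiv : Nonempty (H₀ ≃ₜ* Spin7 × Spin7) := by
  let F : Spin7 × Spin7 →* H₀ := spinPairUnits.codRestrict H₀ spinPairUnits_mem_H₀
  have hFv : ∀ p, (F p : (Cl Oct)ˣ) = spinPairUnits p := fun p => rfl
  have hFc : Continuous F := continuous_spinPairUnits.subtype_mk _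
  clear_value F
  have hF : Function.Bijective F := by
    constructor
    · intro p q h
      exact spinPairUnits_injective (by rw [← hFv, h, hFv])
    · intro g
      obtain ⟨p, hp⟩ := exists_spinPair g.2
      exact ⟨p, Subtype.ext ((hFv p).trans hp)⟩
  let e : Spin7 × Spin7 ≃* H₀ := MulEquiv.ofBijective F hF
  obtain ⟨r, hr, hr'⟩ := exists_continuous_recover 1
  obtain ⟨t, ht, ht'⟩ := exists_continuous_recover (-1)
  have h1 : ∀ p, r (F p : (Cl Oct)ˣ) = p.1 := fun p => by
    rw [hFv]
    exact hr' _ _ (spinPairHom_mul_fst p)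
  have h2 : ∀ p, t (F p : (Cl Oct)ˣ) = p.2 := fun p => by
    rw [hFv]
    exact ht' _ _ (spinPairHom_mul_snd p)
  have hFe : ∀ g, F (e.symm g) = g := e.apply_symm_apply
  have hinv : Continuous e.symm := by
    refine Continuous.prodMk (f := fun g => (e.symm g).1) (g := fun g => (e.symm g).2)
      (continuous_induced_rng.mpr ((hr.comp continuous_subtype_val).congr fun g => ?_))
      (continuous_induced_rng.mpr ((ht.comp continuous_subtype_val).congr fun g => ?_))
    · rw [Function.comp_apply, Function.comp_apply, ← h1, hFe]
    · rw [Function.comp_apply, Function.comp_apply, ← h2, hFe]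
  exact ⟨(⟨e, hFc, hinv⟩ : Spin7 × Spin7 ≃ₜ* H₀).symm⟩

theorem Ad_comp_G₀_of_mem_H₀ (g : (Cl Oct)ˣ) (hg : g ∈ H₀) :
    Ad ⟨g, H₀_le_Cpin hg⟩ ∘ₗ G₀ = G₀ ∘ₗ Ad ⟨g, H₀_le_Cpin hg⟩ := by
  apply Ad_comp_G₀
  obtain ⟨g, -, rfl⟩ := hg
  exact g.2.2

end GenSpin

namespace GenSpin

/-! ### The invariant pairing of forms -/

theorem quad_reverse (ε : ℝ) {i j k l : Fin 8} (hij : i ≠ j) (hik : i ≠ k) (hil : i ≠ l)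
    (hjk : j ≠ k) (hjl : j ≠ l) (hkl : k ≠ l) :
    CliffordAlgebra.reverse (quad ε i j k l) = quad ε i j k l := by
  have h : ∀ {i j : Fin 8}, i ≠ j →
      CliffordAlgebra.ι (normForm ε) (basisVec j) * CliffordAlgebra.ι (normForm ε) (basisVec i) =
      -(CliffordAlgebra.ι (normForm ε) (basisVec i) * CliffordAlgebra.ι (normForm ε) (basisVec j)) := by
    intro i j hij
    apply eq_neg_of_add_eq_zero_left
    rw [CliffordAlgebra.ι_mul_ι_add_swap, normForm_polar]
    simp [basisVec, EuclideanSpace.inner_single_left, hij]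
  have h' : ∀ {i j : Fin 8}, i ≠ j → ∀ x,
      CliffordAlgebra.ι (normForm ε) (basisVec j) * (CliffordAlgebra.ι (normForm ε) (basisVec i) * x) =
      -(CliffordAlgebra.ι (normForm ε) (basisVec i) *
        (CliffordAlgebra.ι (normForm ε) (basisVec j) * x)) := by
    intro i j hij x
    rw [← mul_assoc, h hij, neg_mul, mul_assoc]
  simp only [quad, CliffordAlgebra.reverse.map_mul, CliffordAlgebra.reverse_ι, mul_assoc, h hil,
    h hjl, h hkl, h' hij, h' hik, h' hjk, mul_neg, neg_mul, neg_neg]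

/-- Reversing four orthogonal vectors takes six transpositions, so each product is fixed and only
the order of the four factors changes; their diagonal images commute. -/
theorem reverse_spinorProj {ε : ℝ} (hε : ε * ε = 1) :
    CliffordAlgebra.reverse (spinorProj ε) = spinorProj ε := by
  have e1 : CliffordAlgebra.reverse (quad ε 0 1 2 3) = quad ε 0 1 2 3 := by
    apply quad_reverse <;> decide
  have e2 : CliffordAlgebra.reverse (quad ε 0 1 4 5) = quad ε 0 1 4 5 := by
    apply quad_reverse <;> decide
  have e3 : CliffordAlgebra.reverse (quad ε 4 5 6 7) = quad ε 4 5 6 7 := by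
    apply quad_reverse <;> decide
  have e4 : CliffordAlgebra.reverse (quad ε 0 2 4 6) = quad ε 0 2 4 6 := by
    apply quad_reverse <;> decide
  apply octRep_injective hε
  refine LinearMap.ext fun ⟨x, y⟩ => ?_
  rw [octRep_spinorProj hε]
  simp only [spinorProj, CliffordAlgebra.reverse.map_mul, map_add, map_sub,
    CliffordAlgebra.reverse.map_one, e1, e2, e3, e4, map_mul, map_one, Module.End.mul_apply,
    LinearMap.add_apply, LinearMap.sub_apply, Module.End.one_apply, octRep_quad_0123 hε,
    octRep_quad_0145 hε, octRep_quad_4567 hε, octRep_quad_0246 hε, Prod.mk_add_mk, Prod.mk_sub_mk]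
  ext i <;> fin_cases i <;> (simp [basisVec_apply]; try ring)

theorem reverse_octMap (ε : ℝ) (x : CliffordAlgebra (normForm ε)) :
    CliffordAlgebra.reverse (octMap ε x) = octMap ε (CliffordAlgebra.reverse x) := by
  induction x using CliffordAlgebra.induction with
  | algebraMap r => simp
  | ι u => simp [octMap_ι]
  | mul x y hx hy => simp [hx, hy]
  | add x y hx hy => simp [hx, hy]

/-- The coefficient of the distinguished spinor in `y · (1, 0)`. -/
def spinorCoeff (ε : ℝ) (y : CliffordAlgebra (normForm ε)) : ℝ := (octRep ε y spinorOne).1 0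

theorem spinRep_spinorProj_mul {ε : ℝ} (hε : ε * ε = 1) (y : CliffordAlgebra (normForm ε)) :
    spinRep (octMap ε (spinorProj ε * y)) PhiSpin = (16 * spinorCoeff ε y) • PhiSpin := by
  rw [spinRep_octMap_congr hε (z := algebraMap ℝ _ (16 * spinorCoeff ε y))]
  · rw [AlgHom.commutes, AlgHom.commutes, Module.algebraMap_end_apply]
  · rw [map_mul, Module.End.mul_apply, octRep_spinorProj hε, AlgHom.commutes,
      Module.algebraMap_end_apply, Prod.smul_mk, smul_zero]
    rfl

theorem mem_span_octMap (x : Cl Oct) : x ∈ Submodule.span ℝ {x : Cl Oct |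
    ∃ (y : CliffordAlgebra (normForm 1)) (z : CliffordAlgebra (normForm (-1))),
      x = octMap 1 y * octMap (-1) z} := by
  induction x using CliffordAlgebra.left_induction with
  | algebraMap r => exact Submodule.subset_span ⟨algebraMap ℝ _ r, 1, by simp⟩
  | add x y hx hy => exact add_mem hx hy
  | ι_mul x E hx =>
    obtain ⟨u, w, rfl⟩ := exists_genEmb (one_mul 1) E
    refine Submodule.span_induction ?_ (by simp) (fun a b _ _ ha hb => ?_) (fun c a _ ha => ?_) hx
    · rintro _ ⟨y, z, rfl⟩
      rw [map_add, add_mul]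
      refine add_mem (Submodule.subset_span ⟨CliffordAlgebra.ι _ u * y, z, ?_⟩)
        (Submodule.subset_span ⟨CliffordAlgebra.involute y, CliffordAlgebra.ι _ w * z, ?_⟩)
      · rw [map_mul, octMap_ι, mul_assoc]
      · rw [map_mul, ← mul_assoc, ← mul_assoc, ← octMap_involute_anticomm, octMap_ι]
    · rw [mul_add]; exact add_mem ha hb
    · rw [mul_smul_comm]; exact Submodule.smul_mem _ c ha

theorem exists_spinRep_eq (φ : Forms Oct) : ∃ x : Cl Oct, spinRep x PhiSpin = φ := by
  obtain ⟨f, hf⟩ := Module.Projective.exists_dual_eq_one ℝ PhiSpin_ne_zero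
  obtain ⟨x, hx⟩ := spinRep_surjective (f.smulRight φ)
  exact ⟨x, by rw [hx, LinearMap.smulRight_apply, hf, one_smul]⟩

/-- The projection of forms onto `Φ_Spin` given by a self-reverse element of the Clifford algebra. -/
theorem exists_projection : ∃ (P : Cl Oct) (l : Forms Oct →ₗ[ℝ] ℝ),
    CliffordAlgebra.reverse P = P ∧ (∀ φ, spinRep P φ = l φ • PhiSpin) ∧
    ∀ y z, l (spinRep (octMap 1 y * octMap (-1) z) PhiSpin) =
      spinorCoeff 1 y * spinorCoeff (-1) z := by
  have h1 : (1 : ℝ) * 1 = 1 := one_mul 1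
  have h2 := neg_mul_self_eq_one h1
  obtain ⟨d, hd⟩ := Module.Projective.exists_dual_eq_one ℝ PhiSpin_ne_zero
  -- The product of the two spinor projections, with 256 = 16 · 16 as normalization.
  let P : Cl Oct := (256 : ℝ)⁻¹ • (octMap 1 (spinorProj 1) * octMap (-1) (spinorProj (-1)))
  have hP : ∀ y z, spinRep P (spinRep (octMap 1 y * octMap (-1) z) PhiSpin) =
      (spinorCoeff 1 y * spinorCoeff (-1) z) • PhiSpin := by
    intro y z
    have hc := commute_octMap (neg_neg (1 : ℝ)).symm (involute_spinorProj (-1)) y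
    have e : (octMap 1 (spinorProj 1) * octMap (-1) (spinorProj (-1))) *
        (octMap 1 y * octMap (-1) z) =
        octMap 1 (spinorProj 1 * y) * octMap (-1) (spinorProj (-1) * z) := by
      rw [map_mul, map_mul, mul_assoc, mul_assoc, ← mul_assoc _ (octMap 1 y), ← hc.eq, mul_assoc]
    rw [← Module.End.mul_apply, ← map_mul, smul_mul_assoc, e, map_smul, LinearMap.smul_apply,
      map_mul spinRep, Module.End.mul_apply, spinRep_spinorProj_mul h2, map_smul,
      spinRep_spinorProj_mul h1, smul_smul, smul_smul]
    congr 1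
    ring
  refine ⟨P, d ∘ₗ spinRep P, ?_, fun φ => ?_, fun y z => ?_⟩
  · have hc := octMap_comm_of_involute (involute_spinorProj 1) (spinorProj (-1))
    rw [map_smul, CliffordAlgebra.reverse.map_mul, reverse_octMap, reverse_octMap,
      reverse_spinorProj h1, reverse_spinorProj h2, hc.eq]
  · obtain ⟨x, rfl⟩ := exists_spinRep_eq φ
    refine Submodule.span_induction ?_ (by simp) (fun a b _ _ ha hb => ?_) (fun c a _ ha => ?_)
      (mem_span_octMap x)
    · rintro _ ⟨y, z, rfl⟩
      rw [LinearMap.comp_apply, hP, map_smul, hd, smul_eq_mul, mul_one]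
    · rw [map_add, LinearMap.add_apply, map_add, map_add, add_smul, ha, hb]
    · rw [map_smul spinRep c a, LinearMap.smul_apply, map_smul _ c, map_smul _ c, ha, smul_assoc]
  · rw [LinearMap.comp_apply, hP, map_smul, hd, smul_eq_mul, mul_one]

/-- The pairing is b(x Φ, ψ) = l(xʳ ψ), where P φ = l(φ) Φ, Φ = Φ_Spin and r is reversal. It is well
defined: z Φ = 0 gives z P = 0, and reversing gives P zʳ = 0 as P is self-reverse. Invariance under
reversal follows from P x P = l(x Φ) P in the same way. -/
theorem exists_pairing : ∃ b : Forms Oct →ₗ[ℝ] Forms Oct →ₗ[ℝ] ℝ,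
    (∀ x φ ψ, b φ (spinRep x ψ) = b (spinRep (CliffordAlgebra.reverse x) φ) ψ) ∧
    (∀ x, b PhiSpin (spinRep (CliffordAlgebra.reverse x) PhiSpin) =
      b PhiSpin (spinRep x PhiSpin)) ∧
    ∀ y z, b PhiSpin (spinRep (octMap 1 y * octMap (-1) z) PhiSpin) =
      spinorCoeff 1 y * spinorCoeff (-1) z := by
  obtain ⟨P, l, hrev, hP, hl⟩ := exists_projection
  let ev : Cl Oct →ₗ[ℝ] Forms Oct := LinearMap.applyₗ PhiSpin ∘ₗ (spinRep (V := Oct)).toLinearMap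
  obtain ⟨σ, hσ⟩ := LinearMap.exists_rightInverse_of_surjective ev
    (LinearMap.range_eq_top.mpr exists_spinRep_eq)
  have hσ' : ∀ φ, spinRep (σ φ) PhiSpin = φ := LinearMap.congr_fun hσ
  have hl0 : ∀ z : Cl Oct, spinRep z PhiSpin = 0 →
      ∀ ψ, l (spinRep (CliffordAlgebra.reverse z) ψ) = 0 := by
    intro z hz ψ
    have h1 : z * P = 0 := spinRep_injective (LinearMap.ext fun φ => by
      rw [map_mul, Module.End.mul_apply, hP, map_smul, hz, smul_zero, map_zero,
        LinearMap.zero_apply])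
    have h2 := congrArg (fun t => spinRep (CliffordAlgebra.reverse t) ψ) h1
    simp only [CliffordAlgebra.reverse.map_mul, hrev, map_mul, Module.End.mul_apply, hP, map_zero,
      LinearMap.zero_apply] at h2
    exact (smul_eq_zero.mp h2).resolve_right PhiSpin_ne_zero
  let b : Forms Oct →ₗ[ℝ] Forms Oct →ₗ[ℝ] ℝ :=
    ((spinRep (V := Oct)).toLinearMap ∘ₗ CliffordAlgebra.reverse ∘ₗ σ).compr₂ l
  have hb : ∀ φ ψ, b φ ψ = l (spinRep (CliffordAlgebra.reverse (σ φ)) ψ) := fun φ ψ => rfl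
  have hb' : ∀ x ψ, b (spinRep x PhiSpin) ψ = l (spinRep (CliffordAlgebra.reverse x) ψ) := by
    intro x ψ
    have := hl0 (σ (spinRep x PhiSpin) - x) (by rw [map_sub, LinearMap.sub_apply, hσ', sub_self]) ψ
    rw [map_sub, map_sub, LinearMap.sub_apply, map_sub, sub_eq_zero] at this
    rw [hb, this]
  have hb1 : ∀ ψ, b PhiSpin ψ = l ψ := by
    intro ψ
    have := hb' 1 ψ
    rwa [map_one, Module.End.one_apply, CliffordAlgebra.reverse.map_one, map_one,
      Module.End.one_apply] at this
  refine ⟨b, fun x φ ψ => ?_, fun x => ?_, fun y z => by rw [hb1, hl]⟩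
  · obtain ⟨t, rfl⟩ := exists_spinRep_eq φ
    rw [hb', ← Module.End.mul_apply, ← map_mul, ← Module.End.mul_apply, ← map_mul, hb',
      CliffordAlgebra.reverse.map_mul, CliffordAlgebra.reverse_reverse]
  · rw [hb1, hb1]
    have h1 : P * x * P = l (spinRep x PhiSpin) • P := spinRep_injective (LinearMap.ext fun φ => by
      rw [map_mul, map_mul, map_smul, Module.End.mul_apply, Module.End.mul_apply, hP φ, map_smul,
        map_smul, hP, LinearMap.smul_apply, hP, smul_comm])
    have h2 : P * x * P = l (spinRep (CliffordAlgebra.reverse x) PhiSpin) • P := by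
      have h3 : P * CliffordAlgebra.reverse x * P =
          l (spinRep (CliffordAlgebra.reverse x) PhiSpin) • P :=
        spinRep_injective (LinearMap.ext fun φ => by
          rw [map_mul, map_mul, map_smul, Module.End.mul_apply, Module.End.mul_apply, hP φ,
            map_smul, map_smul, hP, LinearMap.smul_apply, hP, smul_comm])
      have h4 := congrArg CliffordAlgebra.reverse h3
      simpa [hrev, mul_assoc] using h4
    obtain ⟨t, ht⟩ := exists_spinRep_eq PhiSpin
    have h5 := congrArg (fun z => spinRep z PhiSpin) (h1.symm.trans h2)
    have h6 : l PhiSpin = 1 := by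
      have := hl 1 1
      simpa [spinorCoeff, basisVec_apply] using this
    simp only [map_smul, LinearMap.smul_apply, hP, h6, one_smul] at h5
    exact (smul_left_injective ℝ PhiSpin_ne_zero h5).symm

end GenSpin

namespace GenSpin

/-! ### Equivariance of the pairing under the conformal pin group -/

theorem scalar_of_commute {n : Cl Oct} (h : ∀ x, Commute n x) : ∃ c : ℝ, n = algebraMap ℝ _ c := by
  obtain ⟨f, hf⟩ := Module.Projective.exists_dual_eq_one ℝ PhiSpin_ne_zero
  refine ⟨f (spinRep n PhiSpin), spinRep_injective (LinearMap.ext fun φ => ?_)⟩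
  obtain ⟨x, hx⟩ := spinRep_surjective (f.smulRight φ)
  have h1 := LinearMap.congr_fun (congrArg spinRep (h x).eq) PhiSpin
  simp only [map_mul, Module.End.mul_apply, hx, LinearMap.smulRight_apply, hf, one_smul] at h1
  rw [h1, AlgHom.commutes, Module.algebraMap_end_apply]

/-- Two twists cancel, so n commutes with even elements. The parity operator is represented by an
even element, and conjugation by it is the grading involution; hence n is even. Now n commutes with
vectors and is central, so it is a scalar. -/
theorem scalar_of_twisted_commute {n : Cl Oct}
    (h : ∀ E, n * incl Oct E = incl Oct E * CliffordAlgebra.involute n) :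
    ∃ c : ℝ, n = algebraMap ℝ _ c := by
  have h' : ∀ E, CliffordAlgebra.involute n * incl Oct E = incl Oct E * n := by
    intro E
    have := congrArg CliffordAlgebra.involute (h E)
    simpa using this
  have heven : ∀ x ∈ CliffordAlgebra.even (QuadraticForm.dualProd ℝ Oct), Commute n x := by
    intro x hx
    have hx' : x ∈ CliffordAlgebra.evenOdd (QuadraticForm.dualProd ℝ Oct) 0 := hx
    clear hx
    induction x, hx' using CliffordAlgebra.even_induction with
    | algebraMap r => exact Algebra.commute_algebraMap_right r _
    | add x y _ _ hx hy => exact hx.add_right hy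
    | ι_mul_ι_mul E F x _ hx =>
      refine Commute.mul_right ?_ hx
      rw [commute_iff_eq, ← mul_assoc, h, mul_assoc, h', mul_assoc]
  obtain ⟨w, hw⟩ := spinRep_surjective (parity Oct).toLinearMap
  have hpp : (parity Oct).toLinearMap * (parity Oct).toLinearMap = (1 : Module.End ℝ (Forms Oct)) :=
    LinearMap.ext fun φ => parity_parity φ
  have hw2 : CliffordAlgebra.involute w = w := spinRep_injective (by
    rw [spinRep_involute, hw, hpp, one_mul])
  have hn : CliffordAlgebra.involute n = n := spinRep_injective (by
    rw [spinRep_involute, ← hw, ← map_mul, ← map_mul, ← (heven w (mem_even_of_involute hw2)).eq,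
      mul_assoc, map_mul, map_mul, hw, hpp, mul_one])
  apply scalar_of_commute
  intro x
  induction x using CliffordAlgebra.induction with
  | algebraMap r => exact Algebra.commute_algebraMap_right r _
  | ι E => have := h E; rwa [hn] at this
  | mul x y hx hy => exact hx.mul_right hy
  | add x y hx hy => exact hx.add_right hy

/-- Elements of the conformal pin group are even or odd. -/
theorem Cpin.exists_involute_eq (g : Cpin Oct) : ∃ c : ℝ, c * c = 1 ∧
    CliffordAlgebra.involute (g.1 : Cl Oct) = c • (g.1 : Cl Oct) := by
  obtain ⟨c, hc⟩ := scalar_of_twisted_commute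
    (n := CliffordAlgebra.involute (g.1 : Cl Oct) * (↑g.1⁻¹ : Cl Oct)) (fun E => by
      have h := (incl_Ad' g E).symm.trans (incl_Ad g E)
      have h2 := congrArg (fun t => CliffordAlgebra.involute (g.1 : Cl Oct) *
        (t * CliffordAlgebra.involute (↑g.1⁻¹ : Cl Oct))) h
      simp only [mul_assoc, involute_mul_involute_inv, mul_one] at h2
      rw [← mul_assoc _ (CliffordAlgebra.involute (↑g.1⁻¹ : Cl Oct)), involute_mul_involute_inv,
        one_mul] at h2
      rw [map_mul, CliffordAlgebra.involute_involute, mul_assoc, h2])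
  have h1 : CliffordAlgebra.involute (g.1 : Cl Oct) = c • (g.1 : Cl Oct) := by
    have := congrArg (· * (g.1 : Cl Oct)) hc
    simpa [mul_assoc, Algebra.smul_def] using this
  refine ⟨c, ?_, h1⟩
  have h2 := congrArg CliffordAlgebra.involute h1
  rw [CliffordAlgebra.involute_involute, map_smul, h1, smul_smul] at h2
  have h3 : (1 : ℝ) • (g.1 : Cl Oct) = (c * c) • (g.1 : Cl Oct) := by rw [one_smul]; exact h2
  exact (smul_left_injective ℝ g.1.ne_zero h3).symm

theorem Cpin.incl_mul (g : Cpin Oct) {c : ℝ}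
    (hc : CliffordAlgebra.involute (g.1 : Cl Oct) = c • (g.1 : Cl Oct)) (E : Gen Oct) :
    incl Oct E * (g.1 : Cl Oct) = c • ((g.1 : Cl Oct) * incl Oct (Ad g E)) := by
  rw [← smul_mul_assoc, ← hc, incl_Ad, ← mul_assoc, involute_mul_involute_inv, one_mul]

theorem Ad_surjective (g : Cpin Oct) : Function.Surjective (Ad g) := fun E =>
  ⟨Ad g⁻¹ E, by rw [← Ad_mul, inv_mul_cancel, Ad_one]⟩

/-- The spinor norm: g is even or odd by `Cpin.exists_involute_eq`, and the signs from moving a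
vector past g and past its reverse combine to the twisted commutation of
`scalar_of_twisted_commute`. -/
theorem Cpin.exists_reverse_mul (g : Cpin Oct) : ∃ c : ℝ, c ≠ 0 ∧
    CliffordAlgebra.reverse (g.1 : Cl Oct) * (g.1 : Cl Oct) = algebraMap ℝ _ c := by
  obtain ⟨s, hs, hg⟩ := Cpin.exists_involute_eq g
  obtain ⟨c, hc⟩ := scalar_of_twisted_commute
    (n := CliffordAlgebra.reverse (g.1 : Cl Oct) * (g.1 : Cl Oct)) (fun E => by
      obtain ⟨E, rfl⟩ := Ad_surjective g E
      have h1 := Cpin.incl_mul g hg E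
      have h2 := congrArg CliffordAlgebra.reverse h1
      rw [CliffordAlgebra.reverse.map_mul, CliffordAlgebra.reverse_ι, map_smul,
        CliffordAlgebra.reverse.map_mul, CliffordAlgebra.reverse_ι] at h2
      have h3 : CliffordAlgebra.involute (CliffordAlgebra.reverse (g.1 : Cl Oct)) =
          s • CliffordAlgebra.reverse (g.1 : Cl Oct) := by
        rw [← CliffordAlgebra.reverse_involute, hg, map_smul]
      rw [map_mul, h3, hg, smul_mul_smul_comm, hs, one_smul, ← mul_assoc,
        ← one_smul ℝ (incl Oct (Ad g E) * _), ← hs, mul_smul, ← h2, smul_mul_assoc, mul_assoc, mul_assoc]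
      rw [show CliffordAlgebra.ι _ E * (g.1 : Cl Oct) = _ from h1, mul_smul_comm, smul_smul, hs,
        one_smul])
  refine ⟨c, ?_, hc⟩
  rintro rfl
  rw [map_zero] at hc
  have h4 : CliffordAlgebra.reverse (g.1 : Cl Oct) = 0 := (Units.mul_left_eq_zero g.1).mp hc
  have h5 := CliffordAlgebra.reverse_reverse (g.1 : Cl Oct)
  rw [h4, map_zero] at h5
  exact g.1.ne_zero h5.symm

/-- The invariant pairing of forms. -/
def pairing : Forms Oct →ₗ[ℝ] Forms Oct →ₗ[ℝ] ℝ := exists_pairing.choose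

theorem pairing_spinRep (x : Cl Oct) (φ ψ : Forms Oct) :
    pairing φ (spinRep x ψ) = pairing (spinRep (CliffordAlgebra.reverse x) φ) ψ :=
  exists_pairing.choose_spec.1 x φ ψ

theorem pairing_reverse (x : Cl Oct) :
    pairing PhiSpin (spinRep (CliffordAlgebra.reverse x) PhiSpin) =
      pairing PhiSpin (spinRep x PhiSpin) := exists_pairing.choose_spec.2.1 x

theorem pairing_octMap (y : CliffordAlgebra (normForm 1)) (z : CliffordAlgebra (normForm (-1))) :
    pairing PhiSpin (spinRep (octMap 1 y * octMap (-1) z) PhiSpin) =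
      spinorCoeff 1 y * spinorCoeff (-1) z := exists_pairing.choose_spec.2.2 y z

theorem pairing_Cpin (g : Cpin Oct) : ∃ c : ℝ, c ≠ 0 ∧ ∀ φ ψ,
    pairing (spinRep (g.1 : Cl Oct) φ) (spinRep (g.1 : Cl Oct) ψ) = c * pairing φ ψ := by
  obtain ⟨c, hc, h⟩ := Cpin.exists_reverse_mul g
  refine ⟨c, hc, fun φ ψ => ?_⟩
  rw [pairing_spinRep, ← Module.End.mul_apply, ← map_mul, h, AlgHom.commutes,
    Module.algebraMap_end_apply, map_smul, LinearMap.smul_apply, smul_eq_mul]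

/-! ### A tensor determining the generalized metric -/

/-- The totally antisymmetric part of `E F G H`, up to terms of degree two. -/
def quartic (E F G H : Gen Oct) : Cl Oct :=
  incl Oct E * incl Oct F * incl Oct G * incl Oct H -
    -- `LinearMap.dualProd` is twice ⟨·,·⟩, whence the factor 4⁻¹ in the scalar part of a product of
    -- four vectors.
    algebraMap ℝ _ (4⁻¹ * (LinearMap.dualProd ℝ Oct E F * LinearMap.dualProd ℝ Oct G H -
      LinearMap.dualProd ℝ Oct E G * LinearMap.dualProd ℝ Oct F H +
      LinearMap.dualProd ℝ Oct E H * LinearMap.dualProd ℝ Oct F G))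

/-- The 4-form on `𝕆 ⊕ 𝕆*` determined by a form. -/
def rho (α : Forms Oct) (E F G H : Gen Oct) : ℝ := pairing α (spinRep (quartic E F G H) α)

theorem dualProd_apply (E F : Gen Oct) : LinearMap.dualProd ℝ Oct E F = E.1 F.2 + F.1 E.2 := by
  simp [LinearMap.dualProd]; ring

theorem incl_mul_add_swap (E F : Gen Oct) : incl Oct E * incl Oct F + incl Oct F * incl Oct E =
    algebraMap ℝ _ (LinearMap.dualProd ℝ Oct E F) := by
  rw [CliffordAlgebra.ι_mul_ι_add_swap, dualProd_polar, dualProd_apply]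

theorem dualProd_Ad_Ad (g : Cpin Oct) (E F : Gen Oct) :
    LinearMap.dualProd ℝ Oct (Ad g E) (Ad g F) = LinearMap.dualProd ℝ Oct E F := by
  rw [dualProd_apply, dualProd_apply, ← dualProd_polar, ← dualProd_polar]
  simp only [QuadraticMap.polar, ← map_add, dualProd_Ad]

/-- Moving g past one vector costs a sign s with s² = 1; four vectors cost s⁴ = 1. -/
theorem quartic_mul (g : Cpin Oct) (E F G H : Gen Oct) : quartic E F G H * (g.1 : Cl Oct) =
    (g.1 : Cl Oct) * quartic (Ad g E) (Ad g F) (Ad g G) (Ad g H) := by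
  obtain ⟨s, hs, hg⟩ := Cpin.exists_involute_eq g
  have h := Cpin.incl_mul g hg
  have h' : ∀ E x, incl Oct E * ((g.1 : Cl Oct) * x) =
      s • ((g.1 : Cl Oct) * (incl Oct (Ad g E) * x)) := by
    intro E x
    rw [← mul_assoc, h, smul_mul_assoc, mul_assoc]
  simp only [quartic, dualProd_Ad_Ad, sub_mul, mul_sub]
  congr 1
  · simp only [mul_assoc, h, h', mul_smul_comm, smul_smul, hs, one_smul]
  · exact (Algebra.commutes _ _)

theorem rho_Cpin (g : Cpin Oct) : ∃ c : ℝ, c ≠ 0 ∧ ∀ α E F G H,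
    rho (spinRep (g.1 : Cl Oct) α) E F G H = c * rho α (Ad g E) (Ad g F) (Ad g G) (Ad g H) := by
  obtain ⟨c, hc, h⟩ := pairing_Cpin g
  refine ⟨c, hc, fun α E F G H => ?_⟩
  rw [rho, ← Module.End.mul_apply, ← map_mul, quartic_mul, map_mul, Module.End.mul_apply, h, rho]

end GenSpin

/-! ### The Cayley form and the 4-form of Φ_Spin -/

namespace GenSpin

/-- The Cayley form, as a multilinear function. -/
def cayley (a b c d : Oct) : ℝ :=
  inner ℝ (Oct.mul (Oct.mul d (Oct.conj c)) b) a -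
    (inner ℝ a b * inner ℝ c d - inner ℝ a c * inner ℝ b d + inner ℝ a d * inner ℝ b c)

theorem exists_orthogonal (a b : Oct) : ∃ d : Oct, d ≠ 0 ∧ inner ℝ a d = (0 : ℝ) ∧
    inner ℝ b d = (0 : ℝ) := by
  have h := LinearMap.ker_ne_bot_of_finrank_lt (f := (innerₗ Oct a).prod (innerₗ Oct b)) (by simp)
  obtain ⟨d, hd, h0⟩ := Submodule.exists_mem_ne_zero_of_ne_bot h
  rw [LinearMap.mem_ker] at hd
  exact ⟨d, h0, congrArg Prod.fst hd, congrArg Prod.snd hd⟩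

/-- With a, b, c mutually orthogonal and d = (a b̄) c, the Cayley form takes the value ‖a‖²‖b‖²‖c‖².
-/
theorem eq_zero_of_cayley {a : Oct} (h : ∀ b c d, cayley a b c d = 0) : a = 0 := by
  obtain ⟨b, hb, hab, -⟩ := exists_orthogonal a a
  obtain ⟨c, hc, hac, hbc⟩ := exists_orthogonal a b
  have h1 := h b c (Oct.mul (Oct.mul a (Oct.conj b)) c)
  rw [cayley, Oct.mul_mul_conj, Oct.smul_mul, Oct.mul_conj_mul, hab, hac, hbc] at h1
  simp only [real_inner_smul_left, zero_mul, mul_zero, sub_zero, add_zero] at h1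
  rcases mul_eq_zero.mp h1 with h1 | h1
  · exact absurd (inner_self_eq_zero.mp h1) hc
  rcases mul_eq_zero.mp h1 with h1 | h1
  · exact absurd (inner_self_eq_zero.mp h1) hb
  · exact inner_self_eq_zero.mp h1

/-- Every vector is an eigenvector. If b is the part of A c orthogonal to c, the symmetry moves A
off the second slot, where a repeated c gives zero; so the Cayley form of (x, b, c, d) vanishes for
all x and d. Taking d orthogonal to b and c, and x = (d c̄) b, forces b = 0. -/
theorem scalar_of_cayley {A : Module.End ℝ Oct}
    (h : ∀ a b c d, cayley (A a) b c d = cayley a (A b) c d) :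
    ∃ t : ℝ, ∀ u, A u = t • u := by
  have key : ∀ c, c ≠ 0 → ∃ t : ℝ, A c = t • c := by
    intro c hc
    have hcc : inner ℝ c c ≠ (0 : ℝ) := inner_self_ne_zero.mpr hc
    obtain ⟨t, ht⟩ : ∃ t, t = (inner ℝ c (A c) / inner ℝ c c : ℝ) := ⟨_, rfl⟩
    obtain ⟨b, hb⟩ : ∃ b, b = A c - t • c := ⟨_, rfl⟩
    have hcb : inner ℝ c b = (0 : ℝ) := by
      rw [hb, inner_sub_right, real_inner_smul_right, ht, div_mul_cancel₀ _ hcc, sub_self]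
    have hAc : A c = b + t • c := by rw [hb, sub_add_cancel]
    have h0 : ∀ x d, cayley x c c d = 0 := by
      intro x d
      rw [cayley, Oct.mul_conj_mul, real_inner_smul_left, real_inner_comm x d]
      ring
    have h1 : ∀ x d, cayley x b c d = 0 := by
      intro x d
      have h2 : cayley x (A c) c d = cayley x b c d + t * cayley x c c d := by
        rw [hAc]
        simp only [cayley, Oct.mul_add, Oct.mul_smul, inner_add_left, inner_add_right,
          real_inner_smul_left, real_inner_smul_right]
        ring
      rw [← h, h0, h0] at h2
      linarith
    obtain ⟨d, hd, hbd, hcd⟩ := exists_orthogonal b c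
    have h3 := h1 (Oct.mul (Oct.mul d (Oct.conj c)) b) d
    rw [cayley, hcd, hbd, real_inner_comm c b, hcb, Oct.inner_mul_mul_right,
      Oct.inner_mul_mul_right, Oct.inner_conj] at h3
    rw [mul_zero, mul_zero, mul_zero, sub_zero, add_zero, sub_zero] at h3
    have hb0 : b = 0 := inner_self_eq_zero.mp ((mul_eq_zero.mp h3).resolve_right fun h4 => by
      rcases mul_eq_zero.mp h4 with h4 | h4
      · exact hcc h4
      · exact hd (inner_self_eq_zero.mp h4))
    exact ⟨t, by rw [hAc, hb0, zero_add]⟩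
  obtain ⟨t, ht⟩ := A.exists_eq_smul_id_of_forall_notLinearIndependent fun c hli => by
    obtain ⟨t, ht⟩ := key c (hli.ne_zero 0)
    rw [ht, LinearIndependent.pair_iff] at hli
    have := hli t (-1) (by simp)
    norm_num at this
  exact ⟨t, fun u => by rw [ht]; simp⟩

theorem dualProd_genEmb_genEmb (ε δ : ℝ) (u w : Oct) :
    LinearMap.dualProd ℝ Oct (genEmb ε u) (genEmb δ w) = (ε + δ) * inner ℝ u w := by
  rw [dualProd_apply, ← dualProd_polar, dualProd_polar_genEmb]

theorem spinorCoeff_one (ε : ℝ) : spinorCoeff ε 1 = 1 := by simp [spinorCoeff, basisVec_apply]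

theorem pairing_PhiSpin : pairing PhiSpin PhiSpin = 1 := by
  simpa [spinorCoeff_one] using pairing_octMap 1 1

theorem spinorCoeff_ι_mul_ι {ε : ℝ} (u w : Oct) :
    spinorCoeff ε (CliffordAlgebra.ι _ u * CliffordAlgebra.ι _ w) = ε * inner ℝ u w := by
  rw [spinorCoeff, map_mul, Module.End.mul_apply, octRep_ι, octRep_ι]
  simp [Oct.one_mul, Oct.mul_conj_zero, real_inner_comm]

theorem spinorCoeff_ι (ε : ℝ) (u : Oct) : spinorCoeff ε (CliffordAlgebra.ι _ u) = 0 := by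
  rw [spinorCoeff, octRep_ι]
  simp [Oct.zero_mul]

theorem spinorCoeff_quadruple {ε : ℝ} (hε : ε * ε = 1) (a b c d : Oct) :
    spinorCoeff ε (CliffordAlgebra.ι _ a * CliffordAlgebra.ι _ b * CliffordAlgebra.ι _ c *
      CliffordAlgebra.ι _ d) = inner ℝ (Oct.mul (Oct.mul d (Oct.conj c)) b) a := by
  simp only [spinorCoeff, map_mul, Module.End.mul_apply, octRep_ι]
  simp only [Oct.smul_mul, Oct.one_mul, smul_smul, hε, one_smul, Oct.mul_conj_zero]

theorem rho_PhiSpin (E F G H : Gen Oct) : rho PhiSpin E F G H =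
    pairing PhiSpin (spinRep (incl Oct E * incl Oct F * incl Oct G * incl Oct H) PhiSpin) -
    4⁻¹ * (LinearMap.dualProd ℝ Oct E F * LinearMap.dualProd ℝ Oct G H -
      LinearMap.dualProd ℝ Oct E G * LinearMap.dualProd ℝ Oct F H +
      LinearMap.dualProd ℝ Oct E H * LinearMap.dualProd ℝ Oct F G) := by
  rw [rho, quartic, map_sub, LinearMap.sub_apply, AlgHom.commutes, Module.algebraMap_end_apply,
    map_sub, map_smul, pairing_PhiSpin, smul_eq_mul, mul_one]

theorem rho_genEmb {ε : ℝ} (hε : ε = 1 ∨ ε = -1) (a b c d : Oct) :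
    rho PhiSpin (genEmb ε a) (genEmb ε b) (genEmb ε c) (genEmb ε d) = cayley a b c d := by
  have hε2 : ε * ε = 1 := by rcases hε with rfl | rfl <;> norm_num
  have h : ∀ x, pairing PhiSpin (spinRep (octMap ε x) PhiSpin) = spinorCoeff ε x := by
    rcases hε with rfl | rfl
    · intro x
      simpa [spinorCoeff_one] using pairing_octMap x 1
    · intro x
      simpa [spinorCoeff_one] using pairing_octMap 1 x
  rw [rho_PhiSpin, ← octMap_ι, ← octMap_ι, ← octMap_ι, ← octMap_ι, ← map_mul, ← map_mul, ← map_mul,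
    h, spinorCoeff_quadruple hε2, cayley]
  simp only [dualProd_genEmb_genEmb]
  congr 1
  linear_combination (inner ℝ a b * inner ℝ c d - inner ℝ a c * inner ℝ b d +
    inner ℝ a d * inner ℝ b c) * hε2

/-- Invariance under reversal removes the antisymmetric part of E F. Degree two terms are thus
invisible to `rho PhiSpin`, which makes it antisymmetric. -/
theorem pairing_incl_mul_incl (E F : Gen Oct) :
    pairing PhiSpin (spinRep (incl Oct E * incl Oct F) PhiSpin) =
      2⁻¹ * LinearMap.dualProd ℝ Oct E F := by
  have h1 := pairing_reverse (incl Oct E * incl Oct F)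
  have h2 := congrArg (fun x => pairing PhiSpin (spinRep x PhiSpin)) (incl_mul_add_swap E F)
  simp only [CliffordAlgebra.reverse.map_mul, CliffordAlgebra.reverse_ι] at h1
  simp only [map_add, LinearMap.add_apply, AlgHom.commutes, Module.algebraMap_end_apply, map_smul,
    pairing_PhiSpin, smul_eq_mul, mul_one, h1] at h2
  linarith

theorem dualProd_comm (E F : Gen Oct) :
    LinearMap.dualProd ℝ Oct E F = LinearMap.dualProd ℝ Oct F E := by
  rw [dualProd_apply, dualProd_apply, add_comm]

theorem rho_swap₁₂ (E F G H : Gen Oct) : rho PhiSpin F E G H = -rho PhiSpin E F G H := by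
  have h1 : incl Oct F * incl Oct E * incl Oct G * incl Oct H =
      LinearMap.dualProd ℝ Oct E F • (incl Oct G * incl Oct H) -
        incl Oct E * incl Oct F * incl Oct G * incl Oct H := by
    rw [eq_sub_of_add_eq' (incl_mul_add_swap E F), sub_mul, sub_mul, Algebra.smul_def, mul_assoc]
  rw [rho_PhiSpin, rho_PhiSpin, h1, map_sub, map_smul, LinearMap.sub_apply, LinearMap.smul_apply,
    map_sub, map_smul, pairing_incl_mul_incl, dualProd_comm F E, smul_eq_mul]
  ring

theorem rho_swap₂₃ (E F G H : Gen Oct) : rho PhiSpin E G F H = -rho PhiSpin E F G H := by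
  have h1 : incl Oct E * incl Oct G * incl Oct F * incl Oct H =
      LinearMap.dualProd ℝ Oct F G • (incl Oct E * incl Oct H) -
        incl Oct E * incl Oct F * incl Oct G * incl Oct H := by
    rw [mul_assoc (incl Oct E), eq_sub_of_add_eq' (incl_mul_add_swap F G), mul_sub, sub_mul,
      ← Algebra.commutes, ← mul_assoc, mul_assoc (algebraMap ℝ _ _), Algebra.smul_def]
  rw [rho_PhiSpin, rho_PhiSpin, h1, map_sub, map_smul, LinearMap.sub_apply, LinearMap.smul_apply,
    map_sub, map_smul, pairing_incl_mul_incl, dualProd_comm G F, smul_eq_mul]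
  ring

end GenSpin

/-! ### The linear condition singling out G₀ -/

namespace GenSpin

theorem rho_add₃ (E F G G' H : Gen Oct) :
    rho PhiSpin E F (G + G') H = rho PhiSpin E F G H + rho PhiSpin E F G' H := by
  simp only [rho_PhiSpin, map_add, mul_add, add_mul, LinearMap.add_apply]
  ring

theorem rho_add₄ (E F G H H' : Gen Oct) :
    rho PhiSpin E F G (H + H') = rho PhiSpin E F G H + rho PhiSpin E F G H' := by
  simp only [rho_PhiSpin, map_add, mul_add, add_mul, LinearMap.add_apply]
  ring

/-- The pairing factors over C₊ and C₋. An odd number of vectors in either one has no (1, 0)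
coefficient; with two in each, the product of the two metrics is cancelled by the scalar correction
in `quartic`. -/
theorem rho_mixed_pos (u w : Oct) (G H : Gen Oct) :
    rho PhiSpin (genEmb 1 u) (genEmb (-1) w) G H = 0 := by
  have e : ∀ x y, incl Oct (genEmb (-1) x) * incl Oct (genEmb 1 y) =
      -(incl Oct (genEmb 1 y) * incl Oct (genEmb (-1) x)) := by
    intro x y
    rw [← octMap_ι, ← octMap_ι, octMap_anticomm]
  have e' : ∀ x y z, incl Oct (genEmb (-1) x) * (incl Oct (genEmb 1 y) * z) =
      -(incl Oct (genEmb 1 y) * (incl Oct (genEmb (-1) x) * z)) := by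
    intro x y z
    rw [← mul_assoc, e, neg_mul, mul_assoc]
  obtain ⟨a, b, rfl⟩ := exists_genEmb (one_mul 1) G
  obtain ⟨c, d, rfl⟩ := exists_genEmb (one_mul 1) H
  have h1 : rho PhiSpin (genEmb 1 u) (genEmb (-1) w) (genEmb 1 a) (genEmb 1 c) = 0 := by
    have h2 := pairing_octMap (CliffordAlgebra.ι _ u * (CliffordAlgebra.ι _ a * CliffordAlgebra.ι _ c))
      (CliffordAlgebra.ι _ w)
    rw [spinorCoeff_ι, mul_zero] at h2
    simp only [map_mul (octMap 1), map_mul (octMap (-1)), octMap_ι] at h2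
    rw [rho_PhiSpin]
    simp only [mul_assoc, e, e', mul_neg, neg_mul, neg_neg, dualProd_genEmb_genEmb] at h2 ⊢
    rw [h2]
    norm_num
  have h2 : rho PhiSpin (genEmb 1 u) (genEmb (-1) w) (genEmb 1 a) (genEmb (-1) d) = 0 := by
    have h2 := pairing_octMap (CliffordAlgebra.ι _ u * CliffordAlgebra.ι _ a)
      (CliffordAlgebra.ι _ w * CliffordAlgebra.ι _ d)
    rw [spinorCoeff_ι_mul_ι, spinorCoeff_ι_mul_ι] at h2
    simp only [map_mul (octMap 1), map_mul (octMap (-1)), octMap_ι] at h2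
    rw [rho_PhiSpin]
    simp only [mul_assoc, e, e', mul_neg, neg_mul, neg_neg, map_neg, LinearMap.neg_apply,
      dualProd_genEmb_genEmb] at h2 ⊢
    rw [h2]
    ring
  have h3 : rho PhiSpin (genEmb 1 u) (genEmb (-1) w) (genEmb (-1) b) (genEmb 1 c) = 0 := by
    have h2 := pairing_octMap (CliffordAlgebra.ι _ u * CliffordAlgebra.ι _ c)
      (CliffordAlgebra.ι _ w * CliffordAlgebra.ι _ b)
    rw [spinorCoeff_ι_mul_ι, spinorCoeff_ι_mul_ι] at h2
    simp only [map_mul (octMap 1), map_mul (octMap (-1)), octMap_ι] at h2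
    rw [rho_PhiSpin]
    simp only [mul_assoc, e, e', mul_neg, neg_mul, neg_neg, dualProd_genEmb_genEmb] at h2 ⊢
    rw [h2]
    ring
  have h4 : rho PhiSpin (genEmb 1 u) (genEmb (-1) w) (genEmb (-1) b) (genEmb (-1) d) = 0 := by
    have h2 := pairing_octMap (CliffordAlgebra.ι _ u)
      (CliffordAlgebra.ι _ w * (CliffordAlgebra.ι _ b * CliffordAlgebra.ι _ d))
    rw [spinorCoeff_ι, zero_mul] at h2
    simp only [map_mul (octMap 1), map_mul (octMap (-1)), octMap_ι] at h2
    rw [rho_PhiSpin]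
    simp only [mul_assoc, dualProd_genEmb_genEmb] at h2 ⊢
    rw [h2]
    norm_num
  rw [rho_add₃, rho_add₄, rho_add₄, h1, h2, h3, h4]
  norm_num

theorem rho_mixed {ε : ℝ} (hε : ε = 1 ∨ ε = -1) (u w : Oct) (G H : Gen Oct) :
    rho PhiSpin (genEmb ε u) (genEmb (-ε) w) G H = 0 := by
  rcases hε with rfl | rfl
  · exact rho_mixed_pos u w G H
  · rw [rho_swap₁₂, neg_neg, rho_mixed_pos, neg_zero]

/-- The linear condition satisfied by the generalized metric determined by `α`. -/
def RhoSymm (α : Forms Oct) (A : Module.End ℝ (Gen Oct)) : Prop :=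
  ∀ E F G H, rho α (A E) F G H = rho α E (A F) G H

theorem rho_add₁ (α : Forms Oct) (E E' F G H : Gen Oct) :
    rho α (E + E') F G H = rho α E F G H + rho α E' F G H := by
  have : quartic (E + E') F G H = quartic E F G H + quartic E' F G H := by
    simp only [quartic, map_add, add_mul, mul_add, LinearMap.add_apply, mul_sub, map_sub]
    abel
  rw [rho, this, map_add, LinearMap.add_apply, map_add, rho, rho]

theorem rho_add₂ (α : Forms Oct) (E F F' G H : Gen Oct) :
    rho α E (F + F') G H = rho α E F G H + rho α E F' G H := by
  have : quartic E (F + F') G H = quartic E F G H + quartic E F' G H := by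
    simp only [quartic, map_add, add_mul, mul_add, LinearMap.add_apply, mul_sub, map_sub]
    abel
  rw [rho, this, map_add, LinearMap.add_apply, map_add, rho, rho]

theorem rho_smul₁ (α : Forms Oct) (c : ℝ) (E F G H : Gen Oct) :
    rho α (c • E) F G H = c * rho α E F G H := by
  have : quartic (c • E) F G H = c • quartic E F G H := by
    simp only [quartic, map_smul, LinearMap.smul_apply, smul_mul_assoc, smul_sub, smul_eq_mul,
      Algebra.algebraMap_eq_smul_one, smul_smul]
    congr 2
    ring
  rw [rho, this, map_smul, LinearMap.smul_apply, map_smul, rho, smul_eq_mul]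

theorem rho_smul₂ (α : Forms Oct) (c : ℝ) (E F G H : Gen Oct) :
    rho α E (c • F) G H = c * rho α E F G H := by
  have : quartic E (c • F) G H = c • quartic E F G H := by
    simp only [quartic, map_smul, LinearMap.smul_apply, smul_mul_assoc, mul_smul_comm, smul_sub,
      smul_eq_mul, Algebra.algebraMap_eq_smul_one, smul_smul]
    congr 2
    ring
  rw [rho, this, map_smul, LinearMap.smul_apply, map_smul, rho, smul_eq_mul]

theorem rhoSymm_G₀ : RhoSymm PhiSpin G₀ := by
  intro E F G H
  have h1 : (1 : ℝ) * 1 = 1 := one_mul 1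
  obtain ⟨a, b, rfl⟩ := exists_genEmb h1 E
  obtain ⟨c, d, rfl⟩ := exists_genEmb h1 F
  have h2 := rho_mixed_pos a d G H
  have h3 : rho PhiSpin (genEmb (-1) b) (genEmb 1 c) G H = 0 := by
    rw [rho_swap₁₂, rho_mixed_pos, neg_zero]
  rw [map_add, map_add, G₀_genEmb h1, G₀_genEmb (neg_mul_self_eq_one h1), G₀_genEmb h1,
    G₀_genEmb (neg_mul_self_eq_one h1)]
  simp only [rho_add₁, rho_add₂, rho_smul₁, rho_smul₂, h2, h3]
  ring

/-- Away from multiples of the identity, the linear condition characterizes `G₀`. -/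
theorem RhoSymm.exists_eq {A : Module.End ℝ (Gen Oct)} (hA : RhoSymm PhiSpin A) :
    ∃ s t : ℝ, A = s • 1 + t • G₀ := by
  have key : ∀ {ε : ℝ}, (ε = 1 ∨ ε = -1) → ∃ t : ℝ, ∀ u, A (genEmb ε u) = t • genEmb ε u := by
    intro ε hε
    have hε2 : ε * ε = 1 := by rcases hε with rfl | rfl <;> norm_num
    have hε' : -ε = 1 ∨ -ε = -1 := by rcases hε with rfl | rfl <;> norm_num
    have h1 : ∀ u, A (genEmb ε u) = genEmb ε (A (genEmb ε u)).2 := by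
      intro u
      obtain ⟨a, b, hab⟩ := exists_genEmb hε2 (A (genEmb ε u))
      -- Testing with three vectors of the opposite eigenspace: the right-hand side is mixed in
      -- every case and vanishes, while the left-hand side is the Cayley form of b.
      have hb : b = 0 := by
        apply eq_zero_of_cayley
        intro v w z
        have h2 := hA (genEmb ε u) (genEmb (-ε) v) (genEmb (-ε) w) (genEmb (-ε) z)
        obtain ⟨c, d, hcd⟩ := exists_genEmb hε2 (A (genEmb (-ε) v))
        have h3 : rho PhiSpin (genEmb ε u) (genEmb ε c) (genEmb (-ε) w) (genEmb (-ε) z) = 0 := by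
          rw [← neg_eq_zero, ← rho_swap₂₃, rho_mixed hε]
        rwa [hab, hcd, rho_add₁, rho_add₂, rho_mixed hε, rho_mixed hε, h3, rho_genEmb hε',
          zero_add, zero_add] at h2
      rw [hab, hb, map_zero, add_zero]
      rfl
    let B : Module.End ℝ Oct := LinearMap.snd ℝ _ _ ∘ₗ A ∘ₗ genEmb ε
    obtain ⟨t, ht⟩ := scalar_of_cayley (A := B) (fun a b c d => by
      rw [← rho_genEmb hε, ← rho_genEmb hε]
      have h2 := hA (genEmb ε a) (genEmb ε b) (genEmb ε c) (genEmb ε d)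
      rwa [h1 a, h1 b] at h2)
    refine ⟨t, fun u => ?_⟩
    rw [h1, ← map_smul, ← ht]
    rfl
  obtain ⟨p, hp⟩ := key (Or.inl rfl)
  obtain ⟨q, hq⟩ := key (Or.inr rfl)
  refine ⟨(p + q) / 2, (p - q) / 2, LinearMap.ext fun E => ?_⟩
  have h1 : (1 : ℝ) * 1 = 1 := one_mul 1
  obtain ⟨a, b, rfl⟩ := exists_genEmb h1 E
  rw [map_add, hp, hq, LinearMap.add_apply, LinearMap.smul_apply, LinearMap.smul_apply, map_add G₀,
    G₀_genEmb h1, G₀_genEmb (neg_mul_self_eq_one h1), Module.End.one_apply]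
  module

theorem rhoSymm_Cpin (g : Cpin Oct) (α : Forms Oct) (A B : Module.End ℝ (Gen Oct))
    (h : ∀ E, Ad g (A E) = B (Ad g E)) :
    RhoSymm (spinRep (g.1 : Cl Oct) α) A ↔ RhoSymm α B := by
  obtain ⟨c, hc, hr⟩ := rho_Cpin g
  constructor
  · intro hA E F G H
    obtain ⟨E, rfl⟩ := Ad_surjective g E
    obtain ⟨F, rfl⟩ := Ad_surjective g F
    obtain ⟨G, rfl⟩ := Ad_surjective g G
    obtain ⟨H, rfl⟩ := Ad_surjective g H
    have h1 := hA E F G H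
    rw [hr, hr, h, h] at h1
    exact mul_left_cancel₀ hc h1
  · intro hB E F G H
    rw [hr, hr, h, h, hB]

end GenSpin

namespace GenSpin

/-! ### Solutions of linear systems depending smoothly on parameters -/

section LinearSystem

variable {Y : Type*} [NormedAddCommGroup Y] [NormedSpace ℝ Y]

theorem contDiffWithinAt_det {n : ℕ} {M : Y → Matrix (Fin n) (Fin n) ℝ} {U : Set Y} {y₀ : Y}
    (h : ∀ i j, ContDiffWithinAt ℝ ∞ (fun y => M y i j) U y₀) :
    ContDiffWithinAt ℝ ∞ (fun y => (M y).det) U y₀ := by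
  simp only [Matrix.det_apply]
  refine ContDiffWithinAt.sum fun σ _ => ?_
  exact (contDiffWithinAt_prod fun i _ => h _ _).const_smul _

/-- Although the system may be overdetermined, uniqueness at y₀ lets finitely many of its
functionals form a basis of the dual. Their determinant stays nonzero near y₀, and Cramer's rule
gives the solution there. -/
theorem contDiffWithinAt_of_linear_system {V K : Type*} [AddCommGroup V] [Module ℝ V]
    [FiniteDimensional ℝ V] (m : K → Y → V →ₗ[ℝ] ℝ) (b : K → ℝ) (v : Y → V) {U : Set Y} {y₀ : Y}
    (hy₀ : y₀ ∈ U) (hm : ∀ k x, ContDiffWithinAt ℝ ∞ (fun y => m k y x) U y₀)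
    (hv : ∀ y ∈ U, ∀ k, m k y (v y) = b k) (hinj : ∀ x, (∀ k, m k y₀ x = 0) → x = 0)
    (c : Module.Dual ℝ V) : ContDiffWithinAt ℝ ∞ (fun y => c (v y)) U y₀ := by
  have hspan : ⊤ ≤ Submodule.span ℝ (Set.range fun k => m k y₀) := by
    rw [← Subspace.dualCoannihilator_dualAnnihilator_eq
      (W := Submodule.span ℝ (Set.range fun k => m k y₀)), show (Submodule.span ℝ
      (Set.range fun k => m k y₀)).dualCoannihilator = ⊥ from ?_, Submodule.dualAnnihilator_bot]
    rw [eq_bot_iff]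
    intro x hx
    rw [Submodule.mem_dualCoannihilator] at hx
    exact hinj x fun k => hx _ (Submodule.subset_span ⟨k, rfl⟩)
  let e := Module.finBasis ℝ V
  obtain ⟨β, hβ⟩ : ∃ β : Module.Basis (Fin (Module.finrank ℝ V)) ℝ (Module.Dual ℝ V),
      ∀ i, ∃ k, m k y₀ = β i := by
    let β₀ := Module.Basis.ofSpan hspan
    have : Fintype _ := FiniteDimensional.fintypeBasisIndex β₀
    refine ⟨β₀.reindex (Fintype.equivOfCardEq ?_), fun i => ?_⟩
    · rw [← Module.finrank_eq_card_basis β₀, Subspace.dual_finrank_eq, Fintype.card_fin]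
    · rw [Module.Basis.reindex_apply]
      exact Module.Basis.ofSpan_subset hspan ⟨_, rfl⟩
  choose k hk using hβ
  let M : Y → Matrix (Fin (Module.finrank ℝ V)) (Fin (Module.finrank ℝ V)) ℝ :=
    fun y => Matrix.of fun i j => m (k i) y (e j)
  have hM : ∀ y x, (M y).mulVec (e.repr x) = fun i => m (k i) y x := by
    intro y x
    ext i
    conv_rhs => rw [← e.sum_repr x, map_sum]
    simp [M, Matrix.mulVec, dotProduct, mul_comm]
  have hdet : (M y₀).det ≠ 0 := by
    intro h0
    obtain ⟨x, hx0, hx⟩ := Matrix.exists_mulVec_eq_zero_iff.mpr h0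
    apply hx0
    have h1 : (M y₀).mulVec (e.repr (e.equivFun.symm x)) = 0 := by
      rw [← e.equivFun_apply, LinearEquiv.apply_symm_apply]
      exact hx
    rw [hM] at h1
    have h2 : Module.Dual.eval ℝ V (e.equivFun.symm x) = 0 := β.ext fun i => by
      rw [← hk]
      exact congrFun h1 i
    have h3 := hinj (e.equivFun.symm x) fun k => LinearMap.congr_fun h2 (m k y₀)
    exact e.equivFun.symm.map_eq_zero_iff.mp h3
  have hMc : ∀ i j, ContDiffWithinAt ℝ ∞ (fun y => M y i j) U y₀ := fun i j => hm _ _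
  have hdc := contDiffWithinAt_det hMc
  have hcr : ∀ j, ContDiffWithinAt ℝ ∞ (fun y => (M y).cramer (fun i => b (k i)) j) U y₀ := by
    intro j
    simp only [Matrix.cramer_apply]
    refine contDiffWithinAt_det fun i j' => ?_
    by_cases h : j' = j
    · simp only [Matrix.updateCol_apply, h, if_true]
      exact contDiffWithinAt_const
    · simp only [Matrix.updateCol_apply, h, if_false]
      exact hMc _ _
  have hsol : ∀ y ∈ U, (M y).det ≠ 0 →
      c (v y) = ∑ j, ((M y).det)⁻¹ * (M y).cramer (fun i => b (k i)) j * c (e j) := by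
    intro y hy hd
    have h1 : (fun i => b (k i)) = (M y).mulVec (e.repr (v y)) := by
      rw [hM]
      ext i
      exact (hv y hy _).symm
    conv_lhs => rw [← e.sum_repr (v y), map_sum]
    refine Finset.sum_congr rfl fun j _ => ?_
    rw [h1, Matrix.cramer_eq_adjugate_mulVec, Matrix.mulVec_mulVec, Matrix.adjugate_mul,
      Matrix.smul_mulVec, Matrix.one_mulVec, map_smul, Pi.smul_apply, smul_eq_mul, smul_eq_mul,
      inv_mul_cancel_left₀ hd]
  refine ContDiffWithinAt.congr_of_eventuallyEq
    (f := fun y => ∑ j, ((M y).det)⁻¹ * (M y).cramer (fun i => b (k i)) j * c (e j)) ?_ ?_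
    (hsol y₀ hy₀ hdet)
  · exact ContDiffWithinAt.sum fun j _ => ((hdc.inv hdet).mul (hcr j)).mul contDiffWithinAt_const
  · filter_upwards [hdc.continuousWithinAt.eventually_ne hdet, self_mem_nhdsWithin] with y h1 h2
    exact hsol y h2 h1

theorem contDiffWithinAt_bilinear {W : Type*} [AddCommGroup W] [Module ℝ W] [FiniteDimensional ℝ W]
    (β : W →ₗ[ℝ] W →ₗ[ℝ] ℝ) {f : Y → W} {U : Set Y} {y₀ : Y}
    (hf : ∀ c : Module.Dual ℝ W, ContDiffWithinAt ℝ ∞ (fun y => c (f y)) U y₀) :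
    ContDiffWithinAt ℝ ∞ (fun y => β (f y) (f y)) U y₀ := by
  let e := Module.finBasis ℝ W
  have h : ∀ y, β (f y) (f y) = ∑ i, e.coord i (f y) * β (e i) (f y) := by
    intro y
    calc β (f y) (f y) = β (∑ i, e.repr (f y) i • e i) (f y) := by rw [e.sum_repr]
      _ = _ := by
        rw [map_sum, LinearMap.sum_apply]
        simp
  simp only [h]
  exact ContDiffWithinAt.sum fun i _ => (hf _).mul (hf _)

end LinearSystem

end GenSpin

namespace GenSpin

/-! ### The generalized metric induced by an element of the orbit of `Φ_Spin` -/

/-- The splitting `𝕆 ⊕ 𝕆 ≃ C₊ ⊕ C₋ = 𝕆 ⊕ 𝕆*`. -/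
def genEquiv : (Oct × Oct) ≃ₗ[ℝ] Gen Oct :=
  LinearEquiv.ofBijective ((genEmb 1).coprod (genEmb (-1))) <| by
    have hs : Function.Surjective ((genEmb 1).coprod (genEmb (-1))) := fun E => by
      obtain ⟨u, w, rfl⟩ := exists_genEmb (one_mul 1) E
      exact ⟨(u, w), by simp⟩
    refine ⟨(LinearMap.injective_iff_surjective_of_finrank_eq_finrank ?_).mpr hs, hs⟩
    rw [Module.finrank_prod, Module.finrank_prod, Subspace.dual_finrank_eq]

theorem genEquiv_apply (u w : Oct) : genEquiv (u, w) = genEmb 1 u + genEmb (-1) w :=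
  LinearMap.coprod_apply _ _ _

theorem G₀_genEquiv (u w : Oct) : G₀ (genEquiv (u, w)) = genEquiv (u, -w) := by
  have h1 : (1 : ℝ) * 1 = 1 := one_mul 1
  rw [genEquiv_apply, genEquiv_apply, map_add, G₀_genEmb h1, G₀_genEmb (neg_mul_self_eq_one h1),
    map_neg]
  module

theorem G₀_eq : G₀ = genEquiv.toLinearMap ∘ₗ
    (LinearMap.prodMap LinearMap.id (-LinearMap.id)) ∘ₗ genEquiv.symm.toLinearMap := by
  refine LinearMap.ext fun E => ?_
  obtain ⟨⟨u, w⟩, rfl⟩ := genEquiv.surjective E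
  simp [G₀_genEquiv]

theorem det_G₀ : LinearMap.det G₀ = 1 := by
  rw [G₀_eq, LinearMap.det_conj, LinearMap.det_prodMap, LinearMap.det_id, one_mul,
    ← neg_one_smul ℝ LinearMap.id, LinearMap.det_smul, LinearMap.det_id, finrank_euclideanSpace_fin]
  norm_num

theorem trace_G₀ : LinearMap.trace ℝ _ G₀ = 0 := by
  have h := LinearMap.trace_conj' (LinearMap.prodMap LinearMap.id (-LinearMap.id)) genEquiv
  rw [LinearEquiv.conj_apply, LinearMap.comp_assoc, ← G₀_eq, LinearMap.trace_prodMap'] at h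
  rw [h, map_neg, add_neg_cancel]

theorem isGeneralizedMetric_G₀ : IsGeneralizedMetric G₀ where
  isometry := by
    rintro ⟨η, v⟩
    obtain ⟨a, rfl⟩ := flatMap.surjective η
    change inner ℝ v (flatMap.symm (flatMap a)) = inner ℝ a v
    rw [LinearEquiv.symm_apply_apply, real_inner_comm]
  det_eq_one := det_G₀
  sq_eq_one E := by
    obtain ⟨⟨u, w⟩, rfl⟩ := genEquiv.surjective E
    rw [G₀_genEquiv, G₀_genEquiv, neg_neg]
  pos E hE := by
    obtain ⟨⟨u, w⟩, rfl⟩ := genEquiv.surjective E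
    have h : LinearMap.dualProd ℝ Oct (G₀ (genEquiv (u, w))) (genEquiv (u, w)) =
        2 * ‖u‖ ^ 2 + 2 * ‖w‖ ^ 2 := by
      rw [G₀_genEquiv, genEquiv_apply, genEquiv_apply]
      simp only [map_add, LinearMap.add_apply, dualProd_genEmb_genEmb, inner_neg_left,
        real_inner_self_eq_norm_sq]
      ring
    rw [h]
    have h2 : ¬(u = 0 ∧ w = 0) := by
      rintro ⟨rfl, rfl⟩
      exact hE (map_zero genEquiv)
    by_cases hu : u = 0
    · have := norm_pos_iff.mpr fun hw => h2 ⟨hu, hw⟩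
      positivity
    · have := norm_pos_iff.mpr hu
      positivity

/-- The automorphism `Ad_g` of `V ⊕ V*`. -/
def adEquiv (g : Cpin Oct) : Gen Oct ≃ₗ[ℝ] Gen Oct :=
  LinearEquiv.ofLinearMap (Ad g) (Ad g⁻¹)
    (LinearMap.ext fun E => by
      rw [LinearMap.comp_apply, ← Ad_mul, inv_mul_cancel, Ad_one, LinearMap.id_apply])
    (LinearMap.ext fun E => by
      rw [LinearMap.comp_apply, ← Ad_mul, mul_inv_cancel, Ad_one, LinearMap.id_apply])

/-- The generalized metric `Ad_g ∘ G₀ ∘ Ad_g⁻¹`. -/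
def inducedMetric (g : Cpin Oct) : Module.End ℝ (Gen Oct) := (adEquiv g).conj G₀

theorem inducedMetric_Ad (g : Cpin Oct) (E : Gen Oct) :
    inducedMetric g (Ad g E) = Ad g (G₀ E) := by
  change adEquiv g (G₀ ((adEquiv g).symm (adEquiv g E))) = adEquiv g (G₀ E)
  rw [LinearEquiv.symm_apply_apply]

theorem eq_inducedMetric {g : Cpin Oct} {A : Module.End ℝ (Gen Oct)}
    (h : ∀ E, A (Ad g E) = Ad g (G₀ E)) : A = inducedMetric g := by
  refine LinearMap.ext fun E => ?_
  obtain ⟨E, rfl⟩ := Ad_surjective g E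
  rw [h, inducedMetric_Ad]

/-- The two choices differ by h g⁻¹, which fixes Φ_Spin and so commutes with G₀. -/
theorem inducedMetric_eq {g h : Cpin Oct} {α : Forms Oct}
    (hg : spinRep (g.1 : Cl Oct) α = PhiSpin) (hh : spinRep (h.1 : Cl Oct) α = PhiSpin) :
    inducedMetric g = inducedMetric h := by
  refine eq_inducedMetric fun E => ?_
  have hα : α = spinRep (g⁻¹.1 : Cl Oct) PhiSpin := by
    rw [← hg, ← Module.End.mul_apply, ← map_mul]
    simp
  have hk := Ad_comp_G₀ (h * g⁻¹) (by
    rw [Subgroup.coe_mul, Units.val_mul, map_mul, Module.End.mul_apply, ← hα, hh])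
  have h1 : Ad h E = Ad g (Ad (h * g⁻¹) E) := by rw [← Ad_mul, inv_mul_cancel_right]
  have h2 := LinearMap.congr_fun hk E
  rw [LinearMap.comp_apply, LinearMap.comp_apply] at h2
  rw [h1, inducedMetric_Ad, ← h2, ← Ad_mul, inv_mul_cancel_right]

theorem isGeneralizedMetric_inducedMetric (g : Cpin Oct) :
    IsGeneralizedMetric (inducedMetric g) where
  isometry E := by
    obtain ⟨E, rfl⟩ := Ad_surjective g E
    rw [inducedMetric_Ad, dualProd_Ad, dualProd_Ad, isGeneralizedMetric_G₀.isometry]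
  det_eq_one := (LinearMap.det_conj G₀ (adEquiv g)).trans det_G₀
  sq_eq_one E := by
    obtain ⟨E, rfl⟩ := Ad_surjective g E
    rw [inducedMetric_Ad, inducedMetric_Ad, isGeneralizedMetric_G₀.sq_eq_one]
  pos E hE := by
    obtain ⟨E, rfl⟩ := Ad_surjective g E
    rw [inducedMetric_Ad, dualProd_Ad_Ad]
    exact isGeneralizedMetric_G₀.pos E fun h => hE (by rw [h, map_zero])

theorem trace_inducedMetric (g : Cpin Oct) : LinearMap.trace ℝ _ (inducedMetric g) = 0 :=
  (LinearMap.trace_conj' G₀ (adEquiv g)).trans trace_G₀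

theorem rhoSymm_inducedMetric {g : Cpin Oct} {α : Forms Oct}
    (hg : spinRep (g.1 : Cl Oct) α = PhiSpin) : RhoSymm α (inducedMetric g) :=
  (rhoSymm_Cpin g α G₀ _ fun E => (inducedMetric_Ad g E).symm).mp (hg ▸ rhoSymm_G₀)

theorem RhoSymm.exists_eq_inducedMetric {g : Cpin Oct} {α : Forms Oct}
    (hg : spinRep (g.1 : Cl Oct) α = PhiSpin) {A : Module.End ℝ (Gen Oct)} (hA : RhoSymm α A) :
    ∃ s t : ℝ, A = s • 1 + t • inducedMetric g := by
  have h1 : ∀ E, Ad g ((adEquiv g).symm.conj A E) = A (Ad g E) := fun E =>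
    (adEquiv g).apply_symm_apply (A (adEquiv g E))
  obtain ⟨s, t, h⟩ := (show RhoSymm PhiSpin _ from
    hg ▸ (rhoSymm_Cpin g α _ A h1).mpr hA).exists_eq
  refine ⟨s, t, LinearMap.ext fun E => ?_⟩
  obtain ⟨E, rfl⟩ := Ad_surjective g E
  rw [← h1, h]
  simp [inducedMetric_Ad]

/-- The linear equations `ρ(A E, F, G, H) = ρ(E, A F, G, H)`, as functionals of `A`. -/
def rhoDefect (α : Forms Oct) (E F G H : Gen Oct) : Module.End ℝ (Gen Oct) →ₗ[ℝ] ℝ where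
  toFun A := rho α (A E) F G H - rho α E (A F) G H
  map_add' A B := by
    simp only [LinearMap.add_apply, rho_add₁, rho_add₂]
    ring
  map_smul' c A := by
    simp only [LinearMap.smul_apply, rho_smul₁, rho_smul₂, RingHom.id_apply, smul_eq_mul]
    ring

theorem rhoDefect_apply (α : Forms Oct) (E F G H : Gen Oct) (A : Module.End ℝ (Gen Oct)) :
    rhoDefect α E F G H A = rho α (A E) F G H - rho α E (A F) G H := rfl

theorem contDiffOn_inducedMetric {Y : Type*} [NormedAddCommGroup Y] [NormedSpace ℝ Y] {U : Set Y}
    {α : Y → Forms Oct} {G : Y → Module.End ℝ (Gen Oct)}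
    (hα : ∀ c : Module.Dual ℝ (Forms Oct), ContDiffOn ℝ ∞ (fun y => c (α y)) U)
    (hG : ∀ y ∈ U, ∃ g : Cpin Oct, spinRep (g.1 : Cl Oct) (α y) = PhiSpin ∧ G y = inducedMetric g)
    (c : Module.Dual ℝ (Module.End ℝ (Gen Oct))) : ContDiffOn ℝ ∞ (fun y => c (G y)) U := by
  intro y₀ hy₀
  let E₀ : Gen Oct := (0, basisVec 0)
  have hE₀ : E₀ ≠ 0 := fun h => by
    have h2 := congrArg (fun E : Gen Oct => E.2 0) h
    simp [E₀, basisVec] at h2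
  let ℓ : Module.Dual ℝ (Gen Oct) :=
    (EuclideanSpace.proj 0 : Oct →L[ℝ] ℝ).toLinearMap ∘ₗ LinearMap.snd ℝ _ _
  have hℓ : ℓ E₀ = 1 := by simp [ℓ, E₀, basisVec]
  -- A normalization by a positive number: G / s solves an inhomogeneous system whose right-hand
  -- side is constant, although s is not yet known to be smooth.
  let s : Y → ℝ := fun y => LinearMap.dualProd ℝ Oct (G y E₀) E₀
  have hs : ∀ y ∈ U, 0 < s y := fun y hy => by
    obtain ⟨g, -, hg⟩ := hG y hy
    have h := (isGeneralizedMetric_inducedMetric g).pos E₀ hE₀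
    rwa [← hg] at h
  let v : Y → Module.End ℝ (Gen Oct) := fun y => (s y)⁻¹ • G y
  have hrho : ∀ E F G H, ContDiffWithinAt ℝ ∞ (fun y => rho (α y) E F G H) U y₀ := fun E F G H =>
    contDiffWithinAt_bilinear (f := α) (pairing.compl₂ (spinRep (quartic E F G H)))
      fun c => hα c y₀ hy₀
  -- The equations are symmetry with respect to ρ, vanishing trace, and ⟨A E₀, E₀⟩ fixed. The first
  -- leaves p + qG, the trace gives p = 0, and positivity of G makes the last determine q.
  let m : ((Gen Oct × Gen Oct × Gen Oct × Gen Oct) ⊕ Bool) → Y → Module.End ℝ (Gen Oct) →ₗ[ℝ] ℝ :=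
    fun k y => k.elim (fun p => rhoDefect (α y) p.1 p.2.1 p.2.2.1 p.2.2.2) fun b =>
      if b then LinearMap.trace ℝ _
      else (LinearMap.dualProd ℝ Oct).flip E₀ ∘ₗ LinearMap.applyₗ E₀
  let b : ((Gen Oct × Gen Oct × Gen Oct × Gen Oct) ⊕ Bool) → ℝ := fun k =>
    k.elim (fun _ => 0) fun b => if b then 0 else 1
  have hv : ∀ c : Module.Dual ℝ (Module.End ℝ (Gen Oct)),
      ContDiffWithinAt ℝ ∞ (fun y => c (v y)) U y₀ := by
    refine contDiffWithinAt_of_linear_system m b v hy₀ ?_ ?_ ?_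
    · rintro (⟨E, F, G, H⟩ | _ | _) A
      · exact (hrho (A E) F G H).sub (hrho E (A F) G H)
      · exact contDiffWithinAt_const (c := LinearMap.dualProd ℝ Oct (A E₀) E₀)
      · exact contDiffWithinAt_const (c := LinearMap.trace ℝ _ A)
    · intro y hy k
      obtain ⟨g, hg, hGg⟩ := hG y hy
      rcases k with ⟨E, F, G, H⟩ | _ | _
      · change rhoDefect _ _ _ _ _ (v y) = 0
        rw [map_smul, hGg, rhoDefect_apply, rhoSymm_inducedMetric hg, sub_self, smul_zero]
      · change LinearMap.dualProd ℝ Oct ((s y)⁻¹ • G y E₀) E₀ = 1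
        rw [map_smul, LinearMap.smul_apply]
        exact inv_mul_cancel₀ (hs y hy).ne'
      · change LinearMap.trace ℝ _ (v y) = 0
        rw [map_smul, hGg, trace_inducedMetric, smul_zero]
    · intro A hA
      obtain ⟨g, hg, hGg⟩ := hG y₀ hy₀
      obtain ⟨p, q, rfl⟩ := RhoSymm.exists_eq_inducedMetric hg (A := A) fun E F G H =>
        sub_eq_zero.mp (hA (Sum.inl (E, F, G, H)))
      have h1 : LinearMap.trace ℝ _ (p • 1 + q • inducedMetric g) = 0 := hA (Sum.inr true)
      have hp : p = 0 := by
        rw [map_add, map_smul, map_smul, trace_inducedMetric, LinearMap.trace_one, smul_zero,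
          add_zero, smul_eq_mul, mul_eq_zero] at h1
        refine h1.resolve_right ?_
        rw [Module.finrank_prod, Subspace.dual_finrank_eq, finrank_euclideanSpace_fin]
        norm_num
      have h2 : LinearMap.dualProd ℝ Oct ((p • 1 + q • inducedMetric g) E₀) E₀ = 0 :=
        hA (Sum.inr false)
      rw [hp, zero_smul, zero_add, LinearMap.smul_apply, map_smul, LinearMap.smul_apply,
        smul_eq_mul, mul_eq_zero] at h2
      rw [hp, h2.resolve_right ((isGeneralizedMetric_inducedMetric g).pos E₀ hE₀).ne', zero_smul,
        zero_smul, add_zero]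
  have hr : ContDiffWithinAt ℝ ∞ (fun y => ℓ (v y (v y E₀))) U y₀ :=
    contDiffWithinAt_bilinear (LinearMap.mk₂ ℝ (fun A B : Module.End ℝ (Gen Oct) => ℓ (A (B E₀)))
      (fun _ _ _ => by simp) (fun _ _ _ => by simp) (fun _ _ _ => by simp) (fun _ _ _ => by simp)) hv
  have hrs : ∀ y ∈ U, ℓ (v y (v y E₀)) = ((s y)⁻¹) ^ 2 := fun y hy => by
    obtain ⟨g, -, hg⟩ := hG y hy
    change ℓ ((s y)⁻¹ • G y ((s y)⁻¹ • G y E₀)) = _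
    rw [map_smul (G y), hg, (isGeneralizedMetric_inducedMetric g).sq_eq_one, map_smul, map_smul, hℓ]
    simp [pow_two]
  -- Because G² = 1, the solution v = G / s satisfies v² = s⁻², so its scale is a square root of a
  -- smooth positive function.
  have hcG : ∀ y ∈ U, c (G y) = (√(ℓ (v y (v y E₀))))⁻¹ * c (v y) := fun y hy => by
    have h1 := hs y hy
    rw [hrs y hy, Real.sqrt_sq (inv_nonneg.mpr h1.le), inv_inv, map_smul, smul_eq_mul,
      mul_inv_cancel_left₀ h1.ne']
  have h0 := inv_pos.mpr (hs y₀ hy₀)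
  have hr0 : ℓ (v y₀ (v y₀ E₀)) ≠ 0 := by
    rw [hrs y₀ hy₀]
    positivity
  refine ((((hr.sqrt hr0).inv ?_).mul (hv c)).congr hcG (hcG y₀ hy₀))
  rw [hrs y₀ hy₀, Real.sqrt_sq h0.le]
  exact h0.ne'

end GenSpin

namespace GenSpin

/-! ### The generalized metric of a generalized `Spin(7)` structure -/

section Transport

variable {V : Type*} [AddCommGroup V] [Module ℝ V]

/-- The identification `𝕆* ⊕ 𝕆 ≃ V* ⊕ V` induced by `h : 𝕆 ≃ V`. -/
def genMapEquiv (h : Oct ≃ₗ[ℝ] V) : Gen Oct ≃ₗ[ℝ] Gen V :=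
  LinearEquiv.ofLinearMap (genMap h.toLinearMap h.symm.toLinearMap)
    (genMap h.symm.toLinearMap h.toLinearMap)
    (LinearMap.ext fun E => Prod.ext
      (LinearMap.ext fun v => congrArg E.1 (h.apply_symm_apply v)) (h.apply_symm_apply E.2))
    (LinearMap.ext fun E => Prod.ext
      (LinearMap.ext fun v => congrArg E.1 (h.symm_apply_apply v)) (h.symm_apply_apply E.2))

/-- One good frame makes every frame good, since a change of frame acts through Cpin. In particular
chart differentials may serve as frames. -/
theorem exists_spinRep_pullback_eq {φ : Forms V} {h₀ : Oct ≃ₗ[ℝ] V}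
    (hφ : pullback h₀.toLinearMap φ ∈ orbitSpin) (h : Oct ≃ₗ[ℝ] V) :
    ∃ g : Cpin Oct, spinRep (g.1 : Cl Oct) (pullback h.toLinearMap φ) = PhiSpin := by
  obtain ⟨k, hk, hφ⟩ := hφ
  obtain ⟨a, ha, -⟩ := exists_cpin_pullback (h.trans h₀.symm)
  refine ⟨(a * ⟨k, hk⟩)⁻¹, ?_⟩
  have h1 : pullback h.toLinearMap φ = spinRep ((a * ⟨k, hk⟩ : Cpin Oct).1 : Cl Oct) PhiSpin := by
    rw [Subgroup.coe_mul, Units.val_mul, map_mul spinRep, Module.End.mul_apply, ← hφ, ha,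
      pullback_pullback]
    congr 2
    exact LinearMap.ext fun v => (h₀.apply_symm_apply (h v)).symm
  rw [h1, ← Module.End.mul_apply, ← map_mul, Subgroup.coe_inv, Units.inv_mul, map_one,
    Module.End.one_apply]

/-- The change of frame is absorbed into the group element, which reduces independence of (h, g) to
`inducedMetric_eq` in a single frame. -/
theorem genMapEquiv_conj_inducedMetric {φ : Forms V} {h₀ h : Oct ≃ₗ[ℝ] V} {g₀ g : Cpin Oct}
    (hg₀ : spinRep (g₀.1 : Cl Oct) (pullback h₀.toLinearMap φ) = PhiSpin)
    (hg : spinRep (g.1 : Cl Oct) (pullback h.toLinearMap φ) = PhiSpin) (E : Gen Oct) :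
    (genMapEquiv h₀).conj (inducedMetric g₀) (genMapEquiv h (Ad g E)) =
      genMapEquiv h (Ad g (G₀ E)) := by
  obtain ⟨a, ha, haA⟩ := exists_cpin_pullback (h.trans h₀.symm)
  have h1 : ∀ E, genMapEquiv h E = genMapEquiv h₀ (Ad a E) := fun E => by
    rw [haA]
    exact Prod.ext (LinearMap.ext fun v => congrArg (fun w => E.1 (h.symm w))
      (h₀.apply_symm_apply v).symm) (h₀.apply_symm_apply (h E.2)).symm
  have h2 : spinRep ((g * a).1 : Cl Oct) (pullback h₀.toLinearMap φ) = PhiSpin := by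
    rw [Subgroup.coe_mul, Units.val_mul, map_mul, Module.End.mul_apply, ha, pullback_pullback,
      ← hg]
    congr 3
    exact LinearMap.ext fun v => h₀.apply_symm_apply (h v)
  rw [h1, h1, ← Ad_mul, ← Ad_mul, ← inducedMetric_Ad, inducedMetric_eq h2 hg₀]
  exact congrArg (fun F => genMapEquiv h₀ (inducedMetric g₀ F))
    ((genMapEquiv h₀).symm_apply_apply _)

theorem isGeneralizedMetric_conj (h : Oct ≃ₗ[ℝ] V) {A : Module.End ℝ (Gen Oct)}
    (hA : IsGeneralizedMetric A) : IsGeneralizedMetric ((genMapEquiv h).conj A) := by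
  have h1 : ∀ E, (genMapEquiv h).conj A (genMapEquiv h E) = genMapEquiv h (A E) := fun E =>
    congrArg (fun F => genMapEquiv h (A F)) ((genMapEquiv h).symm_apply_apply E)
  have h2 : ∀ E, QuadraticForm.dualProd ℝ V (genMapEquiv h E) = QuadraticForm.dualProd ℝ Oct E :=
    fun E => congrArg E.1 (h.symm_apply_apply E.2)
  have h3 : ∀ E F, LinearMap.dualProd ℝ V (genMapEquiv h E) (genMapEquiv h F) =
      LinearMap.dualProd ℝ Oct E F := fun E F =>
    congrArg₂ (fun u w => F.1 u + E.1 w) (h.symm_apply_apply E.2) (h.symm_apply_apply F.2)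
  constructor
  · intro E
    obtain ⟨E, rfl⟩ := (genMapEquiv h).surjective E
    rw [h1, h2, h2, hA.isometry]
  · exact (LinearMap.det_conj A (genMapEquiv h)).trans hA.det_eq_one
  · intro E
    obtain ⟨E, rfl⟩ := (genMapEquiv h).surjective E
    rw [h1, h1, hA.sq_eq_one]
  · intro E hE
    obtain ⟨E, rfl⟩ := (genMapEquiv h).surjective E
    rw [h1, h3]
    exact hA.pos E fun h0 => hE (by rw [h0, map_zero])

end Transport

section Manifold

variable {X : Type*} [TopologicalSpace X] [ChartedSpace Oct X]

/-- The inverse of the differential of a chart. -/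
def chartEquiv [IsManifold (𝓡 8) ∞ X] {e : OpenPartialHomeomorph X Oct} (he : e ∈ atlas Oct X)
    {y : Oct} (hy : y ∈ e.target) : Oct ≃ₗ[ℝ] TangentSpace (𝓡 8) (e.symm y) :=
  have := IsManifold.of_le (I := 𝓡 8) (M := X) (m := 1) (n := ∞) (by simp)
  have hd := mdifferentiable_of_mem_atlas (I := 𝓡 8) he
  have h1 : (mfderiv (𝓡 8) 𝓘(ℝ, Oct) e (e.symm y)).comp (mfderiv 𝓘(ℝ, Oct) (𝓡 8) e.symm y) =
    ContinuousLinearMap.id ℝ _ := hd.comp_symm_deriv hy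
  have h2 : (mfderiv 𝓘(ℝ, Oct) (𝓡 8) e.symm y).comp (mfderiv (𝓡 8) 𝓘(ℝ, Oct) e (e.symm y)) =
    ContinuousLinearMap.id ℝ _ := by
      have h := hd.symm_comp_deriv (e.map_target hy)
      rwa [e.right_inv hy] at h
  LinearEquiv.ofLinearMap (chartSymmD e y) (chartD e y)
    (LinearMap.ext fun v => DFunLike.congr_fun h2 v)
    (LinearMap.ext fun v => DFunLike.congr_fun h1 v)

/-- The differential of the inverse chart is itself an admissible identification h, so the field
read in the chart is the metric induced by the form read in the chart. -/
theorem IsInducedBy.inChart_eq [IsManifold (𝓡 8) ∞ X] {G : GenEndField X} {Φ : FormField X}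
    (hG : IsInducedBy G Φ) {e : OpenPartialHomeomorph X Oct} (he : e ∈ atlas Oct X)
    {y : Oct} (hy : y ∈ e.target) {g : Cpin Oct}
    (hg : spinRep (g.1 : Cl Oct) (Φ.inChart e y) = PhiSpin) :
    G.inChart e y = inducedMetric g := by
  refine eq_inducedMetric fun E => ?_
  have h := LinearMap.congr_fun (hG _ (chartEquiv he hy) g hg.symm) E
  exact (congrArg (genMapEquiv (chartEquiv he hy)).symm h).trans
    ((genMapEquiv (chartEquiv he hy)).symm_apply_apply _)

theorem IsInducedBy.isSmooth [IsManifold (𝓡 8) ∞ X] {G : GenEndField X} {Φ : FormField X}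
    (hG : IsInducedBy G Φ) (hΦ : IsGeneralizedSpin7 Φ) : G.IsSmooth := by
  intro e he c
  refine contDiffOn_inducedMetric (hΦ.smooth e he) (fun y hy => ?_) c
  obtain ⟨h₀, hh₀⟩ := hΦ.mem_orbit (e.symm y)
  obtain ⟨g, hg⟩ := exists_spinRep_pullback_eq hh₀ (chartEquiv he hy)
  exact ⟨g, hg, hG.inChart_eq he hy hg⟩

theorem IsInducedBy.eq {G G' : GenEndField X} {Φ : FormField X} (hG : IsInducedBy G Φ)
    (hG' : IsInducedBy G' Φ) (hΦ : IsGeneralizedSpin7 Φ) : G = G' := by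
  funext x
  obtain ⟨h, hh⟩ := hΦ.mem_orbit x
  obtain ⟨g, hg⟩ := exists_spinRep_pullback_eq hh h
  refine LinearMap.ext fun E => ?_
  obtain ⟨E, rfl⟩ := (genMapEquiv h).surjective E
  obtain ⟨E, rfl⟩ := Ad_surjective g E
  exact (LinearMap.congr_fun (hG x h g hg.symm) E).trans
    (LinearMap.congr_fun (hG' x h g hg.symm) E).symm

theorem IsGeneralizedSpin7.exists_isInducedBy {Φ : FormField X} (hΦ : IsGeneralizedSpin7 Φ) :
    ∃ G : GenEndField X, (∀ x, IsGeneralizedMetric (G x)) ∧ IsInducedBy G Φ := by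
  choose h₀ hh₀ using hΦ.mem_orbit
  choose g₀ hg₀ using fun x => exists_spinRep_pullback_eq (hh₀ x) (h₀ x)
  exact ⟨fun x => (genMapEquiv (h₀ x)).conj (inducedMetric (g₀ x)),
    fun x => isGeneralizedMetric_conj (h₀ x) (isGeneralizedMetric_inducedMetric (g₀ x)),
    fun x h g hg => LinearMap.ext fun E => genMapEquiv_conj_inducedMetric (hg₀ x) hg.symm E⟩

end Manifold

end GenSpin

end

theorem mainTheorem9 :
    (Nonempty (GenSpin.H₀ ≃ₜ* GenSpin.Spin7 × GenSpin.Spin7) ∧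
      ∀ (g : (GenSpin.Cl GenSpin.Oct)ˣ) (hg : g ∈ GenSpin.H₀),
        GenSpin.Ad ⟨g, GenSpin.H₀_le_Cpin hg⟩ ∘ₗ GenSpin.G₀ =
          GenSpin.G₀ ∘ₗ GenSpin.Ad ⟨g, GenSpin.H₀_le_Cpin hg⟩) ∧
    ∀ (X : Type*) [TopologicalSpace X] [ChartedSpace GenSpin.Oct X] [IsManifold (𝓡 8) ∞ X]
      (Φ : GenSpin.FormField X), GenSpin.IsGeneralizedSpin7 Φ →
      ∃ G : GenSpin.GenEndField X,
        (∀ x, GenSpin.IsGeneralizedMetric (G x)) ∧ G.IsSmooth ∧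
        GenSpin.IsInducedBy G Φ ∧ ∀ G' : GenSpin.GenEndField X, GenSpin.IsInducedBy G' Φ → G' = G := by
  refine ⟨⟨GenSpin.nonempty_continuousMulEquiv, GenSpin.Ad_comp_G₀_of_mem_H₀⟩, ?_⟩
  intro X _ _ _ Φ hΦ
  obtain ⟨G, hG, hI⟩ := hΦ.exists_isInducedBy
  exact ⟨G, hG, hI.isSmooth hΦ, hI, fun G' hG' => hG'.eq hI hΦ⟩
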